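/- **Theorem 2.** *Model.* Fix $\tau\in(0,1)$ and a kernel $K\ge 0$ that is symmetric, bounded, integrates to one, has $\int u^2K(u)\,du<\infty$ and $\min_{|u|\le 1}K(u)>0$, and is differentiable with bounded derivative; write $K_h(u)=K(u/h)/h$. For each total sample size $N=mn$ (with $N\to\infty$; $m,n,p$, the distribution of $(X,Y)$ and $\beta^*$ may vary with $N$) let $(X_i,Y_i)_{i\le N}$ be i.i.d. copies of $(X,Y)$, stored in $m$ machines with $n$ observations each; $\mathcal M_1$ is the central machine. Here $X=(1,x_1,\dots,x_p)^{\rm T}$, $Y=X^{\rm T}\beta^*+\varepsilon$, $\mathbb P(\varepsilon\le 0\mid X)=\tau$, and $\varepsilon$ has a conditional density $f_{\varepsilon|X}$. Let $S=\{j:\beta^*_j\ne0\}$ be the support of $\beta^*\in\mathbb R^{p+1}$ and $s=|S|$. With constants not depending on $N$, assume: - $0<f_1\le f_{\varepsilon|X}(0)\le f_2$ a.s. and $|f_{\varepsilon|X}(u)-f_{\varepsilon|X}(v)|\le l_0|u-v|$ for all $u,v$, a.s.; - $\mathbb P(|X^{\rm T}\Sigma^{-1/2}\delta|\ge c_1t)\le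 2e^{-t^2/2}$ for all unit vectors $\delta$ and $t>0$, where $\Sigma=\mathbb E(XX^{\rm T})$ is positive definite; - $I=\mathbb E\{f_{\varepsilon|X}(0)XX^{\rm T}\}$ satisfies $\|I_{S^c\times S}I_{S\times S}^{-1}\|_\infty\le 1-\alpha$ (maximal absolute row sum) with $0<\alpha<1$, and $0<\lambda_-\le\Lambda_{\min}(I)\le\Lambda_{\max}(I)\le\lambda_+$; - $p=O(N^\nu)$ for some $\nu>0$, $n\ge N^c$ for some $0<c<1$, $s=O(n^r)$ for some $0\le r<1/3$; - the initial estimator satisfies $|\widehat\beta_0-\beta^*|_2=O_{\mathbb P}(\sqrt{s\log N/n})$ and $\mathbb P(\operatorname{supp}(\widehat\beta_0)\subseteq S)\to1$; - the bandwidths $h,b>0$ satisfy $h\asymp(s\log N/N)^{1/3}$ and $b\asymp(s\log n/n)^{1/3}$. *Algorithm.* Given $\widehat\beta_{g-1}$ put $e_i=Y_i-X_i^{\rm T}\widehat\beta_{g-1}$, $\widehat D_h=\frac1N\sum_{i\le N}K_h(e_i)X_iX_i^{\rm T}$, $\widehat D_{1,b}=\frac1n\sum_{i\in\mathcal M_1}K_b(e_i)X_iX_i^{\rm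 T}$ and $z_N=\frac1N\sum_{i\le N}\{K_h(e_i)X_iX_i^{\rm T}\widehat\beta_{g-1}-(I(e_i\le0)-\tau)X_i\}$. Then $\widehat\beta_g$ is a minimizer over $\beta\in\mathbb R^{p+1}$ (arbitrary where none exists) of $$\tfrac12\beta^{\rm T}\widehat D_{1,b}\beta-\beta^{\rm T}\{z_N+(\widehat D_{1,b}-\widehat D_h)\widehat\beta_{g-1}\}+\lambda_{N,g}|\beta|_1 ,\qquad \lambda_{N,g}=C_g\Big(\sqrt{\tfrac{\log N}{N}}+\kappa(\tfrac{5g}{6},g,g)\Big),$$ where $$\kappa(a,b,g)=\max\Big\{s^a\big(\tfrac{\log n}{n}\big)^{\frac{2g+3}{6}},\ s^b\big(\tfrac{\log N}{n}\big)^{\frac{g+1}{2}}\Big\}.$$ *Conclusion.* (1) For every fixed $t\ge1$, $$|\widehat\beta_t-\beta^*|_2=O_{\mathbb P}\Big(\sqrt{\tfrac{s\log N}{N}}+\kappa\big(\tfrac{5t+3}{6},\tfrac{2t+1}{2},t\big)\Big)$$ for sufficiently large constants $C_g$, in the following sense. For every $\epsilon>0$ there is $\Gamma$ such that whenever $C_1\ge\Gamma$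 and $C_{g+1}\ge\Gamma C_g$ for $1\le g<t$, there is $M$ with $\mathbb P(|\widehat\beta_t-\beta^*|_2>M\rho_N)\le\epsilon$ for all large $N$, where $\rho_N$ is the displayed rate. If moreover $\mathbb P(|\widehat\beta_0-\beta^*|_2\le M_0\sqrt{s\log N/n})\to1$ for some constant $M_0$, then $\Gamma$ can be chosen independently of $\epsilon$, so that $|\widehat\beta_t-\beta^*|_2=O_{\mathbb P}(\rho_N)$ for all fixed $C_1\ge\Gamma$, $C_{g+1}\ge\Gamma C_g$. (2) For all large $N$ and all $t\ge 1$, the second part of $\rho_N$ is at most $\sqrt{s\log N/N}$ as soon as $$t\ge\frac{3\log(m\log n/\log N)}{\log(n^2/(s^5\log^2n))}\quad\text{and}\quad t\ge\frac{\log m}{\log(n/(s^2\log N))}.\qquad(*)$$ Hence, if a fixed $t\ge1$ satisfies $(*)$ for all large $N$, then $|\widehat\beta_t-\beta^*|_2=O_{\mathbb P}(\sqrt{s\log N/N})$ in the sense of (1). (3) The right-hand sides of $(*)$, which grow logarithmically in $m$, are bounded: there is a constant $T$ such that every $t\ge T$ satisfies $(*)$ for all large $N$. -/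

import Mathlib

open MeasureTheory ProbabilityTheory Filter Asymptotics
open scoped Topology Matrix

noncomputable section

namespace DHSQR

/-- Vectors `(v₀, v₁, …, v_p)`; the coordinate `0` belongs to the intercept. -/
abbrev Vec (p : ℕ) := Fin (p + 1) → ℝ

def l1norm {p : ℕ} (v : Vec p) : ℝ := ∑ j, |v j|

def l2norm {p : ℕ} (v : Vec p) : ℝ := Real.sqrt (∑ j, v j ^ 2)

/-- The support of a coefficient vector. -/
def supp {p : ℕ} (v : Vec p) : Finset (Fin (p + 1)) := Finset.univ.filter (fun j => v j ≠ 0)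

/-! ### Kernel -/

structure IsSmoothingKernel (K : ℝ → ℝ) : Prop where
  symm : ∀ u, K (-u) = K u
  nonneg : ∀ u, 0 ≤ K u
  bounded : ∃ B, ∀ u, K u ≤ B
  integrable : Integrable K
  integral_eq_one : ∫ u, K u = 1
  second_moment : Integrable (fun u => u ^ 2 * K u)
  pos_on_unit : ∃ c > 0, ∀ u, |u| ≤ 1 → c ≤ K u
  differentiable : Differentiable ℝ K
  deriv_bounded : ∃ B, ∀ u, |deriv K u| ≤ B

/-- The rescaled kernel `K_h(u) = K(u / h) / h`. -/
def scaled (K : ℝ → ℝ) (h u : ℝ) : ℝ := K (u / h) / h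

/-- The indicator `I(e ≤ 0)`. -/
def indNonpos (e : ℝ) : ℝ := if e ≤ 0 then 1 else 0

/-! ### Population -/

/-- A linear quantile model: the law of the covariate vector `X`, the conditional density
`f x u` of the error `ε = Y - Xᵀβ*` at `u` given `X = x`, and the coefficient vector `β*`. -/
structure Population (p : ℕ) where
  lawX : Measure (Vec p)
  f : Vec p → ℝ → ℝ
  beta : Vec p

namespace Population

variable {p : ℕ} (P : Population p)

/-- The support `S` of `β*`. -/
def S : Finset (Fin (p + 1)) := supp P.beta

/-- The sparsity level `s = |S|`. -/
def s : ℕ := P.S.card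

/-- The joint law of `(X, ε)`. -/
def jointLaw : Measure (Vec p × ℝ) :=
  (P.lawX.prod volume).withDensity (fun z => ENNReal.ofReal (P.f z.1 z.2))

/-- `Σ = E(X Xᵀ)`. -/
def Sigma : Matrix (Fin (p + 1)) (Fin (p + 1)) ℝ :=
  Matrix.of fun i j => ∫ x, x i * x j ∂P.lawX

/-- `I = E(f_{ε|X}(0) X Xᵀ)`. -/
def info : Matrix (Fin (p + 1)) (Fin (p + 1)) ℝ :=
  Matrix.of fun i j => ∫ x, P.f x 0 * (x i * x j) ∂P.lawX

/-- `I_{Sᶜ × S} (I_{S × S})⁻¹`. -/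
def irrepMatrix : Matrix {j // j ∉ P.S} {j // j ∈ P.S} ℝ :=
  P.info.submatrix Subtype.val Subtype.val *
    (P.info.submatrix (Subtype.val : {j // j ∈ P.S} → _) (Subtype.val : {j // j ∈ P.S} → _))⁻¹

/-- The linear quantile model at level `τ`, together with the regularity assumptions on the
conditional density, sub-Gaussianity, irrepresentability and the eigenvalue bounds, with given
constants. -/
structure Regular (τ f₁ f₂ l₀ c₁ α lamMin lamMax : ℝ) : Prop where
  prob : IsProbabilityMeasure P.lawX
  intercept : ∀ᵐ x ∂P.lawX, x 0 = 1
  memLp_two : ∀ j, MemLp (fun x : Vec p => x j) 2 P.lawX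
  measurable_f : Measurable (Function.uncurry P.f)
  f_nonneg : ∀ x u, 0 ≤ P.f x u
  f_density : ∀ᵐ x ∂P.lawX, ∫⁻ u, ENNReal.ofReal (P.f x u) = 1
  /-- `P(Y ≤ Xᵀβ* | X) = τ`, that is, `Xᵀβ*` is the conditional `τ`-quantile of `Y`. -/
  quantile : ∀ᵐ x ∂P.lawX, ∫ u in Set.Iic (0 : ℝ), P.f x u = τ
  f_zero : ∀ᵐ x ∂P.lawX, f₁ ≤ P.f x 0 ∧ P.f x 0 ≤ f₂
  f_lipschitz : ∀ᵐ x ∂P.lawX, ∀ u v, |P.f x u - P.f x v| ≤ l₀ * |u - v|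
  /-- Sub-Gaussian covariates; `R` is the (unique) symmetric square root `Σ^{1/2}`. -/
  subGaussian : ∃ R : Matrix (Fin (p + 1)) (Fin (p + 1)) ℝ, R.PosDef ∧ R * R = P.Sigma ∧
    ∀ δ : Vec p, l2norm δ = 1 → ∀ t : ℝ, 0 < t →
      P.lawX.real {x | c₁ * t ≤ |x ⬝ᵥ (R⁻¹ *ᵥ δ)|} ≤ 2 * Real.exp (-t ^ 2 / 2)
  irrepresentable : ∀ i, ∑ j, |P.irrepMatrix i j| ≤ 1 - α
  /-- `lamMin ≤ Λ_min(I)` and `Λ_max(I) ≤ lamMax`. -/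
  eigen : ∀ v : Vec p, lamMin * l2norm v ^ 2 ≤ v ⬝ᵥ (P.info *ᵥ v) ∧
    v ⬝ᵥ (P.info *ᵥ v) ≤ lamMax * l2norm v ^ 2

end Population

/-! ### One step of the algorithm

The data are `X k i`, `Y k i`, where `k : Fin m` is the machine and `i : Fin n` the position on
the machine; machine `0` is the central one. -/

section Algorithm

variable {m n p : ℕ}

/-- Pseudo covariate `√K_h(e) X`, with `e = Y - Xᵀβ` the residual at the current iterate. -/
def pseudoX (K : ℝ → ℝ) (h : ℝ) (x : Vec p) (y : ℝ) (β : Vec p) : Vec p :=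
  Real.sqrt (scaled K h (y - x ⬝ᵥ β)) • x

/-- Pseudo response `X̃ᵀβ - (I(e ≤ 0) - τ) / √K_h(e)`. -/
def pseudoY (τ : ℝ) (K : ℝ → ℝ) (h : ℝ) (x : Vec p) (y : ℝ) (β : Vec p) : ℝ :=
  pseudoX K h x y β ⬝ᵥ β
    - 1 / Real.sqrt (scaled K h (y - x ⬝ᵥ β)) * (indNonpos (y - x ⬝ᵥ β) - τ)

/-- The product `X̃ Ỹ` of pseudo covariate and pseudo response after cancellation of `√K_h(e)`:
`X̃ X̃ᵀβ - (I(e ≤ 0) - τ) X`. It is meaningful also where `K_h(e) = 0`. -/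
def pseudoXY (τ : ℝ) (K : ℝ → ℝ) (h : ℝ) (x : Vec p) (y : ℝ) (β : Vec p) : Vec p :=
  (pseudoX K h x y β ⬝ᵥ β) • pseudoX K h x y β - (indNonpos (y - x ⬝ᵥ β) - τ) • x

theorem pseudoXY_eq (τ : ℝ) (K : ℝ → ℝ) (h : ℝ) (x : Vec p) (y : ℝ) (β : Vec p)
    (hpos : 0 < scaled K h (y - x ⬝ᵥ β)) :
    pseudoXY τ K h x y β = pseudoY τ K h x y β • pseudoX K h x y β := by
  have h0 : Real.sqrt (scaled K h (y - x ⬝ᵥ β)) ≠ 0 := (Real.sqrt_pos.mpr hpos).ne'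
  ext j
  simp only [pseudoXY, pseudoY, pseudoX, Pi.sub_apply, Pi.smul_apply, smul_eq_mul]
  field_simp

/-- `z_N`, the average of `X̃ Ỹ` over all machines. -/
def zVec (τ : ℝ) (K : ℝ → ℝ) (h : ℝ) (X : Fin m → Fin n → Vec p) (Y : Fin m → Fin n → ℝ)
    (β : Vec p) : Vec p :=
  (1 / ((m * n : ℕ) : ℝ)) • ∑ k, ∑ i, pseudoXY τ K h (X k i) (Y k i) β

/-- The Hessian `D̂_h` over all machines (global bandwidth). -/
def globalHessian (K : ℝ → ℝ) (h : ℝ) (X : Fin m → Fin n → Vec p) (Y : Fin m → Fin n → ℝ)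
    (β : Vec p) : Matrix (Fin (p + 1)) (Fin (p + 1)) ℝ :=
  (1 / ((m * n : ℕ) : ℝ)) • ∑ k, ∑ i,
    Matrix.vecMulVec (pseudoX K h (X k i) (Y k i) β) (pseudoX K h (X k i) (Y k i) β)

/-- The Hessian `D̂_{1,b}` of the central machine (local bandwidth). -/
def centralHessian [NeZero m] (K : ℝ → ℝ) (b : ℝ) (X : Fin m → Fin n → Vec p)
    (Y : Fin m → Fin n → ℝ) (β : Vec p) : Matrix (Fin (p + 1)) (Fin (p + 1)) ℝ :=
  (1 / (n : ℝ)) • ∑ i,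
    Matrix.vecMulVec (pseudoX K b (X 0 i) (Y 0 i) β) (pseudoX K b (X 0 i) (Y 0 i) β)

/-- The penalized shifted loss, as a function of `γ`, that is minimized in the step which starts
from the current iterate `β` and has penalty level `lam`. -/
def objective [NeZero m] (τ : ℝ) (K : ℝ → ℝ) (h b lam : ℝ) (X : Fin m → Fin n → Vec p)
    (Y : Fin m → Fin n → ℝ) (β γ : Vec p) : ℝ :=
  1 / (2 * (n : ℝ)) * ∑ i, (pseudoX K b (X 0 i) (Y 0 i) β ⬝ᵥ γ) ^ 2
    - γ ⬝ᵥ (zVec τ K h X Y β + (centralHessian K b X Y β - globalHessian K h X Y β) *ᵥ β)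
    + lam * l1norm γ

end Algorithm

/-! ### The distributed experiment -/

/-- All data of the experiment at one sample size: number of machines `m`, local sample size `n`,
dimension `p`, population, sample, initial estimator, global bandwidth `h`, local bandwidth `b`. -/
structure Experiment where
  m : ℕ
  n : ℕ
  p : ℕ
  m_ne : NeZero m
  pop : Population p
  Ω : Type*
  mΩ : MeasurableSpace Ω
  μ : Measure Ω
  X : Fin m → Fin n → Ω → Vec p
  Y : Fin m → Fin n → Ω → ℝ
  beta0 : Ω → Vec p
  h : ℝ
  b : ℝ

namespace Experiment

attribute [instance] Experiment.m_ne Experiment.mΩ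

variable (E : Experiment)

/-- The total sample size. -/
def N : ℕ := E.m * E.n

/-- The sparsity level. -/
def s : ℕ := E.pop.s

/-- The observations are independent, and `(Xᵢ, Yᵢ - Xᵢᵀβ*)` has the law that the population
prescribes; bandwidths are positive. -/
structure Valid : Prop where
  prob : IsProbabilityMeasure E.μ
  measurable_X : ∀ k i, Measurable (E.X k i)
  measurable_Y : ∀ k i, Measurable (E.Y k i)
  indep : iIndepFun (fun (ki : Fin E.m × Fin E.n) ω => (E.X ki.1 ki.2 ω, E.Y ki.1 ki.2 ω)) E.μ
  law : ∀ k i, E.μ.map (fun ω => (E.X k i ω, E.Y k i ω - E.X k i ω ⬝ᵥ E.pop.beta))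
    = E.pop.jointLaw
  measurable_beta0 : Measurable E.beta0
  h_pos : 0 < E.h
  b_pos : 0 < E.b

/-- `κ(a, b, g) = max {s^a (log n / n)^{(2g+3)/6}, s^b (log N / n)^{(g+1)/2}}`. -/
def kappa (a b g : ℝ) : ℝ :=
  max ((E.s : ℝ) ^ a * (Real.log E.n / E.n) ^ ((2 * g + 3) / 6))
    ((E.s : ℝ) ^ b * (Real.log E.N / E.n) ^ ((g + 1) / 2))

/-- The penalty `C (√(log N / N) + κ(5g/6, g, g))` of iteration `g`. -/
def penalty (C : ℝ) (g : ℕ) : ℝ :=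
  C * (Real.sqrt (Real.log E.N / E.N) + E.kappa (5 * (g : ℝ) / 6) g g)

/-- The rate `√(s log N / n)` of the initial estimator. -/
def initialRate : ℝ := Real.sqrt (E.s * Real.log E.N / E.n)

/-- The near-oracle rate `√(s log N / N)`. -/
def oracleRate : ℝ := Real.sqrt (E.s * Real.log E.N / E.N)

/-- The part `κ((5t+3)/6, (2t+1)/2, t)` of the rate of the `t`-th iterate. -/
def excessRate (t : ℕ) : ℝ :=
  E.kappa ((5 * (t : ℝ) + 3) / 6) ((2 * (t : ℝ) + 1) / 2) t

/-- The rate of the `t`-th iterate. -/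
def iterateRate (t : ℕ) : ℝ := E.oracleRate + E.excessRate t

/-- The condition on the number `t` of rounds, where `n = N / m`:
`t ≥ 3 log(m log n / log N) / log(n² / (s⁵ log² n))` and `t ≥ log m / log(n / (s² log N))`. -/
def EnoughRounds (t : ℕ) : Prop :=
  3 * Real.log (E.m * Real.log E.n / Real.log E.N)
      / Real.log ((E.n : ℝ) ^ 2 / ((E.s : ℝ) ^ 5 * Real.log E.n ^ 2)) ≤ t ∧
  Real.log E.m / Real.log ((E.n : ℝ) / ((E.s : ℝ) ^ 2 * Real.log E.N)) ≤ t

/-- `B 0, B 1, …, B t` is a run of the algorithm with penalty constants `C 1, …, C t`: it starts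
at the initial estimator, and `B (g + 1)` minimizes the objective built from `B g` wherever a
minimizer exists. -/
def IsRun (τ : ℝ) (K : ℝ → ℝ) (C : ℕ → ℝ) (t : ℕ) (B : ℕ → E.Ω → Vec E.p) : Prop :=
  B 0 = E.beta0 ∧ ∀ g < t, ∀ ω,
    let obj := objective τ K E.h E.b (E.penalty (C (g + 1)) (g + 1))
      (fun k i => E.X k i ω) (fun k i => E.Y k i ω) (B g ω)
    (∃ γ, IsMinOn obj Set.univ γ) → IsMinOn obj Set.univ (B (g + 1) ω)

/-- The `ℓ₂` error of an estimator. -/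
def err (B : E.Ω → Vec E.p) (ω : E.Ω) : ℝ := l2norm (B ω - E.pop.beta)

end Experiment

/-- `Z_k = O_P(a_k)`. -/
def IsBigOP (E : ℕ → Experiment) (Z : ∀ k, (E k).Ω → ℝ) (a : ℕ → ℝ) : Prop :=
  ∀ ε > 0, ∃ M > 0, ∀ᶠ k in atTop, (E k).μ.real {ω | M * a k < |Z k ω|} ≤ ε

/-- The penalty constants `C 1, …, C t` are sufficiently large relative to `Γ`. -/
def LargeConstants (Γ : ℝ) (t : ℕ) (C : ℕ → ℝ) : Prop :=
  Γ ≤ C 1 ∧ ∀ g, 1 ≤ g → g < t → Γ * C g ≤ C (g + 1)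

/-- The `t`-th iterate attains the rate `ρ` for sufficiently large penalty constants.
* For every `ε`, if the penalty constants are large (depending on `ε`), the error is at most a
  constant times `ρ` with probability at least `1 - ε`.
* If the bound on the initial estimator holds with one constant `M₀` with probability tending to
  one, then the penalty constants need not depend on any `ε`, and the error is `O_P(ρ)`. -/
def AttainsRate (E : ℕ → Experiment) (τ : ℝ) (K : ℝ → ℝ) (t : ℕ) (ρ : ℕ → ℝ) : Prop :=
  (∀ ε > 0, ∃ Γ > 0, ∀ C, LargeConstants Γ t C →
    ∀ B : ∀ k, ℕ → (E k).Ω → Vec (E k).p, (∀ k, (E k).IsRun τ K C t (B k)) →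
      ∃ M > 0, ∀ᶠ k in atTop, (E k).μ.real {ω | M * ρ k < (E k).err (B k t) ω} ≤ ε) ∧
  ((∃ M₀, Tendsto (fun k => (E k).μ.real
      {ω | (E k).err (E k).beta0 ω ≤ M₀ * (E k).initialRate}) atTop (𝓝 1)) →
    ∃ Γ > 0, ∀ C, LargeConstants Γ t C →
      ∀ B : ∀ k, ℕ → (E k).Ω → Vec (E k).p, (∀ k, (E k).IsRun τ K C t (B k)) →
        IsBigOP E (fun k => (E k).err (B k t)) ρ)

end DHSQR

end

/-!
The Hessian of the full sample cancels from the objective of a round (`objective_eq`): the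
round started at `β` minimizes a lasso objective whose smooth part has the Hessian
`D` of the central machine and the gradient `D (β⋆ - β) + G` at `β⋆`, where `G` is the score of the
check loss at `β`, averaged over all machines. So the global bandwidth plays no role except that
its order `(s log N / N)^{1/3}` and its positivity exclude an empty support.

Deterministic part. If `D` is close to the information matrix `I` on vectors supported in `S` and
the gradient at `β⋆` is small against the penalty, then every minimizer is supported in `S` and its
error is at most a multiple of `√s λ` (`primal_dual_witness`). Irrepresentability enters in
the form that each row of `I` outside `S` acts on such vectors as a combination of rows in `S`
with weights of `ℓ₁` norm at most `1 - α`.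

Stochastic part. All iterates are sparse, so it suffices to control score and Hessian at
`β = β⋆ + Δ` with `Δ` supported in `S`, uniformly over a ball of radius `log N √(s log N / n)`. The
residual is `ε - XᵀΔ`. Three events have probability tending to one (`exists_scoreEvent`,
`exists_incrEvent`, `exists_hessEvent`): the score at `β⋆` is `O(√(log N / N))`; its increment is
`IΔ + O(√(log N / N) + |Δ|²)`, the square being the bias of the linearization; the central Hessian
satisfies `D δ = I δ + O(b |δ|)`, where both the smoothing bias and, by the choice of `b`, the
fluctuation are of order `b`. The uniform bounds come from Bernstein's inequality at the points of
a grid. Between them, an indicator can only change where the residual is small (`nearStat`), and the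
kernel is Lipschitz.

Recursion. The linear terms `IΔ` of `DΔ` and of the score cancel, so an error `a` of the current
iterate contributes only `(A₂ + A₃) b a` to the gradient (`Experiment.InRegime.one_round`). As
`√s b κ(5g/6, g, g)` is at most a constant times `κ(5(g+1)/6, g+1, g+1)`, the errors follow the
claimed rates if each penalty constant dominates a fixed multiple of the previous one
(`Experiment.InRegime.iterates`). The events do not depend on the initial estimator or on the
penalty constants, whence the uniformity in `ε` when the initial bound holds with one constant.

Rounds. The two inequalities in `EnoughRounds` compare powers of the parts of the excess rate with
those of the oracle rate (`Experiment.InRegime.excessRate_le`). Since `s = O(n^r)` with `r < 1/3`,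
their denominators are at least of order `log n ≥ c log N`, so a constant number of rounds
suffices (`Experiment.InRegime.enoughRounds`).
-/

namespace DHSQR

/-! ### Norms and supports of coefficient vectors -/

section Norms

variable {p : ℕ}

/-- The vector `v` vanishes off `S`. -/
def SuppIn (S : Finset (Fin (p + 1))) (v : Vec p) : Prop := ∀ j, j ∉ S → v j = 0

theorem SuppIn.add {S : Finset (Fin (p + 1))} {u v : Vec p} (hu : SuppIn S u) (hv : SuppIn S v) :
    SuppIn S (u + v) := fun j hj => by simp [hu j hj, hv j hj]

theorem SuppIn.sub {S : Finset (Fin (p + 1))} {u v : Vec p} (hu : SuppIn S u) (hv : SuppIn S v) :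
    SuppIn S (u - v) := fun j hj => by simp [hu j hj, hv j hj]

theorem SuppIn.smul {S : Finset (Fin (p + 1))} {v : Vec p} (c : ℝ) (hv : SuppIn S v) :
    SuppIn S (c • v) := fun j hj => by simp [hv j hj]

theorem suppIn_iff {S : Finset (Fin (p + 1))} {v : Vec p} : SuppIn S v ↔ supp v ⊆ S := by
  constructor
  · intro h j hj
    by_contra hjS
    exact (Finset.mem_filter.1 hj).2 (h j hjS)
  · intro h j hj
    by_contra hv
    exact hj (h (Finset.mem_filter.2 ⟨Finset.mem_univ _, hv⟩))

theorem l2norm_eq_norm (v : Vec p) : l2norm v = ‖WithLp.toLp 2 v‖ := by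
  rw [EuclideanSpace.norm_eq, l2norm]
  congr 1
  exact Finset.sum_congr rfl fun j _ => by simp

theorem l2norm_nonneg (v : Vec p) : 0 ≤ l2norm v := Real.sqrt_nonneg _

theorem l2norm_sq (v : Vec p) : l2norm v ^ 2 = ∑ j, v j ^ 2 :=
  Real.sq_sqrt (Finset.sum_nonneg fun _ _ => sq_nonneg _)

theorem l2norm_add_le (u v : Vec p) : l2norm (u + v) ≤ l2norm u + l2norm v := by
  simp only [l2norm_eq_norm, WithLp.toLp_add]
  exact norm_add_le _ _

theorem l2norm_smul (c : ℝ) (v : Vec p) : l2norm (c • v) = |c| * l2norm v := by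
  simp only [l2norm_eq_norm, WithLp.toLp_smul, norm_smul, Real.norm_eq_abs]

theorem l2norm_zero : l2norm (0 : Vec p) = 0 := by
  simp [l2norm]

theorem abs_apply_le_l2norm (v : Vec p) (j : Fin (p + 1)) : |v j| ≤ l2norm v := by
  apply Real.abs_le_sqrt
  exact Finset.single_le_sum (f := fun j => v j ^ 2) (fun i _ => sq_nonneg (v i)) (Finset.mem_univ j)

theorem l2norm_pos {v : Vec p} (hv : v ≠ 0) : 0 < l2norm v := by
  obtain ⟨j, hj⟩ := Function.ne_iff.1 hv
  exact (abs_pos.2 hj).trans_le (abs_apply_le_l2norm v j)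

theorem l2norm_single (j : Fin (p + 1)) : l2norm (Pi.single j (1 : ℝ)) = 1 := by
  simp [l2norm, Pi.single_apply, ite_pow]

theorem dotProduct_single_one' (x : Vec p) (j : Fin (p + 1)) :
    x ⬝ᵥ Pi.single j (1 : ℝ) = x j := by simp

theorem l1norm_eq_sum_of_suppIn {S : Finset (Fin (p + 1))} {v : Vec p} (hv : SuppIn S v) :
    l1norm v = ∑ j ∈ S, |v j| := by
  refine (Finset.sum_subset (Finset.subset_univ S) ?_).symm
  intro j _ hj
  simp [hv j hj]

theorem l1norm_le_sqrt_card_mul {S : Finset (Fin (p + 1))} {v : Vec p} (hv : SuppIn S v) :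
    l1norm v ≤ Real.sqrt S.card * l2norm v := by
  rw [l1norm_eq_sum_of_suppIn hv, l2norm, ← Real.sqrt_mul (Nat.cast_nonneg _)]
  apply Real.le_sqrt_of_sq_le
  have h := Finset.sum_mul_sq_le_sq_mul_sq S (fun _ => (1 : ℝ)) (fun j => |v j|)
  simp only [one_mul, one_pow, Finset.sum_const, nsmul_eq_mul, mul_one, sq_abs] at h
  refine h.trans ?_
  gcongr
  exact Finset.subset_univ S

theorem l2norm_le_sqrt_card_mul {S : Finset (Fin (p + 1))} {v : Vec p} (hv : SuppIn S v) {a : ℝ}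
    (ha : 0 ≤ a) (h : ∀ j, |v j| ≤ a) : l2norm v ≤ Real.sqrt S.card * a := by
  rw [l2norm]
  apply Real.sqrt_le_iff.2 ⟨by positivity, ?_⟩
  rw [mul_pow, Real.sq_sqrt (Nat.cast_nonneg _),
    ← Finset.sum_subset (Finset.subset_univ S) (fun j _ hj => by simp [hv j hj])]
  calc ∑ j ∈ S, v j ^ 2 ≤ ∑ _j ∈ S, a ^ 2 := by
        refine Finset.sum_le_sum fun j _ => ?_
        rw [← sq_abs]
        exact pow_le_pow_left₀ (abs_nonneg _) (h j) 2
    _ = S.card * a ^ 2 := by simp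

theorem abs_dotProduct_le {u v : Vec p} {a : ℝ} (hu : ∀ j, v j ≠ 0 → |u j| ≤ a) :
    |u ⬝ᵥ v| ≤ a * l1norm v := by
  rw [l1norm, Finset.mul_sum]
  refine (Finset.abs_sum_le_sum_abs _ _).trans (Finset.sum_le_sum fun j _ => ?_)
  rw [abs_mul]
  by_cases h : v j = 0
  · simp [h]
  · exact mul_le_mul_of_nonneg_right (hu j h) (abs_nonneg _)

theorem l1norm_sub_le (u v : Vec p) : l1norm u - l1norm v ≤ l1norm (u - v) := by
  rw [l1norm, l1norm, l1norm, ← Finset.sum_sub_distrib]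
  exact Finset.sum_le_sum fun j _ => abs_sub_abs_le_abs_sub (u j) (v j)

theorem continuous_l2norm : Continuous (l2norm : Vec p → ℝ) := by
  unfold l2norm; fun_prop

theorem continuous_l1norm : Continuous (l1norm : Vec p → ℝ) := by
  unfold l1norm; fun_prop

end Norms

/-! ### The penalized quadratic problem -/

section PrimalDual

variable {p : ℕ}

/-- The lasso-type objective `½ γᵀDγ - γᵀ(Dβ - G) + λ|γ|₁`, whose smooth part has gradient
`D(γ - β) + G`. -/
noncomputable def quadObjective (D : Matrix (Fin (p + 1)) (Fin (p + 1)) ℝ) (β G : Vec p) (lam : ℝ)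
    (γ : Vec p) : ℝ :=
  1 / 2 * (γ ⬝ᵥ (D *ᵥ γ)) - γ ⬝ᵥ (D *ᵥ β - G) + lam * l1norm γ

variable {D : Matrix (Fin (p + 1)) (Fin (p + 1)) ℝ} {β G : Vec p} {lam : ℝ}

theorem continuous_quadObjective : Continuous (quadObjective D β G lam) := by
  unfold quadObjective
  have := continuous_l1norm (p := p)
  fun_prop

theorem dotProduct_mulVec_symm (hD : D.IsSymm) (u v : Vec p) :
    u ⬝ᵥ (D *ᵥ v) = v ⬝ᵥ (D *ᵥ u) := by
  rw [Matrix.dotProduct_mulVec, ← Matrix.mulVec_transpose, hD.eq, dotProduct_comm]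

theorem quadObjective_add (hD : D.IsSymm) (γ d : Vec p) :
    quadObjective D β G lam (γ + d) = quadObjective D β G lam γ
      + (D *ᵥ (γ - β) + G) ⬝ᵥ d + 1 / 2 * (d ⬝ᵥ (D *ᵥ d))
      + lam * (l1norm (γ + d) - l1norm γ) := by
  have h1 := dotProduct_mulVec_symm hD γ d
  simp only [quadObjective, Matrix.mulVec_add, Matrix.mulVec_sub, add_dotProduct, dotProduct_add,
    dotProduct_sub, sub_dotProduct, dotProduct_comm (D *ᵥ γ) d, dotProduct_comm (D *ᵥ β) d,
    dotProduct_comm G d, h1]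
  ring

/-- First-order optimality along a segment: no derivative of the penalty is needed, because the
penalty is convex. -/
theorem first_order_segment (hD : D.IsSymm) (hlam : 0 ≤ lam) {γ d : Vec p}
    (hmin : ∀ e : ℝ, 0 < e → e ≤ 1 →
      quadObjective D β G lam γ ≤ quadObjective D β G lam (γ + e • d)) :
    0 ≤ (D *ᵥ (γ - β) + G) ⬝ᵥ d + lam * (l1norm (γ + d) - l1norm γ) := by
  set a := (D *ᵥ (γ - β) + G) ⬝ᵥ d + lam * (l1norm (γ + d) - l1norm γ) with ha
  set q := 1 / 2 * (d ⬝ᵥ (D *ᵥ d)) with hq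
  have key : ∀ e : ℝ, 0 < e → e ≤ 1 → 0 ≤ a + e * q := by
    intro e he he1
    have h := hmin e he he1
    rw [quadObjective_add hD] at h
    have hconv : l1norm (γ + e • d) - l1norm γ ≤ e * (l1norm (γ + d) - l1norm γ) := by
      have hle : l1norm (γ + e • d) ≤ (1 - e) * l1norm γ + e * l1norm (γ + d) := by
        simp only [l1norm, Finset.mul_sum, ← Finset.sum_add_distrib]
        refine Finset.sum_le_sum fun j _ => ?_
        have : (γ + e • d) j = (1 - e) * γ j + e * (γ + d) j := by
          simp only [Pi.add_apply, Pi.smul_apply, smul_eq_mul]; ring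
        rw [this]
        refine (abs_add_le _ _).trans (le_of_eq ?_)
        rw [abs_mul, abs_mul, abs_of_nonneg (sub_nonneg.2 he1), abs_of_pos he]
      linarith
    have hconv' := mul_le_mul_of_nonneg_left hconv hlam
    simp only [dotProduct_smul, Matrix.mulVec_smul, smul_dotProduct, smul_eq_mul] at h
    have : 0 ≤ e * (a + e * q) := by rw [ha, hq]; linarith
    exact nonneg_of_mul_nonneg_right this he
  by_contra hneg
  push Not at hneg
  rcases le_or_gt q 0 with hq0 | hq0
  · have := key 1 one_pos le_rfl
    linarith
  · have he : 0 < min 1 (-a / (2 * q)) := lt_min one_pos (by apply div_pos <;> linarith)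
    have h := key _ he (min_le_left _ _)
    have h2 : min 1 (-a / (2 * q)) * q ≤ -a / (2 * q) * q :=
      mul_le_mul_of_nonneg_right (min_le_right _ _) hq0.le
    have h3 : -a / (2 * q) * q = -a / 2 := by field_simp
    linarith

theorem l1norm_add_single_le (γ : Vec p) (j : Fin (p + 1)) (c : ℝ) :
    l1norm (γ + c • Pi.single j (1 : ℝ)) - l1norm γ ≤ |c| := by
  refine (l1norm_sub_le _ _).trans (le_of_eq ?_)
  simp [l1norm, Pi.single_apply, apply_ite abs]

/-- The primal-dual witness argument in deterministic form. If `D` is close to a positive definite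
`A` that is irrepresentable on `S` (the row of `A` at `i ∉ S` is, on vectors supported in `S`, a
combination with weights `w i` of the rows in `S`), and the gradient `D(β⋆ - β) + G` of the smooth
part at `β⋆` is small against the penalty, then minimizers exist, and all of them are supported
in `S` and close to `β⋆`. -/
theorem primal_dual_witness (hD : D.IsSymm) (hpsd : ∀ v : Vec p, 0 ≤ v ⬝ᵥ (D *ᵥ v))
    {A : Matrix (Fin (p + 1)) (Fin (p + 1)) ℝ} {S : Finset (Fin (p + 1))} {κ α η : ℝ}
    (hκ : 0 < κ) (hα₀ : 0 < α) (hα₁ : α < 1) (hη : 0 ≤ η) (hlam : 0 < lam)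
    (hA : ∀ v : Vec p, κ * l2norm v ^ 2 ≤ v ⬝ᵥ (A *ᵥ v))
    (hirr : ∀ i, i ∉ S → ∃ w : Vec p, SuppIn S w ∧ l1norm w ≤ 1 - α ∧
      ∀ v : Vec p, SuppIn S v → (A *ᵥ v) i = w ⬝ᵥ (A *ᵥ v))
    (hDA : ∀ v : Vec p, SuppIn S v → ∀ j, |((D - A) *ᵥ v) j| ≤ η * l2norm v)
    (hηs : Real.sqrt S.card * η ≤ κ * α / 24)
    {βs : Vec p} (hβs : SuppIn S βs)
    (hg : ∀ j, |(D *ᵥ (βs - β) + G) j| ≤ α / 8 * lam) :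
    (∃ γ, IsMinOn (quadObjective D β G lam) Set.univ γ) ∧
    ∀ γ, IsMinOn (quadObjective D β G lam) Set.univ γ →
      SuppIn S γ ∧ l2norm (γ - βs) ≤ 3 / κ * (Real.sqrt S.card * lam) := by
  set g : Vec p := D *ᵥ (βs - β) + G with hgdef
  set rs : ℝ := Real.sqrt S.card with hrs
  have hrs0 : 0 ≤ rs := Real.sqrt_nonneg _
  set ρ : ℝ := 3 / κ * (rs * lam) with hρ
  have hρ0 : 0 ≤ ρ := by positivity
  have hDsplit : ∀ v : Vec p, D *ᵥ v = A *ᵥ v + (D - A) *ᵥ v := by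
    intro v; rw [← Matrix.add_mulVec]; congr 1; abel
  -- strong convexity on the support
  have hstrong : ∀ v : Vec p, SuppIn S v → 7 / 8 * κ * l2norm v ^ 2 ≤ v ⬝ᵥ (D *ᵥ v) := by
    intro v hv
    rw [hDsplit, dotProduct_add]
    have h1 : |((D - A) *ᵥ v) ⬝ᵥ v| ≤ η * l2norm v * l1norm v :=
      abs_dotProduct_le fun j _ => hDA v hv j
    rw [dotProduct_comm] at h1
    have h2 : η * l2norm v * l1norm v ≤ κ / 8 * l2norm v ^ 2 := by
      calc η * l2norm v * l1norm v ≤ η * l2norm v * (rs * l2norm v) := by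
            gcongr
            · exact mul_nonneg hη (l2norm_nonneg v)
            · exact l1norm_le_sqrt_card_mul hv
        _ = (rs * η) * l2norm v ^ 2 := by ring
        _ ≤ κ / 8 * l2norm v ^ 2 := by
            gcongr
            nlinarith
    have := hA v
    have := (abs_le.1 h1).1
    linarith
  -- restricted candidates far from `βs` are worse than `βs`
  have hclose : ∀ γ : Vec p, SuppIn S γ →
      quadObjective D β G lam γ ≤ quadObjective D β G lam βs → l2norm (γ - βs) ≤ ρ := by
    intro γ hγ hle
    set δ := γ - βs with hδ
    have hδS : SuppIn S δ := hγ.sub hβs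
    have hγe : γ = βs + δ := by rw [hδ]; abel
    rw [hγe, quadObjective_add hD, ← hgdef] at hle
    have h1 := hstrong δ hδS
    have h2 : |g ⬝ᵥ δ| ≤ α / 8 * lam * l1norm δ := abs_dotProduct_le fun j _ => hg j
    have h3 : l1norm βs - l1norm (βs + δ) ≤ l1norm δ := by
      have := l1norm_sub_le βs (βs + δ)
      have e : l1norm (βs - (βs + δ)) = l1norm δ := by
        simp [l1norm]
      rwa [e] at this
    have h4 : l1norm δ ≤ rs * l2norm δ := l1norm_le_sqrt_card_mul hδS
    have h5 := (abs_le.1 h2).1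
    have h6 := mul_le_mul_of_nonneg_left h3 hlam.le
    have h0 := l2norm_nonneg δ
    have h7 : 7 / 16 * κ * l2norm δ ^ 2 ≤ 9 / 8 * lam * (rs * l2norm δ) := by
      have h41 : (α / 8 * lam + lam) * l1norm δ ≤ (9 / 8 * lam) * (rs * l2norm δ) := by
        have : 0 ≤ l1norm δ := Finset.sum_nonneg fun _ _ => abs_nonneg _
        apply mul_le_mul _ h4 this (by positivity)
        nlinarith
      linarith
    rcases h0.eq_or_lt with h | h
    · rw [← h]; exact hρ0
    · have h8 : 7 / 16 * κ * l2norm δ ≤ 9 / 8 * lam * rs := by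
        have : (7 / 16 * κ * l2norm δ) * l2norm δ ≤ (9 / 8 * lam * rs) * l2norm δ := by
          nlinarith
        exact le_of_mul_le_mul_right this h
      rw [hρ, div_mul_eq_mul_div, le_div_iff₀ hκ]
      nlinarith [mul_nonneg hlam.le hrs0]
  -- a restricted minimizer
  obtain ⟨γh, hγS, hγmin⟩ : ∃ γh : Vec p, SuppIn S γh ∧
      ∀ γ, SuppIn S γ → quadObjective D β G lam γh ≤ quadObjective D β G lam γ := by
    have hcomp : IsCompact {γ : Vec p | SuppIn S γ ∧ l2norm (γ - βs) ≤ ρ} := by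
      apply Metric.isCompact_of_isClosed_isBounded
      · apply IsClosed.inter
        · have : {γ : Vec p | SuppIn S γ} = ⋂ j, ⋂ (_ : j ∉ S), {γ : Vec p | γ j = 0} := by
            ext; simp [SuppIn]
          change IsClosed {γ : Vec p | SuppIn S γ}
          rw [this]
          exact isClosed_iInter fun j => isClosed_iInter fun _ =>
            isClosed_eq (continuous_apply j) continuous_const
        · exact isClosed_le (continuous_l2norm.comp (continuous_id.sub continuous_const))
            continuous_const
      · refine (Metric.isBounded_closedBall (x := βs) (r := ρ)).subset ?_
        rintro γ ⟨-, hγ⟩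
        rw [Metric.mem_closedBall, dist_eq_norm, pi_norm_le_iff_of_nonneg hρ0]
        intro j
        exact (abs_apply_le_l2norm (γ - βs) j).trans hγ
    have hβmem : βs ∈ {γ : Vec p | SuppIn S γ ∧ l2norm (γ - βs) ≤ ρ} :=
      ⟨hβs, by rw [sub_self, l2norm_zero]; exact hρ0⟩
    obtain ⟨γh, hmem, hmin⟩ := hcomp.exists_isMinOn ⟨βs, hβmem⟩
      (continuous_quadObjective (D := D) (β := β) (G := G) (lam := lam)).continuousOn
    refine ⟨γh, hmem.1, fun γ hγ => ?_⟩
    by_contra hlt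
    push Not at hlt
    have h1 := isMinOn_iff.1 hmin βs hβmem
    have := isMinOn_iff.1 hmin γ ⟨hγ, hclose γ hγ (hlt.le.trans h1)⟩
    linarith
  have hγclose := hclose γh hγS (hγmin βs hβs)
  set δ := γh - βs with hδ
  have hδS : SuppIn S δ := hγS.sub hβs
  have hgrad : D *ᵥ (γh - β) + G = D *ᵥ δ + g := by
    rw [hgdef, hδ, ← add_assoc, ← Matrix.mulVec_add]
    congr 3; abel
  -- stationarity on the support
  have hstat : ∀ j ∈ S, |(D *ᵥ δ + g) j| ≤ lam := by
    intro j hj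
    have hs1 : ∀ c : ℝ, SuppIn S (c • Pi.single j (1 : ℝ) : Vec p) := by
      intro c i hi
      have : i ≠ j := fun h => hi (h ▸ hj)
      simp [this]
    have hone : ∀ c : ℝ, 0 ≤ c * (D *ᵥ δ + g) j + lam * |c| := by
      intro c
      have h := first_order_segment (d := c • Pi.single j (1 : ℝ)) hD hlam.le (γ := γh)
        (β := β) (G := G) (fun e _ _ => hγmin _ (hγS.add ((hs1 c).smul e)))
      rw [hgrad] at h
      have h2 := l1norm_add_single_le γh j c
      have h3 := mul_le_mul_of_nonneg_left h2 hlam.le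
      rw [dotProduct_smul, dotProduct_single_one', smul_eq_mul] at h
      linarith
    have ha := hone 1
    have hb := hone (-1)
    simp only [abs_one, abs_neg] at ha hb
    rw [abs_le]; constructor <;> linarith
  -- strict dual feasibility off the support
  have hηδ : η * l2norm δ ≤ α / 8 * lam := by
    calc η * l2norm δ ≤ η * ρ := by gcongr
      _ = 3 / κ * (rs * η) * lam := by rw [hρ]; ring
      _ ≤ 3 / κ * (κ * α / 24) * lam := by gcongr
      _ = α / 8 * lam := by field_simp; ring
  have hdual : ∀ j, j ∉ S → |(D *ᵥ δ + g) j| < lam := by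
    intro j hj
    obtain ⟨w, hwS, hw1, hw⟩ := hirr j hj
    have hrow : |w ⬝ᵥ (A *ᵥ δ)| ≤ (lam + α / 8 * lam + α / 8 * lam) * (1 - α) := by
      rw [dotProduct_comm]
      refine (abs_dotProduct_le (a := lam + α / 8 * lam + α / 8 * lam) ?_).trans ?_
      · intro i hi
        have hiS : i ∈ S := by by_contra h; exact hi (hwS i h)
        have e : (A *ᵥ δ) i = (D *ᵥ δ + g) i - g i - ((D - A) *ᵥ δ) i := by
          rw [hDsplit δ]; simp only [Pi.add_apply]; ring
        rw [e]
        have h1 := hstat i hiS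
        have h2 := hg i
        have h3 := (hDA δ hδS i).trans hηδ
        rw [abs_le] at h1 h2 h3 ⊢
        constructor <;> linarith
      · gcongr
    have e : (D *ᵥ δ + g) j = w ⬝ᵥ (A *ᵥ δ) + ((D - A) *ᵥ δ) j + g j := by
      rw [← hw δ hδS, hDsplit δ]; simp only [Pi.add_apply]
    rw [e]
    have h2 := hg j
    have h3 := (hDA δ hδS j).trans hηδ
    have h4 : (lam + α / 8 * lam + α / 8 * lam) * (1 - α) + α / 8 * lam + α / 8 * lam < lam := by
      nlinarith [mul_pos hα₀ hlam, mul_pos (mul_pos hα₀ hα₀) hlam]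
    rw [abs_le] at hrow h2 h3
    rw [abs_lt]
    constructor <;> linarith
  -- comparison of the restricted minimizer with an arbitrary vector
  have hcompare : ∀ γ : Vec p, quadObjective D β G lam γh
      + ∑ j ∈ Finset.univ.filter (· ∉ S), (lam - |(D *ᵥ δ + g) j|) * |γ j|
      ≤ quadObjective D β G lam γ := by
    intro γ
    set γS : Vec p := fun j => if j ∈ S then γ j else 0 with hγSdef
    have hγSS : SuppIn S γS := fun j hj => by simp [hγSdef, hj]
    have h := first_order_segment (d := γS - γh) hD hlam.le (γ := γh)
        (β := β) (G := G) (fun e _ _ => hγmin _ (hγS.add ((hγSS.sub hγS).smul e)))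
    rw [hgrad] at h
    have e1 : γh + (γS - γh) = γS := by abel
    rw [e1] at h
    have h2 := quadObjective_add (β := β) (G := G) (lam := lam) hD γh (γ - γh)
    have e2 : γh + (γ - γh) = γ := by abel
    rw [e2, hgrad] at h2
    have h3 := hpsd (γ - γh)
    have e3 : (D *ᵥ δ + g) ⬝ᵥ (γ - γh) = (D *ᵥ δ + g) ⬝ᵥ (γS - γh)
        + ∑ j ∈ Finset.univ.filter (· ∉ S), (D *ᵥ δ + g) j * γ j := by
      rw [Finset.sum_filter]
      simp only [dotProduct, ← Finset.sum_add_distrib]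
      refine Finset.sum_congr rfl fun j _ => ?_
      by_cases hj : j ∈ S <;> simp [hγSdef, hj, hγS j]
    have e4 : l1norm γ = l1norm γS + ∑ j ∈ Finset.univ.filter (· ∉ S), |γ j| := by
      rw [Finset.sum_filter]
      simp only [l1norm, ← Finset.sum_add_distrib]
      refine Finset.sum_congr rfl fun j _ => ?_
      by_cases hj : j ∈ S <;> simp [hγSdef, hj]
    have h5 : ∑ j ∈ Finset.univ.filter (· ∉ S), (lam - |(D *ᵥ δ + g) j|) * |γ j|
        ≤ ∑ j ∈ Finset.univ.filter (· ∉ S), (D *ᵥ δ + g) j * γ j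
          + lam * ∑ j ∈ Finset.univ.filter (· ∉ S), |γ j| := by
      rw [Finset.mul_sum, ← Finset.sum_add_distrib]
      refine Finset.sum_le_sum fun j _ => ?_
      have := neg_abs_le ((D *ᵥ δ + g) j * γ j)
      rw [abs_mul] at this
      linarith
    rw [h2, e3, e4]
    linarith
  have hterm : ∀ γ : Vec p, ∀ j ∈ Finset.univ.filter (· ∉ S),
      0 ≤ (lam - |(D *ᵥ δ + g) j|) * |γ j| := fun γ j hj =>
    mul_nonneg (sub_nonneg.2 (hdual j (Finset.mem_filter.1 hj).2).le) (abs_nonneg _)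
  refine ⟨⟨γh, isMinOn_iff.2 fun γ _ => ?_⟩, fun γ hγ => ?_⟩
  · have := hcompare γ
    have := Finset.sum_nonneg (hterm γ)
    linarith
  · have h1 := hcompare γ
    have h2 := isMinOn_iff.1 hγ γh (Set.mem_univ _)
    have hzero : ∑ j ∈ Finset.univ.filter (· ∉ S), (lam - |(D *ᵥ δ + g) j|) * |γ j| = 0 :=
      le_antisymm (by linarith) (Finset.sum_nonneg (hterm γ))
    have hS : SuppIn S γ := by
      intro j hj
      have h3 := (Finset.sum_eq_zero_iff_of_nonneg (hterm γ)).1 hzero j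
        (Finset.mem_filter.2 ⟨Finset.mem_univ _, hj⟩)
      rcases mul_eq_zero.1 h3 with h4 | h4
      · have := hdual j hj
        linarith
      · exact abs_eq_zero.1 h4
    exact ⟨hS, hclose γ hS (isMinOn_iff.1 hγ βs (Set.mem_univ _))⟩

end PrimalDual

/-! ### The objective of one round -/

section Round

variable {m n p : ℕ}

/-- The average score `(1/N) ∑ (I(e ≤ 0) - τ) X` of the check loss over all machines. -/
noncomputable def score (τ : ℝ) (X : Fin m → Fin n → Vec p) (Y : Fin m → Fin n → ℝ) (β : Vec p) :
    Vec p :=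
  (1 / ((m * n : ℕ) : ℝ)) • ∑ k, ∑ i, (indNonpos (Y k i - X k i ⬝ᵥ β) - τ) • X k i

theorem zVec_eq (τ : ℝ) (K : ℝ → ℝ) (h : ℝ) (X : Fin m → Fin n → Vec p) (Y : Fin m → Fin n → ℝ)
    (β : Vec p) : zVec τ K h X Y β = globalHessian K h X Y β *ᵥ β - score τ X Y β := by
  simp only [zVec, globalHessian, score, Matrix.smul_mulVec, Matrix.sum_mulVec,
    Matrix.vecMulVec_mulVec, ← smul_sub, ← Finset.sum_sub_distrib, pseudoXY, op_smul_eq_smul]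

/-- The Hessian of the full sample cancels from the objective: one round only sees the Hessian of
the central machine and the score of the full sample. -/
theorem objective_eq [NeZero m] (τ : ℝ) (K : ℝ → ℝ) (h b lam : ℝ) (X : Fin m → Fin n → Vec p)
    (Y : Fin m → Fin n → ℝ) (β : Vec p) :
    objective τ K h b lam X Y β
      = quadObjective (centralHessian K b X Y β) β (score τ X Y β) lam := by
  funext γ
  have h1 : zVec τ K h X Y β + (centralHessian K b X Y β - globalHessian K h X Y β) *ᵥ β
      = centralHessian K b X Y β *ᵥ β - score τ X Y β := by
    rw [zVec_eq, Matrix.sub_mulVec]; abel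
  have h2 : γ ⬝ᵥ (centralHessian K b X Y β *ᵥ γ)
      = 1 / (n : ℝ) * ∑ i, (pseudoX K b (X 0 i) (Y 0 i) β ⬝ᵥ γ) ^ 2 := by
    simp only [centralHessian, Matrix.smul_mulVec, Matrix.sum_mulVec, Matrix.vecMulVec_mulVec,
      op_smul_eq_smul, dotProduct_smul, dotProduct_sum, smul_eq_mul]
    congr 1
    refine Finset.sum_congr rfl fun i _ => ?_
    rw [dotProduct_comm γ, sq]
  rw [objective, quadObjective, h1, h2]
  ring

theorem centralHessian_isSymm [NeZero m] (K : ℝ → ℝ) (b : ℝ) (X : Fin m → Fin n → Vec p)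
    (Y : Fin m → Fin n → ℝ) (β : Vec p) : (centralHessian K b X Y β).IsSymm := by
  ext i j
  simp [centralHessian, Matrix.sum_apply, Matrix.vecMulVec_apply, mul_comm]

theorem centralHessian_nonneg [NeZero m] (K : ℝ → ℝ) (b : ℝ) (X : Fin m → Fin n → Vec p)
    (Y : Fin m → Fin n → ℝ) (β v : Vec p) : 0 ≤ v ⬝ᵥ (centralHessian K b X Y β *ᵥ v) := by
  simp only [centralHessian, Matrix.smul_mulVec, Matrix.sum_mulVec, Matrix.vecMulVec_mulVec,
    op_smul_eq_smul, dotProduct_smul, dotProduct_sum, smul_eq_mul]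
  refine mul_nonneg (by positivity) (Finset.sum_nonneg fun i _ => ?_)
  rw [dotProduct_comm v]
  exact mul_self_nonneg _

theorem centralHessian_mulVec_apply [NeZero m] {K : ℝ → ℝ} (hK : ∀ u, 0 ≤ K u) {b : ℝ}
    (hb : 0 < b) (X : Fin m → Fin n → Vec p) (Y : Fin m → Fin n → ℝ) (β v : Vec p)
    (j : Fin (p + 1)) :
    (centralHessian K b X Y β *ᵥ v) j
      = (∑ i, scaled K b (Y 0 i - X 0 i ⬝ᵥ β) * X 0 i j * (X 0 i ⬝ᵥ v)) / n := by
  have h0 : ∀ u, 0 ≤ scaled K b u := fun u => div_nonneg (hK _) hb.le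
  simp only [centralHessian, Matrix.smul_mulVec, Matrix.sum_mulVec, Matrix.vecMulVec_mulVec,
    op_smul_eq_smul, Pi.smul_apply, Finset.sum_apply, smul_eq_mul, pseudoX, smul_dotProduct]
  rw [one_div, inv_mul_eq_div]
  congr 1
  refine Finset.sum_congr rfl fun i _ => ?_
  have := Real.mul_self_sqrt (h0 (Y 0 i - X 0 i ⬝ᵥ β))
  calc _ = (√(scaled K b (Y 0 i - X 0 i ⬝ᵥ β)) * √(scaled K b (Y 0 i - X 0 i ⬝ᵥ β)))
        * X 0 i j * (X 0 i ⬝ᵥ v) := by ring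
    _ = _ := by rw [this]

theorem score_apply (τ : ℝ) (X : Fin m → Fin n → Vec p) (Y : Fin m → Fin n → ℝ) (β : Vec p)
    (j : Fin (p + 1)) :
    score τ X Y β j
      = (∑ ki : Fin m × Fin n,
          (indNonpos (Y ki.1 ki.2 - X ki.1 ki.2 ⬝ᵥ β) - τ) * X ki.1 ki.2 j) / (m * n : ℕ) := by
  simp only [score, Pi.smul_apply, Finset.sum_apply, smul_eq_mul]
  rw [one_div, inv_mul_eq_div, Fintype.sum_prod_type]

end Round

namespace Population

variable {p : ℕ} {P : Population p} {τ f₁ f₂ l₀ c₁ α lamMin lamMax : ℝ}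

theorem suppIn_beta : SuppIn P.S P.beta := suppIn_iff.2 subset_rfl

/-- Irrepresentability in terms of vectors supported in `S`. -/
theorem Regular.irrepresentable_row (hP : P.Regular τ f₁ f₂ l₀ c₁ α lamMin lamMax)
    (hlam : 0 < lamMin) (i : Fin (p + 1)) (hi : i ∉ P.S) :
    ∃ w : Vec p, SuppIn P.S w ∧ l1norm w ≤ 1 - α ∧
      ∀ v : Vec p, SuppIn P.S v → (P.info *ᵥ v) i = w ⬝ᵥ (P.info *ᵥ v) := by
  classical
  set A := P.info.submatrix (Subtype.val : {j // j ∉ P.S} → _) (Subtype.val : {j // j ∈ P.S} → _)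
    with hA
  set B := P.info.submatrix (Subtype.val : {j // j ∈ P.S} → _) (Subtype.val : {j // j ∈ P.S} → _)
    with hB
  -- a sum over `S` of a vector supported in `S` is the full sum
  have hsum : ∀ (u : Fin (p + 1) → ℝ), (∀ j, j ∉ P.S → u j = 0) →
      ∑ j, u j = ∑ j : {j // j ∈ P.S}, u j := by
    intro u hu
    rw [← Finset.sum_subset (Finset.subset_univ P.S) (fun j _ hj => hu j hj)]
    exact (Finset.sum_coe_sort P.S u).symm
  have hrow : ∀ (v : Vec p), SuppIn P.S v → ∀ k,
      (P.info *ᵥ v) k = ∑ j : {j // j ∈ P.S}, P.info k j * v j := by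
    intro v hv k
    rw [Matrix.mulVec, dotProduct, hsum]
    intro j hj
    rw [hv j hj, mul_zero]
  have hdet : IsUnit B.det := by
    rw [isUnit_iff_ne_zero]
    intro h0
    obtain ⟨v, hv0, hv⟩ := Matrix.exists_mulVec_eq_zero_iff.2 h0
    set u : Vec p := fun j => if h : j ∈ P.S then v ⟨j, h⟩ else 0 with hu
    have huS : SuppIn P.S u := fun j hj => by simp [hu, hj]
    have hval : ∀ j : {j // j ∈ P.S}, u j = v j := fun j => by simp [hu]
    have h1 : u ⬝ᵥ (P.info *ᵥ u) = 0 := by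
      rw [dotProduct, hsum]
      · refine Finset.sum_eq_zero fun k _ => ?_
        have := congrFun hv k
        rw [hrow u huS]
        simp only [Matrix.mulVec, dotProduct, hB, Matrix.submatrix_apply, Pi.zero_apply] at this
        simp only [hval, this, mul_zero]
      · intro j hj
        rw [huS j hj, zero_mul]
    have h2 := (hP.eigen u).1
    have hune : u ≠ 0 := by
      intro h
      apply hv0
      ext j
      rw [← hval j, h]; rfl
    have := l2norm_pos hune
    rw [h1] at h2
    have : 0 < lamMin * l2norm u ^ 2 := by positivity
    linarith
  set M := P.irrepMatrix with hM
  have hMB : M * B = A := by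
    rw [hM, irrepMatrix]
    exact Matrix.nonsing_inv_mul_cancel_right B A hdet
  refine ⟨fun j => if h : j ∈ P.S then M ⟨i, hi⟩ ⟨j, h⟩ else 0, fun j hj => by simp [hj], ?_, ?_⟩
  · have h1 := hP.irrepresentable ⟨i, hi⟩
    rw [l1norm, hsum]
    · simpa using h1
    · intro j hj
      simp [hj]
  · intro v hv
    have h1 : ∀ j : {j // j ∈ P.S}, P.info i j = ∑ k, M ⟨i, hi⟩ k * P.info k j := by
      intro j
      have := congrFun (congrFun hMB ⟨i, hi⟩) j
      rw [Matrix.mul_apply] at this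
      simpa [hA, hB] using this.symm
    rw [hrow v hv, dotProduct, hsum]
    · simp only [hrow v hv, h1, Finset.sum_mul, Finset.mul_sum]
      rw [Finset.sum_comm]
      refine Finset.sum_congr rfl fun k _ => Finset.sum_congr rfl fun j _ => ?_
      simp [mul_assoc]
    · intro j hj
      simp [hj]

end Population

/-! ### A Bernstein inequality -/

section Bernstein

theorem exp_le_one_add_add_sq_mul_exp (y : ℝ) :
    Real.exp y ≤ 1 + y + y ^ 2 * Real.exp |y| := by
  have h := Complex.norm_exp_sub_sum_le_norm_mul_exp (y : ℂ) 2
  have e : Complex.exp (y : ℂ) - ∑ m ∈ Finset.range 2, (y : ℂ) ^ m / (m.factorial : ℂ)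
      = ((Real.exp y - (1 + y) : ℝ) : ℂ) := by
    simp [Finset.sum_range_succ]
  rw [e, Complex.norm_real, Complex.norm_real, Real.norm_eq_abs, Real.norm_eq_abs, sq_abs] at h
  have := le_abs_self (Real.exp y - (1 + y))
  linarith

variable {Ω 𝒳 ι : Type*} {mΩ : MeasurableSpace Ω} {m𝒳 : MeasurableSpace 𝒳} {μ : Measure Ω}
  {ν : Measure 𝒳}

/-- `∫⁻ φ² e^{θ|φ|} ≤ V`: the exponential second moment that drives the Bernstein bound. -/
def ExpMoment (ν : Measure 𝒳) (φ : 𝒳 → ℝ) (θ V : ℝ) : Prop :=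
  ∫⁻ x, ENNReal.ofReal (φ x ^ 2 * Real.exp (θ * |φ x|)) ∂ν ≤ ENNReal.ofReal V

theorem ExpMoment.integrable_main {φ : 𝒳 → ℝ} (hφ : Measurable φ) {θ V : ℝ}
    (h : ExpMoment ν φ θ V) : Integrable (fun x => φ x ^ 2 * Real.exp (θ * |φ x|)) ν := by
  refine ⟨by fun_prop, ?_⟩
  rw [hasFiniteIntegral_iff_ofReal (Eventually.of_forall fun x => by positivity)]
  exact h.trans_lt ENNReal.ofReal_lt_top

theorem ExpMoment.integral_le {φ : 𝒳 → ℝ} (hφ : Measurable φ) {θ V : ℝ} (hV : 0 ≤ V)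
    (h : ExpMoment ν φ θ V) : ∫ x, φ x ^ 2 * Real.exp (θ * |φ x|) ∂ν ≤ V := by
  rw [integral_eq_lintegral_of_nonneg_ae (Eventually.of_forall fun x => by positivity)
    (by fun_prop)]
  exact ENNReal.toReal_le_of_le_ofReal hV h

theorem ExpMoment.integrable [IsFiniteMeasure ν] {φ : 𝒳 → ℝ} (hφ : Measurable φ) {θ V : ℝ}
    (hθ : 0 ≤ θ) (h : ExpMoment ν φ θ V) : Integrable φ ν := by
  refine ((integrable_const (1 : ℝ)).add (h.integrable_main hφ)).mono' (by fun_prop)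
    (Eventually.of_forall fun x => ?_)
  have h1 : (1 : ℝ) ≤ Real.exp (θ * |φ x|) := Real.one_le_exp (by positivity)
  have h2 : φ x ^ 2 ≤ φ x ^ 2 * Real.exp (θ * |φ x|) := le_mul_of_one_le_right (sq_nonneg _) h1
  have h3 : |φ x| ≤ 1 + φ x ^ 2 := by
    rw [← sq_abs]; nlinarith [sq_nonneg (|φ x| - 1), abs_nonneg (φ x)]
  simp only [Real.norm_eq_abs, Pi.add_apply]
  linarith

theorem ExpMoment.neg {φ : 𝒳 → ℝ} {θ V : ℝ} (h : ExpMoment ν φ θ V) :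
    ExpMoment ν (fun x => -φ x) θ V := by
  simpa [ExpMoment] using h

theorem ExpMoment.mono {φ : 𝒳 → ℝ} {θ V V' : ℝ} (h : ExpMoment ν φ θ V) (hV : V ≤ V') :
    ExpMoment ν φ θ V' := le_trans h (ENNReal.ofReal_le_ofReal hV)

theorem exp_mul_le_of_abs_le {y lam θ : ℝ} (hlam : |lam| ≤ θ) :
    Real.exp (lam * y) ≤ 1 + lam * y + lam ^ 2 * (y ^ 2 * Real.exp (θ * |y|)) := by
  refine (exp_le_one_add_add_sq_mul_exp _).trans ?_
  have : Real.exp |lam * y| ≤ Real.exp (θ * |y|) := by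
    rw [abs_mul]; gcongr
  have h2 := mul_le_mul_of_nonneg_left this (sq_nonneg (lam * y))
  nlinarith

theorem ExpMoment.integrable_exp [IsFiniteMeasure ν] {φ : 𝒳 → ℝ} (hφ : Measurable φ) {θ V : ℝ}
    (h : ExpMoment ν φ θ V) {lam : ℝ} (hlam : |lam| ≤ θ) :
    Integrable (fun x => Real.exp (lam * φ x)) ν := by
  have hθ : 0 ≤ θ := (abs_nonneg _).trans hlam
  refine (((integrable_const (1 : ℝ)).add ((h.integrable hφ hθ).const_mul lam)).add
    ((h.integrable_main hφ).const_mul (lam ^ 2))).mono' (by fun_prop)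
    (Eventually.of_forall fun x => ?_)
  rw [Real.norm_eq_abs, Real.abs_exp]
  exact exp_mul_le_of_abs_le hlam

theorem ExpMoment.integral_exp_le [IsProbabilityMeasure ν] {φ : 𝒳 → ℝ} (hφ : Measurable φ)
    {θ V : ℝ} (hV : 0 ≤ V) (h : ExpMoment ν φ θ V) {lam : ℝ} (hlam : |lam| ≤ θ) :
    ∫ x, Real.exp (lam * φ x) ∂ν ≤ Real.exp (lam * ∫ x, φ x ∂ν + lam ^ 2 * V) := by
  have hθ : 0 ≤ θ := (abs_nonneg _).trans hlam
  have i1 : Integrable (fun x => 1 + lam * φ x) ν :=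
    (integrable_const (1 : ℝ)).add ((h.integrable hφ hθ).const_mul lam)
  have i2 := (h.integrable_main hφ).const_mul (lam ^ 2)
  calc ∫ x, Real.exp (lam * φ x) ∂ν
      ≤ ∫ x, ((1 + lam * φ x) + lam ^ 2 * (φ x ^ 2 * Real.exp (θ * |φ x|))) ∂ν :=
        integral_mono (h.integrable_exp hφ hlam) (i1.add i2) fun x => exp_mul_le_of_abs_le hlam
    _ = 1 + lam * ∫ x, φ x ∂ν + lam ^ 2 * ∫ x, φ x ^ 2 * Real.exp (θ * |φ x|) ∂ν := by
        rw [integral_add i1 i2, integral_add (integrable_const _) ((h.integrable hφ hθ).const_mul _),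
          integral_const_mul, integral_const_mul]
        simp
    _ ≤ 1 + lam * ∫ x, φ x ∂ν + lam ^ 2 * V := by
        gcongr
        exact h.integral_le hφ hV
    _ ≤ Real.exp (lam * ∫ x, φ x ∂ν + lam ^ 2 * V) := by
        have := Real.add_one_le_exp (lam * ∫ x, φ x ∂ν + lam ^ 2 * V)
        linarith

/-- The sample average of `φ` over the observations `ξ i`. -/
noncomputable def emp [Fintype ι] (ξ : ι → Ω → 𝒳) (φ : 𝒳 → ℝ) (ω : Ω) : ℝ :=
  (∑ i, φ (ξ i ω)) / Fintype.card ι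

/-- The observations `ξ i` are independent with common law `ν`. -/
structure IsSample (ξ : ι → Ω → 𝒳) (μ : Measure Ω) (ν : Measure 𝒳) : Prop where
  measurable : ∀ i, Measurable (ξ i)
  indep : iIndepFun ξ μ
  law : ∀ i, μ.map (ξ i) = ν

theorem IsSample.upper_tail [Fintype ι] [Nonempty ι] [IsProbabilityMeasure μ]
    [IsProbabilityMeasure ν] {ξ : ι → Ω → 𝒳} (hξ : IsSample ξ μ ν) {φ : 𝒳 → ℝ}
    (hφ : Measurable φ) {θ V t : ℝ} (hV : 0 < V) (h : ExpMoment ν φ θ V) (ht : 0 ≤ t)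
    (htθ : t ≤ 2 * θ * V) :
    μ.real {ω | t ≤ emp ξ φ ω - ∫ x, φ x ∂ν}
      ≤ Real.exp (-(Fintype.card ι * t ^ 2 / (4 * V))) := by
  set c : ℝ := ((Fintype.card ι : ℕ) : ℝ) with hc
  have hc0 : 0 < c := by rw [hc]; exact_mod_cast Fintype.card_pos
  set a := ∫ x, φ x ∂ν with ha
  set lam := t / (2 * V) with hlam
  have hlam0 : 0 ≤ lam := by positivity
  have hlamθ : |lam| ≤ θ := by
    rw [abs_of_nonneg hlam0, hlam, div_le_iff₀ (by positivity)]; linarith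
  have hmeas : ∀ i, Measurable (fun ω => φ (ξ i ω)) := fun i => hφ.comp (hξ.measurable i)
  have hind : iIndepFun (fun i ω => φ (ξ i ω)) μ := hξ.indep.comp (fun _ => φ) fun _ => hφ
  have hint : ∀ i, Integrable (fun ω => Real.exp (lam * φ (ξ i ω))) μ := by
    intro i
    have h1 := h.integrable_exp hφ hlamθ
    rw [← hξ.law i] at h1
    exact h1.comp_measurable (hξ.measurable i)
  have hmgf : ∀ i, mgf (fun ω => φ (ξ i ω)) μ lam ≤ Real.exp (lam * a + lam ^ 2 * V) := by
    intro i
    have e : mgf (fun ω => φ (ξ i ω)) μ lam = ∫ x, Real.exp (lam * φ x) ∂ν := by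
      rw [mgf, ← hξ.law i, integral_map (hξ.measurable i).aemeasurable (by fun_prop)]
    rw [e]
    exact h.integral_exp_le hφ hV.le hlamθ
  have hsub : {ω | t ≤ emp ξ φ ω - a} ⊆ {ω | c * (t + a) ≤ (∑ i, fun ω => φ (ξ i ω)) ω} := by
    intro ω hω
    simp only [Set.mem_ofPred_eq, Finset.sum_apply, emp] at hω ⊢
    have : t + a ≤ (∑ i, φ (ξ i ω)) / c := by linarith
    rw [le_div_iff₀ hc0] at this
    linarith
  calc μ.real {ω | t ≤ emp ξ φ ω - a}
      ≤ μ.real {ω | c * (t + a) ≤ (∑ i, fun ω => φ (ξ i ω)) ω} := measureReal_mono hsub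
    _ ≤ Real.exp (-lam * (c * (t + a))) * mgf (∑ i, fun ω => φ (ξ i ω)) μ lam :=
        measure_ge_le_exp_mul_mgf _ hlam0
          (hind.integrable_exp_mul_sum hmeas fun i _ => hint i)
    _ ≤ Real.exp (-lam * (c * (t + a))) * Real.exp (c * (lam * a + lam ^ 2 * V)) := by
        gcongr
        rw [hind.mgf_sum hmeas]
        refine (Finset.prod_le_prod (fun _ _ => mgf_nonneg) fun i _ => hmgf i).trans ?_
        rw [Finset.prod_const, ← Real.exp_nat_mul, Finset.card_univ]
    _ = Real.exp (-(c * t ^ 2 / (4 * V))) := by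
        rw [← Real.exp_add]
        congr 1
        rw [hlam]
        field_simp
        ring

/-- **Bernstein's inequality** for sample averages, under an exponential second moment. -/
theorem IsSample.bernstein [Fintype ι] [Nonempty ι] [IsProbabilityMeasure μ]
    [IsProbabilityMeasure ν] {ξ : ι → Ω → 𝒳} (hξ : IsSample ξ μ ν) {φ : 𝒳 → ℝ}
    (hφ : Measurable φ) {θ V t : ℝ} (hV : 0 < V) (h : ExpMoment ν φ θ V) (ht : 0 ≤ t)
    (htθ : t ≤ 2 * θ * V) :
    μ.real {ω | t ≤ |emp ξ φ ω - ∫ x, φ x ∂ν|}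
      ≤ 2 * Real.exp (-(Fintype.card ι * t ^ 2 / (4 * V))) := by
  have h1 := hξ.upper_tail hφ hV h ht htθ
  have h2 := hξ.upper_tail (φ := fun x => -φ x) hφ.neg hV h.neg ht htθ
  have hsub : {ω | t ≤ |emp ξ φ ω - ∫ x, φ x ∂ν|} ⊆ {ω | t ≤ emp ξ φ ω - ∫ x, φ x ∂ν} ∪
      {ω | t ≤ emp ξ (fun x => -φ x) ω - ∫ x, -φ x ∂ν} := by
    intro ω hω
    rcases le_abs.1 (show t ≤ |emp ξ φ ω - ∫ x, φ x ∂ν| from hω) with h | h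
    · exact Or.inl h
    · right
      simp only [Set.mem_ofPred_eq, emp, Finset.sum_neg_distrib, integral_neg, neg_div] at h ⊢
      linarith
  refine (measureReal_mono hsub).trans ((measureReal_union_le _ _).trans ?_)
  linarith

theorem IsSample.integral_comp [IsProbabilityMeasure μ] {ξ : ι → Ω → 𝒳} (hξ : IsSample ξ μ ν)
    (i : ι) {φ : 𝒳 → ℝ} (hφ : Measurable φ) : ∫ ω, φ (ξ i ω) ∂μ = ∫ x, φ x ∂ν := by
  rw [← hξ.law i, integral_map (hξ.measurable i).aemeasurable hφ.aestronglyMeasurable]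

/-- Markov's inequality for the sample average of a nonnegative function. -/
theorem IsSample.markov [Fintype ι] [Nonempty ι] [IsProbabilityMeasure μ] {ξ : ι → Ω → 𝒳}
    (hξ : IsSample ξ μ ν) {φ : 𝒳 → ℝ} (hφ : Measurable φ) (h0 : ∀ x, 0 ≤ φ x)
    (hint : Integrable φ ν) {t : ℝ} (ht : 0 < t) :
    μ.real {ω | t ≤ emp ξ φ ω} ≤ (∫ x, φ x ∂ν) / t := by
  have hint' : ∀ i, Integrable (fun ω => φ (ξ i ω)) μ := fun i => by
    have h := hint
    rw [← hξ.law i] at h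
    exact h.comp_measurable (hξ.measurable i)
  have hi : Integrable (emp ξ φ) μ := (integrable_finsetSum _ fun i _ => hint' i).div_const _
  have h1 := mul_meas_ge_le_integral_of_nonneg
    (Eventually.of_forall fun ω => div_nonneg (Finset.sum_nonneg fun i _ => h0 (ξ i ω))
      (Nat.cast_nonneg _)) hi t
  have h2 : ∫ ω, emp ξ φ ω ∂μ = ∫ x, φ x ∂ν := by
    simp only [emp]
    rw [integral_div, integral_finsetSum _ fun i _ => hint' i]
    simp only [hξ.integral_comp _ hφ, Finset.sum_const, Finset.card_univ, nsmul_eq_mul]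
    have : (Fintype.card ι : ℝ) ≠ 0 := by exact_mod_cast Fintype.card_ne_zero
    field_simp
  rw [le_div_iff₀ ht, mul_comm]
  exact h1.trans h2.le

end Bernstein

/-! ### Sub-Gaussian covariates -/

/-- A Gaussian tail bounds a square-exponential moment (layer cake). -/
theorem lintegral_exp_sq_le {Ω : Type*} {mΩ : MeasurableSpace Ω} {μ : Measure Ω}
    [IsProbabilityMeasure μ] {W : Ω → ℝ} (hW : Measurable W) {σ : ℝ} (hσ : 0 < σ)
    (h : ∀ t : ℝ, 0 < t → μ.real {ω | σ * t ≤ |W ω|} ≤ 2 * Real.exp (-t ^ 2 / 2)) :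
    ∫⁻ ω, ENNReal.ofReal (Real.exp (W ω ^ 2 / (4 * σ ^ 2))) ∂μ ≤ 3 := by
  have hmeas : Measurable fun ω => Real.exp (W ω ^ 2 / (4 * σ ^ 2)) := by fun_prop
  rw [lintegral_eq_lintegral_meas_le μ (Eventually.of_forall fun ω => (Real.exp_pos _).le)
    hmeas.aemeasurable]
  have hsplit : Set.Ioi (0 : ℝ) = Set.Ioc 0 1 ∪ Set.Ioi 1 :=
    (Set.Ioc_union_Ioi_eq_Ioi zero_le_one).symm
  rw [hsplit]
  refine (lintegral_union_le _ _ _).trans ?_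
  have h1 : ∫⁻ t in Set.Ioc (0 : ℝ) 1, μ {ω | t ≤ Real.exp (W ω ^ 2 / (4 * σ ^ 2))} ≤ 1 := by
    calc _ ≤ ∫⁻ _t in Set.Ioc (0 : ℝ) 1, 1 := lintegral_mono fun t => prob_le_one
      _ = 1 := by simp
  have h2 : ∫⁻ t in Set.Ioi (1 : ℝ), μ {ω | t ≤ Real.exp (W ω ^ 2 / (4 * σ ^ 2))} ≤ 2 := by
    have hle : ∀ t ∈ Set.Ioi (1 : ℝ), μ {ω | t ≤ Real.exp (W ω ^ 2 / (4 * σ ^ 2))}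
        ≤ ENNReal.ofReal (2 * t ^ (-2 : ℝ)) := by
      intro t ht
      have ht1 : 1 < t := ht
      have ht0 : 0 < t := by linarith
      have hlog : 0 < Real.log t := Real.log_pos ht1
      set r := Real.sqrt (4 * Real.log t) with hr
      have hr0 : 0 < r := Real.sqrt_pos.2 (by positivity)
      have hr2 : r ^ 2 = 4 * Real.log t := Real.sq_sqrt (by positivity)
      have hsub : {ω | t ≤ Real.exp (W ω ^ 2 / (4 * σ ^ 2))} ⊆ {ω | σ * r ≤ |W ω|} := by
        intro ω hω
        have h3 : Real.log t ≤ W ω ^ 2 / (4 * σ ^ 2) := (Real.log_le_iff_le_exp ht0).2 hω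
        rw [le_div_iff₀ (by positivity)] at h3
        refine (sq_le_sq₀ (by positivity) (abs_nonneg (W ω))).1 ?_
        rw [sq_abs, mul_pow, hr2]
        linarith
      refine (measure_mono hsub).trans ?_
      rw [← ofReal_measureReal]
      apply ENNReal.ofReal_le_ofReal
      refine (h r hr0).trans (le_of_eq ?_)
      rw [hr2, Real.rpow_def_of_pos ht0]
      congr 2; ring
    have hint : IntegrableOn (fun t : ℝ => 2 * t ^ (-2 : ℝ)) (Set.Ioi 1) :=
      (integrableOn_Ioi_rpow_of_lt (by norm_num) one_pos).const_mul 2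
    calc _ ≤ ∫⁻ t in Set.Ioi (1 : ℝ), ENNReal.ofReal (2 * t ^ (-2 : ℝ)) :=
          setLIntegral_mono' measurableSet_Ioi hle
      _ = ENNReal.ofReal (∫ t in Set.Ioi (1 : ℝ), 2 * t ^ (-2 : ℝ)) := by
          rw [ofReal_integral_eq_lintegral_ofReal hint]
          filter_upwards [ae_restrict_mem measurableSet_Ioi] with t ht
          have : (0 : ℝ) < t := lt_trans one_pos ht
          positivity
      _ = 2 := by
          rw [integral_const_mul, integral_Ioi_rpow_of_lt (by norm_num) one_pos]
          norm_num
  calc _ ≤ (1 : ENNReal) + 2 := add_le_add h1 h2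
    _ = 3 := by norm_num

namespace Population

variable {p : ℕ} {P : Population p} {τ f₁ f₂ l₀ c₁ α lamMin lamMax : ℝ}

theorem Regular.measurable_f_zero (hP : P.Regular τ f₁ f₂ l₀ c₁ α lamMin lamMax) :
    Measurable fun x => P.f x 0 :=
  hP.measurable_f.comp (measurable_id.prodMk measurable_const)

theorem Regular.integrable_mul (hP : P.Regular τ f₁ f₂ l₀ c₁ α lamMin lamMax)
    (i j : Fin (p + 1)) : Integrable (fun x : Vec p => x i * x j) P.lawX :=
  (hP.memLp_two i).integrable_mul (hP.memLp_two j)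

theorem Regular.integrable_f_mul (hP : P.Regular τ f₁ f₂ l₀ c₁ α lamMin lamMax) {g : Vec p → ℝ}
    (hg : Integrable g P.lawX) : Integrable (fun x => P.f x 0 * g x) P.lawX := by
  refine hg.bdd_mul (c := f₂) hP.measurable_f_zero.aestronglyMeasurable ?_
  filter_upwards [hP.f_zero] with x hx
  rw [Real.norm_eq_abs, abs_of_nonneg (hP.f_nonneg x 0)]
  exact hx.2

theorem Regular.integrable_mul_dot (hP : P.Regular τ f₁ f₂ l₀ c₁ α lamMin lamMax)
    (j : Fin (p + 1)) (v : Vec p) : Integrable (fun x : Vec p => x j * (x ⬝ᵥ v)) P.lawX := by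
  simp only [dotProduct, Finset.mul_sum, ← mul_assoc]
  exact integrable_finsetSum _ fun i _ => (hP.integrable_mul j i).mul_const _

theorem Regular.integrable_dot_sq (hP : P.Regular τ f₁ f₂ l₀ c₁ α lamMin lamMax)
    (v : Vec p) : Integrable (fun x : Vec p => (x ⬝ᵥ v) ^ 2) P.lawX := by
  have : (fun x : Vec p => (x ⬝ᵥ v) ^ 2) = fun x => ∑ j, v j * (x j * (x ⬝ᵥ v)) := by
    funext x
    rw [sq, dotProduct, Finset.sum_mul]
    exact Finset.sum_congr rfl fun j _ => by ring
  rw [this]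
  exact integrable_finsetSum _ fun j _ => (hP.integrable_mul_dot j v).const_mul _

theorem Regular.info_mulVec_apply (hP : P.Regular τ f₁ f₂ l₀ c₁ α lamMin lamMax)
    (v : Vec p) (j : Fin (p + 1)) :
    (P.info *ᵥ v) j = ∫ x, P.f x 0 * (x j * (x ⬝ᵥ v)) ∂P.lawX := by
  have h : ∀ x : Vec p, P.f x 0 * (x j * (x ⬝ᵥ v)) = ∑ i, P.f x 0 * (x j * x i) * v i := by
    intro x
    simp only [dotProduct, Finset.mul_sum]
    exact Finset.sum_congr rfl fun i _ => by ring
  simp only [h]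
  rw [integral_finsetSum _ fun i _ => (hP.integrable_f_mul (hP.integrable_mul j i)).mul_const _]
  simp only [integral_mul_const]
  rfl

theorem Regular.dot_info (hP : P.Regular τ f₁ f₂ l₀ c₁ α lamMin lamMax) (v : Vec p) :
    v ⬝ᵥ (P.info *ᵥ v) = ∫ x, P.f x 0 * (x ⬝ᵥ v) ^ 2 ∂P.lawX := by
  have h : ∀ x : Vec p, P.f x 0 * (x ⬝ᵥ v) ^ 2
      = ∑ j, v j * (P.f x 0 * (x j * (x ⬝ᵥ v))) := by
    intro x
    conv_lhs => rw [sq]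
    conv_lhs => enter [2, 1]; rw [dotProduct]
    rw [Finset.sum_mul, Finset.mul_sum]
    exact Finset.sum_congr rfl fun i _ => by ring
  simp only [h]
  rw [integral_finsetSum _ fun i _ =>
    (hP.integrable_f_mul (hP.integrable_mul_dot i v)).const_mul _]
  simp only [integral_const_mul, ← hP.info_mulVec_apply]
  rfl

theorem Regular.dot_Sigma (hP : P.Regular τ f₁ f₂ l₀ c₁ α lamMin lamMax) (v : Vec p) :
    v ⬝ᵥ (P.Sigma *ᵥ v) = ∫ x, (x ⬝ᵥ v) ^ 2 ∂P.lawX := by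
  have h : ∀ x : Vec p, (x ⬝ᵥ v) ^ 2 = ∑ j, ∑ i, v j * (x j * x i * v i) := by
    intro x
    rw [sq, dotProduct, Finset.sum_mul]
    refine Finset.sum_congr rfl fun j _ => ?_
    rw [Finset.mul_sum]
    exact Finset.sum_congr rfl fun i _ => by ring
  simp only [h]
  rw [integral_finsetSum _ fun j _ => integrable_finsetSum _ fun i _ =>
    ((hP.integrable_mul j i).mul_const _).const_mul _]
  simp only [dotProduct]
  refine Finset.sum_congr rfl fun j _ => ?_
  rw [integral_finsetSum _ fun i _ => ((hP.integrable_mul j i).mul_const _).const_mul _]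
  simp only [integral_const_mul, integral_mul_const, Matrix.mulVec, dotProduct, Finset.mul_sum]
  rfl

theorem Regular.dot_Sigma_le (hP : P.Regular τ f₁ f₂ l₀ c₁ α lamMin lamMax) (hf₁ : 0 < f₁)
    (v : Vec p) : v ⬝ᵥ (P.Sigma *ᵥ v) ≤ lamMax / f₁ * l2norm v ^ 2 := by
  have h1 := (hP.eigen v).2
  rw [hP.dot_info] at h1
  rw [hP.dot_Sigma, div_mul_eq_mul_div, le_div_iff₀ hf₁, mul_comm, ← integral_const_mul]
  refine le_trans (integral_mono_ae ((hP.integrable_dot_sq v).const_mul _)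
    (hP.integrable_f_mul (hP.integrable_dot_sq v)) ?_) h1
  filter_upwards [hP.f_zero] with x hx
  exact mul_le_mul_of_nonneg_right hx.1 (sq_nonneg _)

/-- Linear functionals of the covariates have Gaussian tails. The scale uses `Σ ≤ I / f₁`. -/
theorem Regular.tail (hP : P.Regular τ f₁ f₂ l₀ c₁ α lamMin lamMax) (hf₁ : 0 < f₁)
    (hc₁ : 0 < c₁) (hlamMax : 0 < lamMax) {v : Vec p} (hv : l2norm v ≤ 1) {t : ℝ} (ht : 0 < t) :
    P.lawX.real {x | c₁ * Real.sqrt (lamMax / f₁) * t ≤ |x ⬝ᵥ v|}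
      ≤ 2 * Real.exp (-t ^ 2 / 2) := by
  have := hP.prob
  have hq : 0 < Real.sqrt (lamMax / f₁) := Real.sqrt_pos.2 (by positivity)
  rcases eq_or_ne v 0 with rfl | hv0
  · have : {x : Vec p | c₁ * Real.sqrt (lamMax / f₁) * t ≤ |x ⬝ᵥ (0 : Vec p)|} = ∅ := by
      ext x
      simp only [dotProduct_zero, abs_zero, Set.mem_ofPred_eq, Set.mem_empty_iff_false, iff_false,
        not_le]
      positivity
    rw [this, measureReal_empty]
    positivity
  obtain ⟨R, hR, hRR, htail⟩ := hP.subGaussian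
  have hdet : IsUnit R.det := (Matrix.isUnit_iff_isUnit_det R).1 hR.isUnit
  have hRs : R.IsSymm := by
    have := hR.isHermitian
    rwa [Matrix.IsHermitian, Matrix.conjTranspose_eq_transpose_of_trivial] at this
  set u := R *ᵥ v with hu
  have huv : R⁻¹ *ᵥ u = v := by
    rw [hu, Matrix.mulVec_mulVec, Matrix.nonsing_inv_mul R hdet, Matrix.one_mulVec]
  have hu0 : u ≠ 0 := by
    intro h
    apply hv0
    rw [← huv, h, Matrix.mulVec_zero]
  have hρ := l2norm_pos hu0
  have hu2 : l2norm u ^ 2 = v ⬝ᵥ (P.Sigma *ᵥ v) := by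
    rw [← hRR, ← Matrix.mulVec_mulVec, Matrix.dotProduct_mulVec, ← Matrix.mulVec_transpose, hRs.eq,
      ← hu, l2norm_sq, dotProduct]
    exact Finset.sum_congr rfl fun j _ => sq _
  have hule : l2norm u ≤ Real.sqrt (lamMax / f₁) := by
    apply Real.le_sqrt_of_sq_le
    rw [hu2]
    refine (hP.dot_Sigma_le hf₁ v).trans ?_
    have : l2norm v ^ 2 ≤ 1 := pow_le_one₀ (l2norm_nonneg v) hv
    exact mul_le_of_le_one_right (by positivity) this
  have hδ : l2norm ((l2norm u)⁻¹ • u) = 1 := by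
    rw [l2norm_smul, abs_of_pos (inv_pos.2 hρ), inv_mul_cancel₀ hρ.ne']
  refine (measureReal_mono ?_).trans (htail _ hδ t ht)
  intro x hx
  have hx' : c₁ * Real.sqrt (lamMax / f₁) * t ≤ |x ⬝ᵥ v| := hx
  rw [Set.mem_ofPred_eq, Matrix.mulVec_smul, huv, dotProduct_smul, smul_eq_mul, abs_mul,
    abs_of_pos (inv_pos.2 hρ), inv_mul_eq_div, le_div_iff₀ hρ]
  refine le_trans ?_ hx'
  have := mul_le_mul_of_nonneg_left hule (by positivity : (0 : ℝ) ≤ c₁ * t)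
  linarith

/-- The envelope that dominates every moment of the covariates needed below: products of powers
of two linear functionals with a factor that is exponential in their product. -/
noncomputable def envelope (θ : ℝ) (v w x : Vec p) : ℝ :=
  (1 + |x ⬝ᵥ v|) ^ 4 * (1 + |x ⬝ᵥ w|) ^ 4 *
    (Real.exp |x ⬝ᵥ v| * Real.exp (θ * (|x ⬝ᵥ v| * |x ⬝ᵥ w|)))

/-- The envelope has integral at most `C` for all directions in the unit ball. -/
def EnvelopeBound (P : Population p) (θ C : ℝ) : Prop :=
  ∀ v w : Vec p, l2norm v ≤ 1 → l2norm w ≤ 1 →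
    ∫⁻ x, ENNReal.ofReal (envelope θ v w x) ∂P.lawX ≤ ENNReal.ofReal C

theorem pow_mul_exp_le {θ : ℝ} (hθ : 0 < θ) {y : ℝ} (hy : 0 ≤ y) :
    (1 + y) ^ 8 * Real.exp (2 * y)
      ≤ 40320 * Real.exp (1 + 9 / (2 * θ)) * Real.exp (θ * y ^ 2 / 2) := by
  have h1 := Real.pow_div_factorial_le_exp (1 + y) (by linarith) 8
  have h2 : (1 + y) ^ 8 ≤ 40320 * Real.exp (1 + y) := by
    rw [div_le_iff₀ (by positivity)] at h1
    have : ((Nat.factorial 8 : ℕ) : ℝ) = 40320 := by norm_num [Nat.factorial]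
    rw [this] at h1
    linarith
  have h3 : 3 * y ≤ 9 / (2 * θ) + θ * y ^ 2 / 2 := by
    have h4 : 9 / (2 * θ) + θ * y ^ 2 / 2 - 3 * y = (θ * y - 3) ^ 2 / (2 * θ) := by
      field_simp; ring
    have : 0 ≤ (θ * y - 3) ^ 2 / (2 * θ) := by positivity
    linarith
  calc (1 + y) ^ 8 * Real.exp (2 * y) ≤ 40320 * Real.exp (1 + y) * Real.exp (2 * y) := by gcongr
    _ = 40320 * Real.exp (1 + 3 * y) := by rw [mul_assoc, ← Real.exp_add]; ring_nf
    _ ≤ 40320 * Real.exp (1 + 9 / (2 * θ) + θ * y ^ 2 / 2) :=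
        mul_le_mul_of_nonneg_left (Real.exp_le_exp.2 (by linarith)) (by norm_num)
    _ = _ := by rw [Real.exp_add (1 + 9 / (2 * θ)), mul_assoc]

theorem Regular.exists_envelopeBound (hf₁ : 0 < f₁) (hc₁ : 0 < c₁) (hlamMax : 0 < lamMax) :
    ∃ θ > 0, ∃ C > 0, ∀ {p : ℕ} {P : Population p},
      P.Regular τ f₁ f₂ l₀ c₁ α lamMin lamMax → P.EnvelopeBound θ C := by
  set σ := c₁ * Real.sqrt (lamMax / f₁) with hσ
  have hσ0 : 0 < σ := mul_pos hc₁ (Real.sqrt_pos.2 (by positivity))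
  set θ := 1 / (4 * σ ^ 2) with hθ
  have hθ0 : 0 < θ := by positivity
  set C := 40320 * Real.exp (1 + 9 / (2 * θ)) with hC
  have hC1 : 1 ≤ C := by
    have : 1 ≤ Real.exp (1 + 9 / (2 * θ)) := Real.one_le_exp (by positivity)
    rw [hC]; linarith
  refine ⟨θ / 2, by positivity, 3 * C, by positivity, fun {p P} hP v w hv hw => ?_⟩
  have := hP.prob
  have hexp : ∀ v : Vec p, l2norm v ≤ 1 →
      ∫⁻ x, ENNReal.ofReal (Real.exp (θ * (x ⬝ᵥ v) ^ 2)) ∂P.lawX ≤ 3 := by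
    intro v hv
    have h := lintegral_exp_sq_le (μ := P.lawX) (W := fun x => x ⬝ᵥ v)
      (by unfold dotProduct; fun_prop) hσ0 (fun t ht => hP.tail hf₁ hc₁ hlamMax hv ht)
    have e : ∀ y : ℝ, θ * y = y / (4 * σ ^ 2) := fun y => by rw [hθ]; ring
    simpa only [e] using h
  have hpt : ∀ x : Vec p, envelope (θ / 2) v w x
      ≤ C / 2 * Real.exp (θ * (x ⬝ᵥ v) ^ 2) + C / 2 * Real.exp (θ * (x ⬝ᵥ w) ^ 2) := by
    intro x
    rw [← sq_abs (x ⬝ᵥ v), ← sq_abs (x ⬝ᵥ w), envelope]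
    set a := |x ⬝ᵥ v|
    set c := |x ⬝ᵥ w|
    have ha : 0 ≤ a := abs_nonneg _
    have hc : 0 ≤ c := abs_nonneg _
    have e1 : Real.exp (θ / 2 * (a * c))
        ≤ Real.exp (θ * a ^ 2 / 4) * Real.exp (θ * c ^ 2 / 4) := by
      rw [← Real.exp_add]
      gcongr
      nlinarith [mul_nonneg hθ0.le (sq_nonneg (a - c))]
    set A := (1 + a) ^ 4 * Real.exp a * Real.exp (θ * a ^ 2 / 4)
    set B := (1 + c) ^ 4 * Real.exp (θ * c ^ 2 / 4)
    have hA : A ^ 2 ≤ C * Real.exp (θ * a ^ 2) := by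
      have h1 := pow_mul_exp_le hθ0 ha
      have e2 : A ^ 2 = (1 + a) ^ 8 * Real.exp (2 * a) * Real.exp (θ * a ^ 2 / 2) := by
        simp only [A, mul_pow, ← pow_mul, ← Real.exp_nat_mul]
        push_cast; ring_nf
      have e3 : Real.exp (θ * a ^ 2) = Real.exp (θ * a ^ 2 / 2) * Real.exp (θ * a ^ 2 / 2) := by
        rw [← Real.exp_add]; ring_nf
      rw [e2, e3, ← mul_assoc]
      gcongr
    have hB : B ^ 2 ≤ C * Real.exp (θ * c ^ 2) := by
      have h1 := pow_mul_exp_le hθ0 hc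
      have h1' : (1 + c) ^ 8 ≤ C * Real.exp (θ * c ^ 2 / 2) := by
        refine le_trans ?_ h1
        exact le_mul_of_one_le_right (by positivity) (Real.one_le_exp (by positivity))
      have e2 : B ^ 2 = (1 + c) ^ 8 * Real.exp (θ * c ^ 2 / 2) := by
        simp only [B, mul_pow, ← pow_mul, ← Real.exp_nat_mul]
        push_cast; ring_nf
      have e3 : Real.exp (θ * c ^ 2) = Real.exp (θ * c ^ 2 / 2) * Real.exp (θ * c ^ 2 / 2) := by
        rw [← Real.exp_add]; ring_nf
      rw [e2, e3, ← mul_assoc]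
      gcongr
    calc (1 + a) ^ 4 * (1 + c) ^ 4 * (Real.exp a * Real.exp (θ / 2 * (a * c)))
        ≤ (1 + a) ^ 4 * (1 + c) ^ 4 *
          (Real.exp a * (Real.exp (θ * a ^ 2 / 4) * Real.exp (θ * c ^ 2 / 4))) := by gcongr
      _ = A * B := by simp only [A, B]; ring
      _ ≤ A ^ 2 / 2 + B ^ 2 / 2 := by nlinarith [sq_nonneg (A - B)]
      _ ≤ _ := by linarith
  have hmeasv : ∀ v : Vec p, Measurable fun x : Vec p => x ⬝ᵥ v := fun v => by
    unfold dotProduct; fun_prop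
  calc ∫⁻ x, ENNReal.ofReal (envelope (θ / 2) v w x) ∂P.lawX
      ≤ ∫⁻ x, (ENNReal.ofReal (C / 2) * ENNReal.ofReal (Real.exp (θ * (x ⬝ᵥ v) ^ 2))
          + ENNReal.ofReal (C / 2) * ENNReal.ofReal (Real.exp (θ * (x ⬝ᵥ w) ^ 2))) ∂P.lawX := by
        refine lintegral_mono fun x => ?_
        rw [← ENNReal.ofReal_mul (by positivity), ← ENNReal.ofReal_mul (by positivity),
          ← ENNReal.ofReal_add (by positivity) (by positivity)]
        exact ENNReal.ofReal_le_ofReal (hpt x)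
    _ ≤ ENNReal.ofReal (C / 2) * 3 + ENNReal.ofReal (C / 2) * 3 := by
        have hv' := hmeasv v
        have hw' := hmeasv w
        rw [lintegral_add_left (by fun_prop), lintegral_const_mul _ (by fun_prop),
          lintegral_const_mul _ (by fun_prop)]
        gcongr
        · exact hexp v hv
        · exact hexp w hw
    _ = ENNReal.ofReal (3 * C) := by
        have e3 : (3 : ENNReal) = ENNReal.ofReal 3 := by simp
        rw [e3, ← ENNReal.ofReal_mul (by positivity), ← ENNReal.ofReal_add (by positivity)
          (by positivity)]
        congr 1; ring

end Population

/-! ### Smoothing and thresholding against a Lipschitz density -/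

section OneDim

/-- The first absolute moment of the kernel. -/
noncomputable def kernelMoment (K : ℝ → ℝ) : ℝ := ∫ u, |u| * K u

variable {K : ℝ → ℝ}

theorem IsSmoothingKernel.continuous (hK : IsSmoothingKernel K) : Continuous K :=
  hK.differentiable.continuous

theorem IsSmoothingKernel.integrable_abs_mul (hK : IsSmoothingKernel K) :
    Integrable fun u => |u| * K u := by
  have hc := hK.continuous
  refine (hK.integrable.add hK.second_moment).mono' (by fun_prop) (Eventually.of_forall fun u => ?_)
  have h0 := hK.nonneg u
  simp only [norm_mul, Real.norm_eq_abs, abs_abs, Pi.add_apply, abs_of_nonneg h0]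
  have : |u| ≤ 1 + u ^ 2 := by
    rw [← sq_abs]; nlinarith [sq_nonneg (|u| - 1), abs_nonneg u]
  nlinarith

theorem IsSmoothingKernel.kernelMoment_nonneg (hK : IsSmoothingKernel K) : 0 ≤ kernelMoment K :=
  integral_nonneg fun u => mul_nonneg (abs_nonneg u) (hK.nonneg u)

theorem integral_scaled_shift (F : ℝ → ℝ) {b : ℝ} (hb : 0 < b) (a : ℝ) :
    ∫ u, F ((u - a) / b) / b = ∫ u, F u := by
  rw [integral_sub_right_eq_self (fun u => F (u / b) / b) a, integral_div,
    Measure.integral_comp_div F b, abs_of_pos hb, smul_eq_mul, mul_div_cancel_left₀ _ hb.ne']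

theorem integrable_scaled_shift {F : ℝ → ℝ} (hF : Integrable F) {b : ℝ} (hb : 0 < b) (a : ℝ) :
    Integrable fun u => F ((u - a) / b) / b :=
  ((hF.comp_div hb.ne').comp_sub_right a).div_const b

theorem IsSmoothingKernel.scaled_nonneg (hK : IsSmoothingKernel K) {b : ℝ} (hb : 0 < b) (u : ℝ) :
    0 ≤ scaled K b u := div_nonneg (hK.nonneg _) hb.le

theorem IsSmoothingKernel.lintegral_scaled (hK : IsSmoothingKernel K) {b : ℝ} (hb : 0 < b)
    (a : ℝ) : ∫⁻ u, ENNReal.ofReal (scaled K b (u - a)) = 1 := by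
  have hi : Integrable fun u => scaled K b (u - a) := integrable_scaled_shift hK.integrable hb a
  rw [← ofReal_integral_eq_lintegral_ofReal hi
    (Eventually.of_forall fun u => hK.scaled_nonneg hb _)]
  have : ∫ u, scaled K b (u - a) = 1 := by
    rw [← hK.integral_eq_one]
    exact integral_scaled_shift K hb a
  rw [this, ENNReal.ofReal_one]

/-- Smoothing bias, of first order because the density is only Lipschitz. -/
theorem IsSmoothingKernel.bias (hK : IsSmoothingKernel K) {b : ℝ} (hb : 0 < b) (a : ℝ)
    {g : ℝ → ℝ} {l : ℝ} (hl : 0 ≤ l) (hg : ∀ u v, |g u - g v| ≤ l * |u - v|) :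
    |(∫ u, g u * scaled K b (u - a)) - g 0| ≤ l * (b * kernelMoment K + |a|) := by
  have hgc : Continuous g := by
    refine (LipschitzWith.of_dist_le_mul (K := ⟨l, hl⟩) fun u v => ?_).continuous
    exact hg u v
  have hKc := hK.continuous
  have i0 : Integrable fun u => scaled K b (u - a) := integrable_scaled_shift hK.integrable hb a
  have e0 : ∫ u, scaled K b (u - a) = 1 := by
    rw [← hK.integral_eq_one]
    exact integral_scaled_shift K hb a
  have i1 : Integrable fun u => |u - a| * scaled K b (u - a) := by
    have h := (integrable_scaled_shift hK.integrable_abs_mul hb a).const_mul b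
    refine h.congr (Eventually.of_forall fun u => ?_)
    simp only [scaled, abs_div, abs_of_pos hb]
    field_simp
  have e1 : ∫ u, |u - a| * scaled K b (u - a) = b * kernelMoment K := by
    rw [kernelMoment, ← integral_scaled_shift (fun u => |u| * K u) hb a, ← integral_const_mul]
    refine integral_congr_ae (Eventually.of_forall fun u => ?_)
    simp only [scaled, abs_div, abs_of_pos hb]
    field_simp
  have hbd : ∀ u, ‖(g u - g 0) * scaled K b (u - a)‖
      ≤ l * (|u - a| * scaled K b (u - a)) + l * |a| * scaled K b (u - a) := by
    intro u
    have hs := hK.scaled_nonneg hb (u - a)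
    rw [norm_mul, Real.norm_eq_abs, Real.norm_eq_abs, abs_of_nonneg hs]
    have h1 := hg u 0
    have h2 : |u - 0| ≤ |u - a| + |a| := by
      have := abs_add_le (u - a) a
      simpa using this
    calc |g u - g 0| * scaled K b (u - a) ≤ l * (|u - a| + |a|) * scaled K b (u - a) := by
          gcongr
          exact h1.trans (by gcongr)
      _ = _ := by ring
  have ibd := (i1.const_mul l).add (i0.const_mul (l * |a|))
  have i2 : Integrable fun u => (g u - g 0) * scaled K b (u - a) :=
    ibd.mono' (by unfold scaled; fun_prop) (Eventually.of_forall hbd)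
  have e2 : (∫ u, g u * scaled K b (u - a)) - g 0 = ∫ u, (g u - g 0) * scaled K b (u - a) := by
    have : (fun u => g u * scaled K b (u - a))
        = fun u => (g u - g 0) * scaled K b (u - a) + g 0 * scaled K b (u - a) := by
      funext u; ring
    rw [this, integral_add i2 (i0.const_mul _), integral_const_mul, e0]
    ring
  rw [e2]
  refine (norm_integral_le_of_norm_le ibd (Eventually.of_forall hbd)).trans (le_of_eq ?_)
  simp only [Pi.add_apply]
  rw [integral_add (i1.const_mul l) (i0.const_mul _), integral_const_mul, integral_const_mul, e0, e1]
  ring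

theorem measurable_indNonpos : Measurable indNonpos :=
  Measurable.ite measurableSet_Iic measurable_const measurable_const

/-- The change of the indicator `I(u ≤ a)` with `a`, as a signed indicator of an interval. -/
theorem indNonpos_sub_eq (a u : ℝ) : indNonpos (u - a) - indNonpos u
    = (Set.Ioc 0 a).indicator 1 u - (Set.Ioc a 0).indicator 1 u := by
  simp only [indNonpos, Set.indicator, Set.mem_Ioc, sub_nonpos, Pi.one_apply]
  split_ifs with h1 h2 h3 h4 <;> first | (norm_num; done) | (exfalso; grind)

theorem abs_indNonpos_sub (a u : ℝ) : |indNonpos (u - a) - indNonpos u|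
    = (Set.uIoc 0 a).indicator 1 u := by
  simp only [indNonpos, Set.indicator, Set.mem_uIoc, sub_nonpos, Pi.one_apply]
  split_ifs with h1 h2 h3 h4 <;> first | (norm_num; done) | (exfalso; grind)

theorem lintegral_abs_indNonpos_sub (a : ℝ) :
    ∫⁻ u, ENNReal.ofReal |indNonpos (u - a) - indNonpos u| = ENNReal.ofReal |a| := by
  have : ∀ u, ENNReal.ofReal |indNonpos (u - a) - indNonpos u|
      = (Set.uIoc 0 a).indicator 1 u := by
    intro u
    rw [abs_indNonpos_sub]
    by_cases h : u ∈ Set.uIoc 0 a <;> simp [h]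
  simp only [this]
  rw [lintegral_indicator_one measurableSet_uIoc, Real.volume_uIoc, sub_zero]

theorem indicator_bias (a : ℝ) {g : ℝ → ℝ} {l : ℝ} (hl : 0 ≤ l)
    (hg : ∀ u v, |g u - g v| ≤ l * |u - v|) :
    |(∫ u, g u * (indNonpos (u - a) - indNonpos u)) - g 0 * a| ≤ l * a ^ 2 := by
  have hgc : Continuous g := by
    refine (LipschitzWith.of_dist_le_mul (K := ⟨l, hl⟩) fun u v => ?_).continuous
    exact hg u v
  have e : (∫ u, g u * (indNonpos (u - a) - indNonpos u)) = ∫ u in (0 : ℝ)..a, g u := by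
    have h1 : ∀ u, g u * (indNonpos (u - a) - indNonpos u)
        = (Set.Ioc 0 a).indicator g u - (Set.Ioc a 0).indicator g u := by
      intro u
      rw [indNonpos_sub_eq, mul_sub]
      congr 1 <;> simp [Set.indicator]
    simp only [h1]
    rw [intervalIntegral, integral_sub, integral_indicator measurableSet_Ioc,
      integral_indicator measurableSet_Ioc]
    · exact (hgc.integrableOn_Icc.mono_set Set.Ioc_subset_Icc_self).integrable_indicator
        measurableSet_Ioc
    · exact (hgc.integrableOn_Icc.mono_set Set.Ioc_subset_Icc_self).integrable_indicator
        measurableSet_Ioc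
  have e2 : (∫ u in (0 : ℝ)..a, g u) - g 0 * a = ∫ u in (0 : ℝ)..a, (g u - g 0) := by
    rw [intervalIntegral.integral_sub (hgc.intervalIntegrable _ _) (by simp)]
    simp [mul_comm]
  rw [e, e2]
  have h := intervalIntegral.norm_integral_le_of_norm_le_const (a := (0 : ℝ)) (b := a)
    (f := fun u => g u - g 0) (C := l * |a|) ?_
  · refine h.trans (le_of_eq ?_)
    rw [sub_zero, mul_assoc, ← sq, sq_abs]
  · intro u hu
    refine (hg u 0).trans (mul_le_mul_of_nonneg_left ?_ hl)
    rw [sub_zero]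
    rcases Set.mem_uIoc.1 hu with h | h
    · rw [abs_of_pos h.1, abs_of_nonneg (h.1.le.trans h.2)]; exact h.2
    · rw [abs_of_nonpos h.2, abs_of_nonpos (h.1.le.trans h.2)]; linarith [h.1]

end OneDim

/-! ### Integration against the joint law -/

namespace Population

variable {p : ℕ} {P : Population p} {τ f₁ f₂ l₀ c₁ α lamMin lamMax : ℝ}

theorem measurable_dot (v : Vec p) : Measurable fun x : Vec p => x ⬝ᵥ v := by
  unfold dotProduct; fun_prop

theorem Regular.l₀_nonneg (hP : P.Regular τ f₁ f₂ l₀ c₁ α lamMin lamMax) : 0 ≤ l₀ := by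
  have := hP.prob
  obtain ⟨x, hx⟩ := hP.f_lipschitz.exists
  have := (abs_nonneg _).trans (hx 1 0)
  simpa using this

/-- A Lipschitz density is bounded. -/
theorem Regular.f_le (hP : P.Regular τ f₁ f₂ l₀ c₁ α lamMin lamMax) :
    ∀ᵐ x ∂P.lawX, ∀ u, P.f x u ≤ 1 + l₀ := by
  filter_upwards [hP.f_lipschitz, hP.f_density] with x hL hd u
  have h1 : ENNReal.ofReal (P.f x u - l₀) ≤ 1 := by
    calc ENNReal.ofReal (P.f x u - l₀)
        = ∫⁻ _v in Set.Icc u (u + 1), ENNReal.ofReal (P.f x u - l₀) := by simp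
      _ ≤ ∫⁻ v in Set.Icc u (u + 1), ENNReal.ofReal (P.f x v) := by
          refine setLIntegral_mono' measurableSet_Icc fun v hv => ENNReal.ofReal_le_ofReal ?_
          have h2 := (abs_le.1 (hL v u)).1
          have h3 : |v - u| ≤ 1 := by
            rw [abs_le]; constructor <;> linarith [hv.1, hv.2]
          have h4 := mul_le_mul_of_nonneg_left h3 hP.l₀_nonneg
          linarith
      _ ≤ ∫⁻ v, ENNReal.ofReal (P.f x v) := setLIntegral_le_lintegral _ _
      _ = 1 := hd
  rw [ENNReal.ofReal_le_one] at h1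
  linarith

theorem Regular.measurable_density (hP : P.Regular τ f₁ f₂ l₀ c₁ α lamMin lamMax) :
    Measurable fun z : Vec p × ℝ => ENNReal.ofReal (P.f z.1 z.2) :=
  hP.measurable_f.ennreal_ofReal

theorem Regular.lintegral_jointLaw (hP : P.Regular τ f₁ f₂ l₀ c₁ α lamMin lamMax)
    {g : Vec p × ℝ → ENNReal} (hg : Measurable g) :
    ∫⁻ z, g z ∂P.jointLaw = ∫⁻ x, (∫⁻ u, ENNReal.ofReal (P.f x u) * g (x, u)) ∂P.lawX := by
  have := hP.prob
  rw [jointLaw, lintegral_withDensity_eq_lintegral_mul _ hP.measurable_density hg,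
    lintegral_prod _ (hP.measurable_density.mul hg).aemeasurable]
  rfl

theorem Regular.lintegral_jointLaw_fst (hP : P.Regular τ f₁ f₂ l₀ c₁ α lamMin lamMax)
    {g : Vec p → ENNReal} (hg : Measurable g) :
    ∫⁻ z, g z.1 ∂P.jointLaw = ∫⁻ x, g x ∂P.lawX := by
  rw [hP.lintegral_jointLaw (g := fun z => g z.1) (hg.comp measurable_fst)]
  refine lintegral_congr_ae ?_
  filter_upwards [hP.f_density] with x hx
  have hm : Measurable fun u => ENNReal.ofReal (P.f x u) :=
    hP.measurable_density.comp (measurable_const.prodMk measurable_id)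
  rw [lintegral_mul_const _ hm, hx, one_mul]

theorem Regular.isProbabilityMeasure_jointLaw
    (hP : P.Regular τ f₁ f₂ l₀ c₁ α lamMin lamMax) : IsProbabilityMeasure P.jointLaw := by
  have := hP.prob
  constructor
  rw [← lintegral_one]
  have := hP.lintegral_jointLaw_fst (g := fun _ => 1) measurable_const
  simpa using this

/-- Integration over `u` first, with the density bounded by `1 + l₀`. -/
theorem Regular.lintegral_jointLaw_le (hP : P.Regular τ f₁ f₂ l₀ c₁ α lamMin lamMax)
    {g : Vec p × ℝ → ℝ} (hg : Measurable g) {k : Vec p → ℝ → ℝ} {W κ : Vec p → ℝ}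
    (hW : ∀ x, 0 ≤ W x) (hgk : ∀ x u, g (x, u) ≤ W x * k x u)
    (hk : ∀ x, ∫⁻ u, ENNReal.ofReal (k x u) ≤ ENNReal.ofReal (κ x)) :
    ∫⁻ z, ENNReal.ofReal (g z) ∂P.jointLaw
      ≤ ENNReal.ofReal (1 + l₀) * ∫⁻ x, ENNReal.ofReal (W x * κ x) ∂P.lawX := by
  have hl := hP.l₀_nonneg
  rw [hP.lintegral_jointLaw hg.ennreal_ofReal, ← lintegral_const_mul' _ _ ENNReal.ofReal_ne_top]
  refine lintegral_mono_ae ?_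
  filter_upwards [hP.f_le] with x hx
  calc ∫⁻ u, ENNReal.ofReal (P.f x u) * ENNReal.ofReal (g (x, u))
      ≤ ∫⁻ u, ENNReal.ofReal (1 + l₀) * (ENNReal.ofReal (W x) * ENNReal.ofReal (k x u)) := by
        refine lintegral_mono fun u => ?_
        rw [← ENNReal.ofReal_mul (hW x)]
        exact mul_le_mul' (ENNReal.ofReal_le_ofReal (hx u)) (ENNReal.ofReal_le_ofReal (hgk x u))
    _ = ENNReal.ofReal (1 + l₀) * (ENNReal.ofReal (W x) * ∫⁻ u, ENNReal.ofReal (k x u)) := by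
        rw [lintegral_const_mul' _ _ ENNReal.ofReal_ne_top,
          lintegral_const_mul' _ _ ENNReal.ofReal_ne_top]
    _ ≤ ENNReal.ofReal (1 + l₀) * ENNReal.ofReal (W x * κ x) := by
        rw [ENNReal.ofReal_mul (hW x)]
        gcongr
        exact hk x

theorem Regular.integral_jointLaw (hP : P.Regular τ f₁ f₂ l₀ c₁ α lamMin lamMax)
    {φ : Vec p × ℝ → ℝ} (hφ : Integrable φ P.jointLaw) :
    Integrable (fun x => ∫ u, P.f x u * φ (x, u)) P.lawX ∧
    ∫ z, φ z ∂P.jointLaw = ∫ x, (∫ u, P.f x u * φ (x, u)) ∂P.lawX := by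
  have := hP.prob
  have htop : ∀ᵐ z ∂(P.lawX.prod volume), ENNReal.ofReal (P.f z.1 z.2) < ⊤ :=
    Eventually.of_forall fun _ => ENNReal.ofReal_lt_top
  have e : ∀ z : Vec p × ℝ, (ENNReal.ofReal (P.f z.1 z.2)).toReal • φ z = P.f z.1 z.2 * φ z :=
    fun z => by rw [ENNReal.toReal_ofReal (hP.f_nonneg _ _), smul_eq_mul]
  have hi : Integrable (fun z : Vec p × ℝ => P.f z.1 z.2 * φ z) (P.lawX.prod volume) := by
    have := (integrable_withDensity_iff_integrable_smul' hP.measurable_density htop).1 hφ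
    simpa only [e] using this
  refine ⟨hi.integral_prod_left, ?_⟩
  rw [jointLaw, integral_withDensity_eq_integral_toReal_smul hP.measurable_density htop]
  simp only [e]
  exact integral_prod _ hi

/-- Comparison of an expectation under the joint law with its value for `u` near `0`. -/
theorem Regular.abs_integral_jointLaw_sub_le (hP : P.Regular τ f₁ f₂ l₀ c₁ α lamMin lamMax)
    {φ : Vec p × ℝ → ℝ} (hφ : Integrable φ P.jointLaw) {k : Vec p → ℝ → ℝ} {W κ e : Vec p → ℝ}
    (hφk : ∀ x u, φ (x, u) = k x u * W x)
    (hk : ∀ᵐ x ∂P.lawX, |(∫ u, P.f x u * k x u) - P.f x 0 * κ x| ≤ e x)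
    (hκ : Integrable (fun x => P.f x 0 * (κ x * W x)) P.lawX)
    (he : Integrable (fun x => e x * |W x|) P.lawX) :
    |(∫ z, φ z ∂P.jointLaw) - ∫ x, P.f x 0 * (κ x * W x) ∂P.lawX|
      ≤ ∫ x, e x * |W x| ∂P.lawX := by
  obtain ⟨hi, hint⟩ := hP.integral_jointLaw hφ
  rw [hint, ← integral_sub hi hκ, ← Real.norm_eq_abs]
  refine norm_integral_le_of_norm_le he ?_
  filter_upwards [hk] with x hx
  have : (∫ u, P.f x u * φ (x, u)) = (∫ u, P.f x u * k x u) * W x := by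
    rw [← integral_mul_const]
    refine integral_congr_ae (Eventually.of_forall fun u => ?_)
    simp only [hφk]; ring
  rw [this, Real.norm_eq_abs, ← mul_assoc, ← sub_mul, abs_mul]
  gcongr

/-! ### Moments below the envelope -/

theorem envelope_nonneg (θ : ℝ) (v w x : Vec p) : 0 ≤ envelope θ v w x := by
  unfold envelope; positivity

theorem measurable_envelope (θ : ℝ) (v w : Vec p) : Measurable (envelope θ v w) := by
  have h1 := measurable_dot v
  have h2 := measurable_dot w
  unfold envelope
  fun_prop

theorem le_envelope {θ : ℝ} (v w x : Vec p) {a b : ℕ} (ha : a ≤ 4) (hb : b ≤ 4) :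
    |x ⬝ᵥ v| ^ a * |x ⬝ᵥ w| ^ b * (Real.exp |x ⬝ᵥ v| * Real.exp (θ * (|x ⬝ᵥ v| * |x ⬝ᵥ w|)))
      ≤ envelope θ v w x := by
  have key : ∀ (y : ℝ) (n : ℕ), 0 ≤ y → n ≤ 4 → y ^ n ≤ (1 + y) ^ 4 := fun y n hy hn =>
    (pow_le_pow_left₀ hy (by linarith) n).trans (pow_le_pow_right₀ (by linarith) hn)
  unfold envelope
  gcongr
  · exact key _ a (abs_nonneg _) ha
  · exact key _ b (abs_nonneg _) hb

theorem pow_mul_pow_le_envelope {θ : ℝ} (hθ : 0 ≤ θ) (v w x : Vec p) {a b : ℕ} (ha : a ≤ 4)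
    (hb : b ≤ 4) : |x ⬝ᵥ v| ^ a * |x ⬝ᵥ w| ^ b ≤ envelope θ v w x := by
  refine le_trans ?_ (le_envelope v w x ha hb)
  refine le_mul_of_one_le_right (by positivity) ?_
  exact one_le_mul_of_one_le_of_one_le (Real.one_le_exp (abs_nonneg _))
    (Real.one_le_exp (by positivity))

variable {θ C : ℝ}

theorem EnvelopeBound.integrable_envelope (h : P.EnvelopeBound θ C) {v w : Vec p}
    (hv : l2norm v ≤ 1) (hw : l2norm w ≤ 1) : Integrable (envelope θ v w) P.lawX := by
  refine ⟨(measurable_envelope θ v w).aestronglyMeasurable, ?_⟩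
  rw [hasFiniteIntegral_iff_ofReal (Eventually.of_forall (envelope_nonneg θ v w))]
  exact (h v w hv hw).trans_lt ENNReal.ofReal_lt_top

theorem EnvelopeBound.integral_envelope_le (h : P.EnvelopeBound θ C) (hC : 0 ≤ C) {v w : Vec p}
    (hv : l2norm v ≤ 1) (hw : l2norm w ≤ 1) : ∫ x, envelope θ v w x ∂P.lawX ≤ C := by
  rw [integral_eq_lintegral_of_nonneg_ae (Eventually.of_forall (envelope_nonneg θ v w))
    (measurable_envelope θ v w).aestronglyMeasurable]
  exact ENNReal.toReal_le_of_le_ofReal hC (h v w hv hw)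

end Population

/-! ### The summands of score and Hessian: moments and means -/

/-- `∑_{l ∈ S} |x_l|`. -/
def absSum {p : ℕ} (S : Finset (Fin (p + 1))) (x : Vec p) : ℝ := ∑ l ∈ S, |x l|

/-- Summand of the entry `(D̂ δ)_j` of the Hessian at the iterate `β⋆ + Δ`, at `z = (x, ε)`. -/
noncomputable def hessStat {p : ℕ} (K : ℝ → ℝ) (b : ℝ) (Δ δ : Vec p) (j : Fin (p + 1))
    (z : Vec p × ℝ) : ℝ := scaled K b (z.2 - z.1 ⬝ᵥ Δ) * (z.1 j * (z.1 ⬝ᵥ δ))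

/-- Summand of the score at `β⋆`, at `z = (x, ε)`. -/
noncomputable def scoreStat {p : ℕ} (τ : ℝ) (j : Fin (p + 1)) (z : Vec p × ℝ) : ℝ :=
  (indNonpos z.2 - τ) * z.1 j

/-- Summand of the increment of the score from `β⋆` to `β⋆ + Δ`, at `z = (x, ε)`. -/
noncomputable def incrStat {p : ℕ} (Δ : Vec p) (j : Fin (p + 1)) (z : Vec p × ℝ) : ℝ :=
  (indNonpos (z.2 - z.1 ⬝ᵥ Δ) - indNonpos z.2) * z.1 j

/-- Bound for the change of the score when `Δ` moves by at most `η` in each coordinate of `S`: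
the indicator can only change where the residual is at most `η ∑_{l ∈ S} |x_l|`. -/
noncomputable def nearStat {p : ℕ} (S : Finset (Fin (p + 1))) (η : ℝ) (Δ : Vec p)
    (j : Fin (p + 1)) (z : Vec p × ℝ) : ℝ :=
  |z.1 j| * (if |z.2 - z.1 ⬝ᵥ Δ| ≤ η * absSum S z.1 then 1 else 0)

section Elementary

variable {p : ℕ} {S : Finset (Fin (p + 1))}

theorem absSum_nonneg (x : Vec p) : 0 ≤ absSum S x := Finset.sum_nonneg fun _ _ => abs_nonneg _

theorem measurable_absSum : Measurable (absSum S : Vec p → ℝ) := by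
  unfold absSum; fun_prop

theorem abs_dot_le_mul_absSum {v : Vec p} (hv : SuppIn S v) {η : ℝ} (h : ∀ j, |v j| ≤ η)
    (x : Vec p) : |x ⬝ᵥ v| ≤ η * absSum S x := by
  rw [dotProduct, ← Finset.sum_subset (Finset.subset_univ S) (fun j _ hj => by simp [hv j hj]),
    absSum, Finset.mul_sum]
  refine (Finset.abs_sum_le_sum_abs _ _).trans (Finset.sum_le_sum fun j _ => ?_)
  rw [abs_mul, mul_comm]
  exact mul_le_mul_of_nonneg_right (h j) (abs_nonneg _)

variable {K : ℝ → ℝ}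

theorem IsSmoothingKernel.measurable_hessStat (hK : IsSmoothingKernel K) (b : ℝ) (Δ δ : Vec p)
    (j : Fin (p + 1)) : Measurable (hessStat K b Δ δ j) := by
  have h1 := Population.measurable_dot Δ
  have h2 := Population.measurable_dot δ
  have h3 := hK.continuous.measurable
  unfold hessStat scaled
  fun_prop

theorem measurable_scoreStat (τ : ℝ) (j : Fin (p + 1)) : Measurable (scoreStat τ j) := by
  have h1 := measurable_indNonpos
  unfold scoreStat
  fun_prop

theorem measurable_incrStat (Δ : Vec p) (j : Fin (p + 1)) : Measurable (incrStat Δ j) := by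
  have h1 := Population.measurable_dot Δ
  have h2 := measurable_indNonpos
  unfold incrStat
  fun_prop

theorem measurable_nearStat (η : ℝ) (Δ : Vec p) (j : Fin (p + 1)) :
    Measurable (nearStat S η Δ j) := by
  have h1 := Population.measurable_dot Δ
  have h2 : Measurable (absSum S : Vec p → ℝ) := measurable_absSum
  unfold nearStat
  refine Measurable.mul (by fun_prop) (Measurable.ite ?_ measurable_const measurable_const)
  exact measurableSet_le (by fun_prop) (by fun_prop)

end Elementary

namespace Population

variable {p : ℕ} {P : Population p} {τ f₁ f₂ l₀ c₁ α lamMin lamMax : ℝ} {θ C : ℝ}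

theorem pow_mul_pow_mul_exp_le_envelope (hθ : 0 ≤ θ) (v w x : Vec p) {a b : ℕ} (ha : a ≤ 4)
    (hb : b ≤ 4) : |x ⬝ᵥ v| ^ a * |x ⬝ᵥ w| ^ b * Real.exp |x ⬝ᵥ v| ≤ envelope θ v w x := by
  refine le_trans ?_ (le_envelope v w x ha hb)
  gcongr
  exact le_mul_of_one_le_right (Real.exp_pos _).le (Real.one_le_exp (by positivity))

theorem pow_mul_pow_mul_exp_le_envelope' (v w x : Vec p) {a b : ℕ} (ha : a ≤ 4)
    (hb : b ≤ 4) : |x ⬝ᵥ v| ^ a * |x ⬝ᵥ w| ^ b * Real.exp (θ * (|x ⬝ᵥ v| * |x ⬝ᵥ w|))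
      ≤ envelope θ v w x := by
  refine le_trans ?_ (le_envelope v w x ha hb)
  gcongr
  exact le_mul_of_one_le_left (Real.exp_pos _).le (Real.one_le_exp (abs_nonneg _))

theorem l2norm_single_le (j : Fin (p + 1)) : l2norm (Pi.single j (1 : ℝ)) ≤ 1 :=
  (l2norm_single j).le

theorem exists_eq_smul {Δ : Vec p} {ρ : ℝ} (hρ : 0 < ρ) (hΔ : l2norm Δ ≤ ρ) :
    ∃ v : Vec p, l2norm v ≤ 1 ∧ ∀ x : Vec p, |x ⬝ᵥ Δ| = ρ * |x ⬝ᵥ v| := by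
  refine ⟨ρ⁻¹ • Δ, ?_, fun x => ?_⟩
  · rw [l2norm_smul, abs_of_pos (inv_pos.2 hρ), inv_mul_eq_div]
    exact (div_le_one hρ).2 hΔ
  · rw [dotProduct_smul, smul_eq_mul, abs_mul, abs_of_pos (inv_pos.2 hρ),
      mul_inv_cancel_left₀ hρ.ne']

theorem EnvelopeBound.lintegral_mul_sum_le (h : P.EnvelopeBound θ C) (hC : 0 ≤ C) {c : ℝ}
    (hc : 0 ≤ c) (S : Finset (Fin (p + 1))) {v : Vec p} (hv : l2norm v ≤ 1) :
    ∫⁻ x, ENNReal.ofReal (c * ∑ l ∈ S, envelope θ v (Pi.single l 1) x) ∂P.lawX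
      ≤ ENNReal.ofReal (c * (S.card * C)) := by
  have hi : Integrable (fun x => c * ∑ l ∈ S, envelope θ v (Pi.single l 1) x) P.lawX :=
    (integrable_finsetSum _ fun l _ => h.integrable_envelope hv (l2norm_single_le l)).const_mul c
  rw [← ofReal_integral_eq_lintegral_ofReal hi]
  · apply ENNReal.ofReal_le_ofReal
    rw [integral_const_mul, integral_finsetSum _ fun l _ =>
      h.integrable_envelope hv (l2norm_single_le l)]
    gcongr
    rw [← nsmul_eq_mul]
    exact Finset.sum_le_card_nsmul _ _ _ fun l _ =>
      h.integral_envelope_le hC hv (l2norm_single_le l)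
  · exact Eventually.of_forall fun x =>
      mul_nonneg hc (Finset.sum_nonneg fun l _ => envelope_nonneg θ v _ x)

theorem Regular.expMoment_scoreStat (hP : P.Regular τ f₁ f₂ l₀ c₁ α lamMin lamMax)
    (hE : P.EnvelopeBound θ C) (hθ : 0 ≤ θ) (hτ₀ : 0 < τ) (hτ₁ : τ < 1) (j : Fin (p + 1)) :
    ExpMoment P.jointLaw (scoreStat τ j) 1 C := by
  set e : Vec p := Pi.single j 1
  calc ∫⁻ z, ENNReal.ofReal (scoreStat τ j z ^ 2 * Real.exp (1 * |scoreStat τ j z|)) ∂P.jointLaw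
      ≤ ∫⁻ z, ENNReal.ofReal (envelope θ e e z.1) ∂P.jointLaw := by
        refine lintegral_mono fun z => ENNReal.ofReal_le_ofReal ?_
        have h1 : |scoreStat τ j z| ≤ |z.1 j| := by
          rw [scoreStat, abs_mul]
          refine mul_le_of_le_one_left (abs_nonneg _) ?_
          unfold indNonpos
          rw [abs_le]
          split_ifs <;> constructor <;> linarith
        refine le_trans ?_ (pow_mul_pow_mul_exp_le_envelope hθ e e z.1 (a := 2) (b := 0)
          (by norm_num) (by norm_num))
        rw [dotProduct_single_one', pow_zero, mul_one, one_mul, ← sq_abs (scoreStat τ j z)]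
        gcongr
    _ = ∫⁻ x, ENNReal.ofReal (envelope θ e e x) ∂P.lawX :=
        hP.lintegral_jointLaw_fst (measurable_envelope θ e e).ennreal_ofReal
    _ ≤ ENNReal.ofReal C := hE e e (l2norm_single_le j) (l2norm_single_le j)

theorem Regular.expMoment_hessStat (hP : P.Regular τ f₁ f₂ l₀ c₁ α lamMin lamMax)
    (hE : P.EnvelopeBound θ C) (hθ : 0 ≤ θ) {K : ℝ → ℝ} (hK : IsSmoothingKernel K)
    {B : ℝ} (hB : 0 < B) (hKB : ∀ u, K u ≤ B) {b : ℝ} (hb : 0 < b) (Δ : Vec p) {δ : Vec p}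
    (hδ : l2norm δ ≤ 1) (j : Fin (p + 1)) :
    ExpMoment P.jointLaw (hessStat K b Δ δ j) (θ * b / B) ((1 + l₀) * (B * C) / b) := by
  have hl := hP.l₀_nonneg
  set e : Vec p := Pi.single j 1
  have hm := hK.measurable_hessStat b Δ δ j
  have h := hP.lintegral_jointLaw_le
    (g := fun z => hessStat K b Δ δ j z ^ 2 * Real.exp (θ * b / B * |hessStat K b Δ δ j z|))
    (by fun_prop) (k := fun x u => scaled K b (u - x ⬝ᵥ Δ))
    (W := fun x => B / b * envelope θ e δ x) (κ := fun _ => 1)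
    (fun x => mul_nonneg (by positivity) (envelope_nonneg _ _ _ _)) ?_
    (fun x => by rw [hK.lintegral_scaled hb, ENNReal.ofReal_one])
  · refine h.trans ?_
    have e1 : (1 + l₀) * (B * C) / b = (1 + l₀) * (B / b * C) := by ring
    rw [e1, ENNReal.ofReal_mul (by positivity), ENNReal.ofReal_mul (p := B / b) (by positivity)]
    gcongr
    simp only [mul_one, ENNReal.ofReal_mul (p := B / b) (by positivity)]
    rw [lintegral_const_mul' _ _ ENNReal.ofReal_ne_top]
    gcongr
    exact hE e δ (l2norm_single_le j) hδ
  · intro x u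
    simp only [hessStat]
    set k := scaled K b (u - x ⬝ᵥ Δ) with hk
    have hk0 : 0 ≤ k := hK.scaled_nonneg hb _
    have hkB : k ≤ B / b := div_le_div_of_nonneg_right (hKB _) hb.le
    have h1 := pow_mul_pow_mul_exp_le_envelope' (θ := θ) e δ x (a := 2) (b := 2) (by norm_num)
      (by norm_num)
    rw [dotProduct_single_one'] at h1
    have e2 : (k * (x j * (x ⬝ᵥ δ))) ^ 2 = k * k * (|x j| ^ 2 * |x ⬝ᵥ δ| ^ 2) := by
      rw [sq_abs, sq_abs]; ring
    have e3 : θ * b / B * |k * (x j * (x ⬝ᵥ δ))| ≤ θ * (|x j| * |x ⬝ᵥ δ|) := by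
      rw [abs_mul, abs_of_nonneg hk0, abs_mul]
      calc θ * b / B * (k * (|x j| * |x ⬝ᵥ δ|))
          ≤ θ * b / B * (B / b * (|x j| * |x ⬝ᵥ δ|)) := by gcongr
        _ = θ * (|x j| * |x ⬝ᵥ δ|) := by field_simp
    calc (k * (x j * (x ⬝ᵥ δ))) ^ 2 * Real.exp (θ * b / B * |k * (x j * (x ⬝ᵥ δ))|)
        ≤ B / b * k * (|x j| ^ 2 * |x ⬝ᵥ δ| ^ 2) * Real.exp (θ * (|x j| * |x ⬝ᵥ δ|)) := by
          rw [e2]; gcongr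
      _ = B / b * (|x j| ^ 2 * |x ⬝ᵥ δ| ^ 2 * Real.exp (θ * (|x j| * |x ⬝ᵥ δ|))) * k := by ring
      _ ≤ B / b * envelope θ e δ x * k := by gcongr

theorem Regular.expMoment_incrStat (hP : P.Regular τ f₁ f₂ l₀ c₁ α lamMin lamMax)
    (hE : P.EnvelopeBound θ C) (hθ : 0 ≤ θ) {ρ : ℝ} (hρ : 0 < ρ) {Δ : Vec p}
    (hΔ : l2norm Δ ≤ ρ) (j : Fin (p + 1)) :
    ExpMoment P.jointLaw (incrStat Δ j) 1 ((1 + l₀) * (ρ * C)) := by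
  have hl := hP.l₀_nonneg
  obtain ⟨v, hv, hΔv⟩ := exists_eq_smul hρ hΔ
  set e : Vec p := Pi.single j 1
  have hm := measurable_incrStat Δ j
  have h := hP.lintegral_jointLaw_le
    (g := fun z => incrStat Δ j z ^ 2 * Real.exp (1 * |incrStat Δ j z|))
    (by fun_prop) (k := fun x u => |indNonpos (u - x ⬝ᵥ Δ) - indNonpos u|)
    (W := fun x => |x j| ^ 2 * Real.exp |x j|) (κ := fun x => |x ⬝ᵥ Δ|)
    (fun x => by positivity) ?_ (fun x => (lintegral_abs_indNonpos_sub _).le)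
  · refine h.trans ?_
    rw [ENNReal.ofReal_mul (by positivity), ENNReal.ofReal_mul (p := ρ) (by positivity)]
    gcongr
    rw [← ENNReal.ofReal_mul hρ.le]
    have hle : ∀ x : Vec p, |x j| ^ 2 * Real.exp |x j| * |x ⬝ᵥ Δ| ≤ ρ * envelope θ e v x := by
      intro x
      have h1 := pow_mul_pow_mul_exp_le_envelope hθ e v x (a := 2) (b := 1) (by norm_num)
        (by norm_num)
      rw [dotProduct_single_one'] at h1
      rw [hΔv]
      calc _ = ρ * (|x j| ^ 2 * |x ⬝ᵥ v| ^ 1 * Real.exp |x j|) := by ring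
        _ ≤ _ := by gcongr
    refine (lintegral_mono fun x => ENNReal.ofReal_le_ofReal (hle x)).trans ?_
    simp only [ENNReal.ofReal_mul hρ.le]
    rw [lintegral_const_mul' _ _ ENNReal.ofReal_ne_top]
    gcongr
    exact hE e v (l2norm_single_le j) hv
  · intro x u
    simp only [incrStat]
    rw [one_mul, abs_mul, mul_pow, ← sq_abs, ← sq_abs (x j)]
    have hk : |indNonpos (u - x ⬝ᵥ Δ) - indNonpos u| = 0 ∨
        |indNonpos (u - x ⬝ᵥ Δ) - indNonpos u| = 1 := by
      rw [abs_indNonpos_sub]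
      by_cases hu : u ∈ Set.uIoc 0 (x ⬝ᵥ Δ) <;> simp [hu]
    rcases hk with hk | hk <;> simp [hk]

theorem lintegral_ite_abs_sub_le (a : ℝ) {r : ℝ} :
    ∫⁻ u, ENNReal.ofReal (if |u - a| ≤ r then 1 else 0) = ENNReal.ofReal (2 * r) := by
  have : ∀ u : ℝ, ENNReal.ofReal (if |u - a| ≤ r then 1 else 0)
      = (Metric.closedBall a r).indicator 1 u := by
    intro u
    by_cases h : |u - a| ≤ r <;> simp [h, Real.dist_eq]
  simp only [this]
  rw [lintegral_indicator_one Metric.isClosed_closedBall.measurableSet, Real.volume_closedBall]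

theorem Regular.expMoment_nearStat (hP : P.Regular τ f₁ f₂ l₀ c₁ α lamMin lamMax)
    (hE : P.EnvelopeBound θ C) (hθ : 0 ≤ θ) (hC : 0 ≤ C) (S : Finset (Fin (p + 1))) {η : ℝ}
    (hη : 0 ≤ η) (Δ : Vec p) (j : Fin (p + 1)) :
    ExpMoment P.jointLaw (nearStat S η Δ j) 1 ((1 + l₀) * (2 * η * (S.card * C))) ∧
    ∫ z, nearStat S η Δ j z ∂P.jointLaw ≤ (1 + l₀) * (2 * η * (S.card * C)) := by
  have hl := hP.l₀_nonneg
  set e : Vec p := Pi.single j 1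
  have hm : Measurable (nearStat S η Δ j) := measurable_nearStat η Δ j
  have hle : ∀ x : Vec p, |x j| * 1 ≤ |x j| * Real.exp |x j| := fun x =>
    mul_le_mul_of_nonneg_left (Real.one_le_exp (abs_nonneg _)) (abs_nonneg _)
  -- both bounds come from integrating a weight below the envelope
  have main : ∀ (a : ℕ) (_ : a ≤ 2) (W : Vec p → ℝ), (∀ x, 0 ≤ W x) →
      (∀ x, W x ≤ |x j| ^ a * Real.exp |x j|) →
      ENNReal.ofReal (1 + l₀) * ∫⁻ x, ENNReal.ofReal (W x * (2 * (η * absSum S x))) ∂P.lawX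
        ≤ ENNReal.ofReal ((1 + l₀) * (2 * η * (S.card * C))) := by
    intro a ha W hW0 hW
    rw [ENNReal.ofReal_mul (p := 1 + l₀) (by positivity)]
    gcongr
    refine le_trans (lintegral_mono fun x => ENNReal.ofReal_le_ofReal ?_)
      (hE.lintegral_mul_sum_le hC (c := 2 * η) (by positivity) S (v := e) (l2norm_single_le j))
    have h0 := absSum_nonneg (S := S) x
    calc W x * (2 * (η * absSum S x))
        ≤ |x j| ^ a * Real.exp |x j| * (2 * (η * absSum S x)) := by gcongr; exact hW x
      _ = 2 * η * ∑ l ∈ S, |x j| ^ a * |x l| ^ 1 * Real.exp |x j| := by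
          simp only [absSum, Finset.mul_sum]
          exact Finset.sum_congr rfl fun l _ => by ring
      _ ≤ 2 * η * ∑ l ∈ S, envelope θ e (Pi.single l 1) x := by
          gcongr with l hl
          have h1 := pow_mul_pow_mul_exp_le_envelope hθ e (Pi.single l 1) x (a := a) (b := 1)
            (by omega) (by norm_num)
          rwa [dotProduct_single_one', dotProduct_single_one'] at h1
  constructor
  · refine (hP.lintegral_jointLaw_le
      (g := fun z => nearStat S η Δ j z ^ 2 * Real.exp (1 * |nearStat S η Δ j z|))
      (by fun_prop) (k := fun x u => if |u - x ⬝ᵥ Δ| ≤ η * absSum S x then 1 else 0)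
      (W := fun x => |x j| ^ 2 * Real.exp |x j|) (κ := fun x => 2 * (η * absSum S x))
      (fun x => by positivity) ?_ (fun x => (lintegral_ite_abs_sub_le _).le)).trans
      (main 2 le_rfl _ (fun x => by positivity) fun x => le_rfl)
    intro x u
    simp only [nearStat]
    split_ifs <;> simp
  · have hn : ∀ z, 0 ≤ nearStat S η Δ j z := fun z => by
      unfold nearStat
      split_ifs <;> simp
    rw [integral_eq_lintegral_of_nonneg_ae (Eventually.of_forall hn) hm.aestronglyMeasurable]
    refine ENNReal.toReal_le_of_le_ofReal (by positivity) ?_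
    refine (hP.lintegral_jointLaw_le (g := nearStat S η Δ j)
      hm (k := fun x u => if |u - x ⬝ᵥ Δ| ≤ η * absSum S x then 1 else 0)
      (W := fun x => |x j|) (κ := fun x => 2 * (η * absSum S x))
      (fun x => by positivity) (fun x u => le_rfl)
      (fun x => (lintegral_ite_abs_sub_le _).le)).trans
      (main 1 (by norm_num) _ (fun x => by positivity) fun x => ?_)
    simpa using hle x

theorem Regular.integral_scoreStat (hP : P.Regular τ f₁ f₂ l₀ c₁ α lamMin lamMax)
    (hE : P.EnvelopeBound θ C) (hθ : 0 ≤ θ) (hτ₀ : 0 < τ) (hτ₁ : τ < 1) (j : Fin (p + 1)) :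
    ∫ z, scoreStat τ j z ∂P.jointLaw = 0 := by
  have := hP.isProbabilityMeasure_jointLaw
  have hi := (hP.expMoment_scoreStat hE hθ hτ₀ hτ₁ j).integrable (measurable_scoreStat τ j)
    zero_le_one
  rw [(hP.integral_jointLaw hi).2]
  apply integral_eq_zero_of_ae
  filter_upwards [hP.f_density, hP.quantile] with x hd hq
  have hm : Measurable (P.f x) := hP.measurable_f.comp (measurable_const.prodMk measurable_id)
  have hif : Integrable (P.f x) := by
    refine ⟨hm.aestronglyMeasurable, ?_⟩
    rw [hasFiniteIntegral_iff_ofReal (Eventually.of_forall (hP.f_nonneg x)), hd]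
    exact ENNReal.one_lt_top
  have hf1 : ∫ u, P.f x u = 1 := by
    rw [integral_eq_lintegral_of_nonneg_ae (Eventually.of_forall (hP.f_nonneg x))
      hm.aestronglyMeasurable, hd, ENNReal.toReal_one]
  have e1 : ∀ u, P.f x u * scoreStat τ j (x, u)
      = ((Set.Iic 0).indicator (P.f x) u - P.f x u * τ) * x j := by
    intro u
    simp only [scoreStat, indNonpos, Set.indicator, Set.mem_Iic]
    split_ifs <;> ring
  simp only [e1, Pi.zero_apply]
  rw [integral_mul_const, integral_sub (hif.indicator measurableSet_Iic) (hif.mul_const τ),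
    integral_indicator measurableSet_Iic, hq, integral_mul_const, hf1]
  ring

theorem Regular.abs_integral_hessStat_sub_le (hP : P.Regular τ f₁ f₂ l₀ c₁ α lamMin lamMax)
    (hE : P.EnvelopeBound θ C) (hθ : 0 ≤ θ) (hC : 0 ≤ C) {K : ℝ → ℝ} (hK : IsSmoothingKernel K)
    {b : ℝ} (hb : 0 < b) {ρ : ℝ} (hρ : 0 < ρ) {Δ δ : Vec p} (hΔ : l2norm Δ ≤ ρ)
    (hδ : l2norm δ ≤ 1) (j : Fin (p + 1)) :
    |(∫ z, hessStat K b Δ δ j z ∂P.jointLaw) - (P.info *ᵥ δ) j|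
      ≤ l₀ * C * (b * kernelMoment K + 2 * ρ) := by
  have := hP.isProbabilityMeasure_jointLaw
  have hl := hP.l₀_nonneg
  obtain ⟨B, hB⟩ := hK.bounded
  have hB1 : (0 : ℝ) < max B 1 := lt_max_of_lt_right one_pos
  have hi := (hP.expMoment_hessStat hE hθ hK hB1 (fun u => (hB u).trans (le_max_left _ _)) hb Δ hδ
    j).integrable (hK.measurable_hessStat b Δ δ j) (by positivity)
  obtain ⟨v, hv, hΔv⟩ := exists_eq_smul hρ hΔ
  set e : Vec p := Pi.single j 1
  have hκ := hK.kernelMoment_nonneg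
  have ie1 := hE.integrable_envelope (v := e) (l2norm_single_le j) hδ
  have ie2 := hE.integrable_envelope (v := e) (l2norm_single_le j) hv
  have ie12 : Integrable (fun x => envelope θ e δ x + envelope θ e v x) P.lawX := ie1.add ie2
  set G : Vec p → ℝ := fun x => l₀ * (b * kernelMoment K) * envelope θ e δ x
    + l₀ * ρ * (envelope θ e δ x + envelope θ e v x) with hG
  have iG : Integrable G P.lawX := (ie1.const_mul _).add (ie12.const_mul _)
  have hbd : ∀ x : Vec p, l₀ * (b * kernelMoment K + |x ⬝ᵥ Δ|) * |x j * (x ⬝ᵥ δ)| ≤ G x := by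
    intro x
    have h1 := pow_mul_pow_le_envelope hθ e δ x (a := 1) (b := 1) (by norm_num) (by norm_num)
    have h2 := pow_mul_pow_le_envelope hθ e δ x (a := 1) (b := 2) (by norm_num) (by norm_num)
    have h3 := pow_mul_pow_le_envelope hθ e v x (a := 1) (b := 2) (by norm_num) (by norm_num)
    rw [dotProduct_single_one'] at h1 h2 h3
    simp only [pow_one] at h1 h2 h3
    rw [abs_mul, hΔv]
    have h4 : |x j| * (|x ⬝ᵥ δ| * |x ⬝ᵥ v|) ≤ |x j| * |x ⬝ᵥ δ| ^ 2 + |x j| * |x ⬝ᵥ v| ^ 2 := by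
      rw [← mul_add]
      refine mul_le_mul_of_nonneg_left ?_ (abs_nonneg _)
      nlinarith [sq_nonneg (|x ⬝ᵥ δ| - |x ⬝ᵥ v|), abs_nonneg (x ⬝ᵥ δ), abs_nonneg (x ⬝ᵥ v)]
    calc l₀ * (b * kernelMoment K + ρ * |x ⬝ᵥ v|) * (|x j| * |x ⬝ᵥ δ|)
        = l₀ * (b * kernelMoment K) * (|x j| * |x ⬝ᵥ δ|)
          + l₀ * ρ * (|x j| * (|x ⬝ᵥ δ| * |x ⬝ᵥ v|)) := by ring
      _ ≤ G x := by
          simp only [hG]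
          gcongr
          linarith
  have i1 : Integrable (fun x => l₀ * (b * kernelMoment K + |x ⬝ᵥ Δ|) * |x j * (x ⬝ᵥ δ)|)
      P.lawX := by
    have hm1 := measurable_dot Δ
    have hm2 := measurable_dot δ
    refine iG.mono' (by fun_prop) (Eventually.of_forall fun x => ?_)
    rw [Real.norm_eq_abs, abs_of_nonneg (by positivity)]
    exact hbd x
  have h := hP.abs_integral_jointLaw_sub_le hi (k := fun x u => scaled K b (u - x ⬝ᵥ Δ))
    (W := fun x => x j * (x ⬝ᵥ δ)) (κ := fun _ => 1)
    (e := fun x => l₀ * (b * kernelMoment K + |x ⬝ᵥ Δ|)) (fun x u => rfl) ?_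
    (by simpa using hP.integrable_f_mul (hP.integrable_mul_dot j δ)) i1
  · simp only [one_mul] at h
    rw [← hP.info_mulVec_apply] at h
    refine h.trans ((integral_mono i1 iG hbd).trans ?_)
    have b1 := hE.integral_envelope_le hC (v := e) (l2norm_single_le j) hδ
    have b2 := hE.integral_envelope_le hC (v := e) (l2norm_single_le j) hv
    simp only [hG]
    rw [integral_add (ie1.const_mul _) (ie12.const_mul _), integral_const_mul,
      integral_const_mul, integral_add ie1 ie2]
    calc _ ≤ l₀ * (b * kernelMoment K) * C + l₀ * ρ * (C + C) := by gcongr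
      _ = _ := by ring
  · filter_upwards [hP.f_lipschitz] with x hx
    rw [mul_one]
    exact hK.bias hb _ hl hx

theorem Regular.abs_integral_incrStat_sub_le (hP : P.Regular τ f₁ f₂ l₀ c₁ α lamMin lamMax)
    (hE : P.EnvelopeBound θ C) (hθ : 0 ≤ θ) (hC : 0 ≤ C) {ρ : ℝ} (hρ : 0 < ρ) {Δ : Vec p}
    (hΔ : l2norm Δ ≤ ρ) (j : Fin (p + 1)) :
    |(∫ z, incrStat Δ j z ∂P.jointLaw) - (P.info *ᵥ Δ) j| ≤ l₀ * C * ρ ^ 2 := by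
  have := hP.isProbabilityMeasure_jointLaw
  have hl := hP.l₀_nonneg
  have hi := (hP.expMoment_incrStat hE hθ hρ hΔ j).integrable (measurable_incrStat Δ j)
    zero_le_one
  obtain ⟨v, hv, hΔv⟩ := exists_eq_smul hρ hΔ
  set e : Vec p := Pi.single j 1
  have ie := (hE.integrable_envelope (v := e) (l2norm_single_le j) hv).const_mul (l₀ * ρ ^ 2)
  have hbd : ∀ x : Vec p, l₀ * (x ⬝ᵥ Δ) ^ 2 * |x j| ≤ l₀ * ρ ^ 2 * envelope θ e v x := by
    intro x
    have h3 := pow_mul_pow_le_envelope hθ e v x (a := 1) (b := 2) (by norm_num) (by norm_num)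
    rw [dotProduct_single_one'] at h3
    rw [← sq_abs (x ⬝ᵥ Δ), hΔv]
    calc l₀ * (ρ * |x ⬝ᵥ v|) ^ 2 * |x j| = l₀ * ρ ^ 2 * (|x j| ^ 1 * |x ⬝ᵥ v| ^ 2) := by ring
      _ ≤ _ := by gcongr
  have i1 : Integrable (fun x => l₀ * (x ⬝ᵥ Δ) ^ 2 * |x j|) P.lawX := by
    have hm1 := measurable_dot Δ
    refine ie.mono' (by fun_prop) (Eventually.of_forall fun x => ?_)
    rw [Real.norm_eq_abs, abs_of_nonneg (by positivity)]
    exact hbd x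
  have h := hP.abs_integral_jointLaw_sub_le hi
    (k := fun x u => indNonpos (u - x ⬝ᵥ Δ) - indNonpos u)
    (W := fun x => x j) (κ := fun x => x ⬝ᵥ Δ)
    (e := fun x => l₀ * (x ⬝ᵥ Δ) ^ 2) (fun x u => rfl)
    (by filter_upwards [hP.f_lipschitz] with x hx; exact indicator_bias _ hl hx)
    (by simpa [mul_comm] using hP.integrable_f_mul (hP.integrable_mul_dot j Δ)) i1
  have e1 : (P.info *ᵥ Δ) j = ∫ x, P.f x 0 * ((x ⬝ᵥ Δ) * x j) ∂P.lawX := by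
    rw [hP.info_mulVec_apply]
    simp only [mul_comm]
  rw [e1]
  refine h.trans ((integral_mono i1 ie hbd).trans ?_)
  rw [integral_const_mul]
  have b2 := hE.integral_envelope_le hC (v := e) (l2norm_single_le j) hv
  calc _ ≤ l₀ * ρ ^ 2 * C := by gcongr
    _ = _ := by ring

theorem Regular.map_fst_jointLaw (hP : P.Regular τ f₁ f₂ l₀ c₁ α lamMin lamMax) :
    P.jointLaw.map Prod.fst = P.lawX := by
  ext s hs
  rw [Measure.map_apply measurable_fst hs, ← lintegral_indicator_one (measurable_fst hs),
    ← lintegral_indicator_one hs, ← hP.lintegral_jointLaw_fst (measurable_one.indicator hs)]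
  rfl

end Population

/-! ### Uniform deviation bounds over sparse vectors -/

section Grid

variable {p : ℕ}

/-- The vectors supported in `S` with coordinates in `{z / M : |z| ≤ M}`. -/
noncomputable def grid (S : Finset (Fin (p + 1))) (M : ℕ) : Finset (Vec p) :=
  Fintype.piFinset fun l =>
    if l ∈ S then (Finset.Icc (-(M : ℤ)) M).image (fun z : ℤ => (z : ℝ) / M) else {0}

variable {S : Finset (Fin (p + 1))} {M : ℕ}

theorem card_grid_le : (grid S M).card ≤ (2 * M + 1) ^ S.card := by
  rw [grid, Fintype.card_piFinset]
  calc ∏ l, (if l ∈ S then (Finset.Icc (-(M : ℤ)) M).image (fun z : ℤ => (z : ℝ) / M)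
          else {0}).card
      ≤ ∏ l, (if l ∈ S then 2 * M + 1 else 1) := by
        refine Finset.prod_le_prod' fun l _ => ?_
        split_ifs
        · refine Finset.card_image_le.trans ?_
          rw [Int.card_Icc]
          omega
        · simp
    _ = (2 * M + 1) ^ S.card := by
        rw [Finset.prod_ite_mem, Finset.univ_inter, Finset.prod_const]

theorem suppIn_of_mem_grid {u : Vec p} (hu : u ∈ grid S M) : SuppIn S u := by
  intro j hj
  have := Fintype.mem_piFinset.1 hu j
  simpa [hj] using this

theorem exists_mem_grid (hM : 1 ≤ M) {v : Vec p} (hv : SuppIn S v) (h1 : ∀ j, |v j| ≤ 1) :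
    ∃ u ∈ grid S M, ∀ j, |(v - u) j| ≤ 1 / M := by
  have hM0 : (0 : ℝ) < M := by exact_mod_cast hM
  refine ⟨fun j => (⌊(M : ℝ) * v j⌋ : ℝ) / M, ?_, fun j => ?_⟩
  · refine Fintype.mem_piFinset.2 fun j => ?_
    split_ifs with hj
    · refine Finset.mem_image.2 ⟨⌊(M : ℝ) * v j⌋, ?_, rfl⟩
      obtain ⟨h2, h3⟩ := abs_le.1 (h1 j)
      rw [Finset.mem_Icc]
      constructor
      · apply Int.le_floor.2
        push_cast
        nlinarith
      · have : ⌊(M : ℝ) * v j⌋ ≤ ⌊((M : ℤ) : ℝ)⌋ := by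
          apply Int.floor_mono
          push_cast
          nlinarith
        simpa using this
    · simp [hv j hj]
  · have h2 := Int.floor_le ((M : ℝ) * v j)
    have h3 := Int.lt_floor_add_one ((M : ℝ) * v j)
    rw [Pi.sub_apply, abs_le]
    have e : v j - (⌊(M : ℝ) * v j⌋ : ℝ) / M = ((M : ℝ) * v j - ⌊(M : ℝ) * v j⌋) / M := by
      field_simp
    rw [e]
    constructor
    · have : 0 ≤ ((M : ℝ) * v j - ⌊(M : ℝ) * v j⌋) / M := div_nonneg (by linarith) hM0.le
      have : 0 ≤ 1 / (M : ℝ) := by positivity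
      linarith
    · exact div_le_div_of_nonneg_right (by linarith) hM0.le

theorem l2norm_le_add_of_sub_le {v u : Vec p} (hv : SuppIn S v) (hu : SuppIn S u) {η : ℝ}
    (hη : 0 ≤ η) (h : ∀ j, |(v - u) j| ≤ η) : l2norm u ≤ l2norm v + Real.sqrt S.card * η := by
  have e : u = v + (u - v) := by abel
  have h2 : l2norm (u - v) ≤ Real.sqrt S.card * η :=
    l2norm_le_sqrt_card_mul (hu.sub hv) hη fun j => by
      rw [Pi.sub_apply, abs_sub_comm]; exact h j
  calc l2norm u = l2norm (v + (u - v)) := by rw [← e]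
    _ ≤ l2norm v + l2norm (u - v) := l2norm_add_le _ _
    _ ≤ _ := by linarith

end Grid

section Emp

variable {Ω 𝒳 ι : Type*} [Fintype ι] {ξ : ι → Ω → 𝒳}

theorem emp_const_mul (c : ℝ) (φ : 𝒳 → ℝ) (ω : Ω) :
    emp ξ (fun x => c * φ x) ω = c * emp ξ φ ω := by
  simp only [emp, ← Finset.mul_sum, mul_div_assoc]

theorem abs_emp_sub_le {φ ψ χ : 𝒳 → ℝ} (h : ∀ x, |φ x - ψ x| ≤ χ x) (ω : Ω) :
    |emp ξ φ ω - emp ξ ψ ω| ≤ emp ξ χ ω := by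
  simp only [emp]
  rw [← sub_div, ← Finset.sum_sub_distrib, abs_div, Nat.abs_cast]
  exact div_le_div_of_nonneg_right ((Finset.abs_sum_le_sum_abs _ _).trans
    (Finset.sum_le_sum fun i _ => h _)) (Nat.cast_nonneg _)

theorem measureReal_biUnion_le_card_mul {mΩ : MeasurableSpace Ω} {μ : Measure Ω} {β : Type*}
    (A : Finset β) (Ev : β → Set Ω) {q : ℝ} (h : ∀ a ∈ A, μ.real (Ev a) ≤ q) :
    μ.real (⋃ a ∈ A, Ev a) ≤ A.card * q := by
  refine (measureReal_biUnion_finset_le A Ev).trans ?_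
  rw [← nsmul_eq_mul]
  exact Finset.sum_le_card_nsmul _ _ _ h

end Emp

/-- A function of the covariates that bounds `|x_j| (L + L²)`, `L = ∑_{l ∈ S} |x_l|`, for all `j`
simultaneously; it controls the Lipschitz constant of the Hessian. -/
noncomputable def lipStat {p : ℕ} (S : Finset (Fin (p + 1))) (θ : ℝ) (z : Vec p × ℝ) : ℝ :=
  (1 + S.card) * ∑ j, ∑ l ∈ S, Population.envelope θ (Pi.single j 1) (Pi.single l 1) z.1

theorem le_lipStat {p : ℕ} (S : Finset (Fin (p + 1))) {θ : ℝ} (hθ : 0 ≤ θ) (z : Vec p × ℝ)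
    (j : Fin (p + 1)) : |z.1 j| * (absSum S z.1 + absSum S z.1 ^ 2) ≤ lipStat S θ z := by
  have h1 : absSum S z.1 ^ 2 ≤ S.card * ∑ l ∈ S, |z.1 l| ^ 2 := sq_sum_le_card_mul_sum_sq
  have key : |z.1 j| * (absSum S z.1 + absSum S z.1 ^ 2)
      ≤ (1 + S.card) * ∑ l ∈ S, Population.envelope θ (Pi.single j 1) (Pi.single l 1) z.1 := by
    calc |z.1 j| * (absSum S z.1 + absSum S z.1 ^ 2)
        ≤ |z.1 j| * (absSum S z.1 + S.card * ∑ l ∈ S, |z.1 l| ^ 2) := by gcongr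
      _ = ∑ l ∈ S, |z.1 j| ^ 1 * |z.1 l| ^ 1
          + S.card * ∑ l ∈ S, |z.1 j| ^ 1 * |z.1 l| ^ 2 := by
          simp only [absSum, pow_one, ← Finset.mul_sum]; ring
      _ ≤ ∑ l ∈ S, Population.envelope θ (Pi.single j 1) (Pi.single l 1) z.1
          + S.card * ∑ l ∈ S, Population.envelope θ (Pi.single j 1) (Pi.single l 1) z.1 := by
          gcongr with l _ l _
          · have := Population.pow_mul_pow_le_envelope hθ (Pi.single j 1) (Pi.single l 1) z.1
              (a := 1) (b := 1) (by norm_num) (by norm_num)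
            rwa [dotProduct_single_one', dotProduct_single_one'] at this
          · have := Population.pow_mul_pow_le_envelope hθ (Pi.single j 1) (Pi.single l 1) z.1
              (a := 1) (b := 2) (by norm_num) (by norm_num)
            rwa [dotProduct_single_one', dotProduct_single_one'] at this
      _ = _ := by ring
  refine key.trans ?_
  unfold lipStat
  gcongr
  exact Finset.single_le_sum (f := fun j => ∑ l ∈ S,
    Population.envelope θ (Pi.single j 1) (Pi.single l 1) z.1)
    (fun _ _ => Finset.sum_nonneg fun l _ => Population.envelope_nonneg _ _ _ _)
    (Finset.mem_univ j)

theorem lipStat_nonneg {p : ℕ} (S : Finset (Fin (p + 1))) (θ : ℝ) (z : Vec p × ℝ) :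
    0 ≤ lipStat S θ z :=
  mul_nonneg (by positivity) (Finset.sum_nonneg fun j _ => Finset.sum_nonneg fun l _ =>
    Population.envelope_nonneg _ _ _ _)

theorem measurable_lipStat {p : ℕ} (S : Finset (Fin (p + 1))) (θ : ℝ) :
    Measurable (lipStat S θ) := by
  unfold lipStat
  refine Measurable.const_mul (Finset.measurable_sum _ fun j _ =>
    Finset.measurable_sum _ fun l _ => ?_) _
  exact (Population.measurable_envelope _ _ _).comp measurable_fst

/-- The kernel bounds that enter the deviation inequalities: `K ≤ B` and `K` is
`B`-Lipschitz. -/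
structure KernelBound (K : ℝ → ℝ) (B : ℝ) : Prop where
  pos : 0 < B
  le : ∀ u, K u ≤ B
  lipschitz : ∀ u v, |K u - K v| ≤ B * |u - v|

theorem IsSmoothingKernel.exists_kernelBound {K : ℝ → ℝ} (hK : IsSmoothingKernel K) :
    ∃ B, KernelBound K B := by
  obtain ⟨B₁, h1⟩ := hK.bounded
  obtain ⟨B₂, h2⟩ := hK.deriv_bounded
  have hB : 0 < max (max B₁ B₂) 1 := lt_max_of_lt_right one_pos
  refine ⟨max (max B₁ B₂) 1, hB, fun u => (h1 u).trans ?_, fun u v => ?_⟩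
  · exact (le_max_left _ _).trans (le_max_left _ _)
  · have := Convex.norm_image_sub_le_of_norm_deriv_le (𝕜 := ℝ) (f := K) (s := Set.univ) (x := v)
      (y := u) (C := max (max B₁ B₂) 1) (fun x _ => hK.differentiable x)
      (fun x _ => (h2 x).trans ((le_max_right _ _).trans (le_max_left _ _)))
      convex_univ (Set.mem_univ _) (Set.mem_univ _)
    simpa using this

theorem abs_hessStat_sub_le {p : ℕ} {S : Finset (Fin (p + 1))} {K : ℝ → ℝ}
    (hK : IsSmoothingKernel K) {B : ℝ} (hB : KernelBound K B) {b : ℝ} (hb : 0 < b) (hb1 : b ≤ 1)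
    {θ : ℝ} (hθ : 0 ≤ θ) {Δ Δ' δ δ' : Vec p} (hΔ : SuppIn S Δ) (hΔ' : SuppIn S Δ')
    (hδ : SuppIn S δ) (hδ' : SuppIn S δ') {η : ℝ} (h1 : ∀ j, |(Δ - Δ') j| ≤ η)
    (h2 : ∀ j, |(δ - δ') j| ≤ η) (h3 : ∀ j, |δ j| ≤ 1) (j : Fin (p + 1)) (z : Vec p × ℝ) :
    |hessStat K b Δ δ j z - hessStat K b Δ' δ' j z| ≤ η * B / b ^ 2 * lipStat S θ z := by
  have hB0 := hB.pos
  have hη : 0 ≤ η := (abs_nonneg _).trans (h1 0)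
  set L := absSum S z.1 with hL
  have hL0 : 0 ≤ L := absSum_nonneg _
  set k := scaled K b (z.2 - z.1 ⬝ᵥ Δ) with hk
  set k' := scaled K b (z.2 - z.1 ⬝ᵥ Δ') with hk'
  have e : hessStat K b Δ δ j z - hessStat K b Δ' δ' j z
      = (k - k') * (z.1 j * (z.1 ⬝ᵥ δ)) + k' * (z.1 j * (z.1 ⬝ᵥ (δ - δ'))) := by
    simp only [hessStat, dotProduct_sub, ← hk, ← hk']
    ring
  have d1 : |z.1 ⬝ᵥ (Δ - Δ')| ≤ η * L := abs_dot_le_mul_absSum (hΔ.sub hΔ') h1 z.1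
  have d2 : |z.1 ⬝ᵥ (δ - δ')| ≤ η * L := abs_dot_le_mul_absSum (hδ.sub hδ') h2 z.1
  have d3 : |z.1 ⬝ᵥ δ| ≤ 1 * L := abs_dot_le_mul_absSum hδ h3 z.1
  have k0 : 0 ≤ k' := hK.scaled_nonneg hb _
  have k1 : k' ≤ B / b ^ 2 := by
    have h4 : k' ≤ B / b := div_le_div_of_nonneg_right (hB.le _) hb.le
    refine h4.trans ?_
    apply div_le_div_of_nonneg_left hB0.le (by positivity)
    nlinarith
  have k2 : |k - k'| ≤ B / b ^ 2 * (η * L) := by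
    have h4 := hB.lipschitz ((z.2 - z.1 ⬝ᵥ Δ) / b) ((z.2 - z.1 ⬝ᵥ Δ') / b)
    have e2 : (z.2 - z.1 ⬝ᵥ Δ) / b - (z.2 - z.1 ⬝ᵥ Δ') / b = -(z.1 ⬝ᵥ (Δ - Δ')) / b := by
      rw [dotProduct_sub]; ring
    rw [e2, abs_div, abs_neg, abs_of_pos hb] at h4
    have e3 : k - k' = (K ((z.2 - z.1 ⬝ᵥ Δ) / b) - K ((z.2 - z.1 ⬝ᵥ Δ') / b)) / b := by
      rw [hk, hk', scaled, scaled]; exact (sub_div _ _ _).symm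
    rw [e3, abs_div, abs_of_pos hb, div_le_iff₀ hb]
    calc _ ≤ B * (|z.1 ⬝ᵥ (Δ - Δ')| / b) := h4
      _ ≤ B * (η * L / b) := by gcongr
      _ = B / b ^ 2 * (η * L) * b := by field_simp
  have hlip := le_lipStat S hθ z j
  rw [e]
  calc |(k - k') * (z.1 j * (z.1 ⬝ᵥ δ)) + k' * (z.1 j * (z.1 ⬝ᵥ (δ - δ')))|
      ≤ |k - k'| * (|z.1 j| * |z.1 ⬝ᵥ δ|) + k' * (|z.1 j| * |z.1 ⬝ᵥ (δ - δ')|) := by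
        refine (abs_add_le _ _).trans (le_of_eq ?_)
        rw [abs_mul, abs_mul, abs_mul, abs_mul, abs_of_nonneg k0]
    _ ≤ B / b ^ 2 * (η * L) * (|z.1 j| * (1 * L)) + B / b ^ 2 * (|z.1 j| * (η * L)) := by
        gcongr
    _ = η * B / b ^ 2 * (|z.1 j| * (L + L ^ 2)) := by ring
    _ ≤ η * B / b ^ 2 * lipStat S θ z := by gcongr

theorem abs_incrStat_sub_le {p : ℕ} {S : Finset (Fin (p + 1))} {Δ Δ' : Vec p} (hΔ : SuppIn S Δ)
    (hΔ' : SuppIn S Δ') {η : ℝ} (h1 : ∀ j, |(Δ - Δ') j| ≤ η) (j : Fin (p + 1))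
    (z : Vec p × ℝ) : |incrStat Δ j z - incrStat Δ' j z| ≤ nearStat S η Δ' j z := by
  have d1 : |z.1 ⬝ᵥ (Δ - Δ')| ≤ η * absSum S z.1 := abs_dot_le_mul_absSum (hΔ.sub hΔ') h1 z.1
  rw [dotProduct_sub, abs_le] at d1
  have e : incrStat Δ j z - incrStat Δ' j z
      = (indNonpos (z.2 - z.1 ⬝ᵥ Δ) - indNonpos (z.2 - z.1 ⬝ᵥ Δ')) * z.1 j := by
    simp only [incrStat]; ring
  rw [e, abs_mul, nearStat, mul_comm]
  refine mul_le_mul_of_nonneg_left ?_ (abs_nonneg _)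
  by_cases hnear : |z.2 - z.1 ⬝ᵥ Δ'| ≤ η * absSum S z.1
  · rw [if_pos hnear]
    unfold indNonpos
    split_ifs <;> norm_num
  · rw [if_neg hnear]
    have : indNonpos (z.2 - z.1 ⬝ᵥ Δ) = indNonpos (z.2 - z.1 ⬝ᵥ Δ') := by
      unfold indNonpos
      rw [abs_le, not_and_or] at hnear
      congr 1
      rw [eq_iff_iff]
      constructor <;> intro h <;> rcases hnear with h' | h' <;> linarith
    rw [this, sub_self, abs_zero]

namespace Population

variable {p : ℕ} {P : Population p} {τ f₁ f₂ l₀ c₁ α lamMin lamMax : ℝ} {θ C : ℝ}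

theorem Regular.abs_info_mulVec_le (hP : P.Regular τ f₁ f₂ l₀ c₁ α lamMin lamMax)
    (hE : P.EnvelopeBound θ C) (hθ : 0 ≤ θ) (hC : 0 ≤ C) {S : Finset (Fin (p + 1))} {v : Vec p}
    (hv : SuppIn S v) {η : ℝ} (h : ∀ j, |v j| ≤ η) (j : Fin (p + 1)) :
    |(P.info *ᵥ v) j| ≤ (1 + l₀) * C * (S.card * η) := by
  have hl := hP.l₀_nonneg
  have hη : 0 ≤ η := (abs_nonneg _).trans (h 0)
  rw [hP.info_mulVec_apply, ← Real.norm_eq_abs]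
  have hi : Integrable (fun x => (1 + l₀) * (η *
      ∑ l ∈ S, envelope θ (Pi.single j 1) (Pi.single l 1) x)) P.lawX :=
    ((integrable_finsetSum _ fun l _ => hE.integrable_envelope (l2norm_single_le j)
      (l2norm_single_le l)).const_mul _).const_mul _
  refine (norm_integral_le_of_norm_le hi ?_).trans ?_
  · filter_upwards [hP.f_le] with x hx
    rw [Real.norm_eq_abs, abs_mul, abs_mul, abs_of_nonneg (hP.f_nonneg x 0)]
    have h1 := abs_dot_le_mul_absSum hv h x
    calc P.f x 0 * (|x j| * |x ⬝ᵥ v|) ≤ (1 + l₀) * (|x j| * (η * absSum S x)) := by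
          gcongr
          exact hx 0
      _ = (1 + l₀) * (η * ∑ l ∈ S, |x j| ^ 1 * |x l| ^ 1) := by
          simp only [absSum, pow_one, ← Finset.mul_sum]; ring
      _ ≤ _ := by
          gcongr with l hl
          have := pow_mul_pow_le_envelope hθ (Pi.single j 1) (Pi.single l 1) x
              (a := 1) (b := 1) (by norm_num) (by norm_num)
          rwa [dotProduct_single_one', dotProduct_single_one'] at this
  · rw [integral_const_mul, integral_const_mul, integral_finsetSum _ fun l _ =>
      hE.integrable_envelope (l2norm_single_le j) (l2norm_single_le l)]
    have : ∑ l ∈ S, ∫ x, envelope θ (Pi.single j 1) (Pi.single l 1) x ∂P.lawX ≤ S.card * C := by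
      rw [← nsmul_eq_mul]
      exact Finset.sum_le_card_nsmul _ _ _ fun l _ =>
        hE.integral_envelope_le hC (l2norm_single_le j) (l2norm_single_le l)
    calc _ ≤ (1 + l₀) * (η * (S.card * C)) := by gcongr
      _ = _ := by ring

theorem Regular.integral_lipStat_le (hP : P.Regular τ f₁ f₂ l₀ c₁ α lamMin lamMax)
    (hE : P.EnvelopeBound θ C) (hC : 0 ≤ C) (S : Finset (Fin (p + 1))) :
    Integrable (lipStat S θ) P.jointLaw ∧
    ∫ z, lipStat S θ z ∂P.jointLaw ≤ (1 + S.card) * ((p + 1) * (S.card * C)) := by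
  have hint : ∀ j l : Fin (p + 1), Integrable (fun z : Vec p × ℝ =>
      envelope θ (Pi.single j 1) (Pi.single l 1) z.1) P.jointLaw := by
    intro j l
    have h := hE.integrable_envelope (l2norm_single_le j) (l2norm_single_le l)
    rw [← hP.map_fst_jointLaw] at h
    exact h.comp_measurable measurable_fst
  have hval : ∀ j l : Fin (p + 1), ∫ z : Vec p × ℝ,
      envelope θ (Pi.single j 1) (Pi.single l 1) z.1 ∂P.jointLaw ≤ C := by
    intro j l
    have h := hE.integral_envelope_le hC (l2norm_single_le j) (l2norm_single_le l)
    rwa [← hP.map_fst_jointLaw, integral_map measurable_fst.aemeasurable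
      (measurable_envelope _ _ _).aestronglyMeasurable] at h
  constructor
  · exact (integrable_finsetSum _ fun j _ => integrable_finsetSum _ fun l _ => hint j l).const_mul _
  · simp only [lipStat]
    rw [integral_const_mul, integral_finsetSum _ fun j _ => integrable_finsetSum _ fun l _ => hint j l]
    gcongr
    have h1 : ∀ j ∈ (Finset.univ : Finset (Fin (p + 1))), ∫ z : Vec p × ℝ,
        ∑ l ∈ S, envelope θ (Pi.single j 1) (Pi.single l 1) z.1 ∂P.jointLaw ≤ S.card * C := by
      intro j _
      rw [integral_finsetSum _ fun l _ => hint j l, ← nsmul_eq_mul]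
      exact Finset.sum_le_card_nsmul _ _ _ fun l _ => hval j l
    refine (Finset.sum_le_card_nsmul _ _ _ h1).trans (le_of_eq ?_)
    simp

variable {Ω ι : Type*} {mΩ : MeasurableSpace Ω} {μ : Measure Ω} [Fintype ι] [Nonempty ι]
  {ξ : ι → Ω → Vec p × ℝ}

/-- The score at `β⋆` is uniformly small. -/
theorem Regular.score_deviation (hP : P.Regular τ f₁ f₂ l₀ c₁ α lamMin lamMax)
    (hE : P.EnvelopeBound θ C) (hθ : 0 ≤ θ) (hC : 0 < C) (hτ₀ : 0 < τ) (hτ₁ : τ < 1)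
    [IsProbabilityMeasure μ] (hξ : IsSample ξ μ P.jointLaw) {t : ℝ} (ht : 0 ≤ t)
    (htC : t ≤ 2 * C) :
    μ.real {ω | ¬ ∀ j, |emp ξ (scoreStat τ j) ω| ≤ t}
      ≤ (p + 1) * (2 * Real.exp (-(Fintype.card ι * t ^ 2 / (4 * C)))) := by
  have := hP.isProbabilityMeasure_jointLaw
  have hsub : {ω | ¬ ∀ j, |emp ξ (scoreStat τ j) ω| ≤ t}
      ⊆ ⋃ j ∈ (Finset.univ : Finset (Fin (p + 1))),
        {ω | t ≤ |emp ξ (scoreStat τ j) ω - ∫ z, scoreStat τ j z ∂P.jointLaw|} := by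
    intro ω hω
    obtain ⟨j, hj⟩ := not_forall.1 hω
    refine Set.mem_iUnion₂.2 ⟨j, Finset.mem_univ j, ?_⟩
    rw [Set.mem_ofPred_eq, hP.integral_scoreStat hE hθ hτ₀ hτ₁, sub_zero]
    exact (not_le.1 hj).le
  refine (measureReal_mono hsub (measure_ne_top _ _)).trans ((measureReal_biUnion_le_card_mul _ _ fun j _ =>
    hξ.bernstein (measurable_scoreStat τ j) hC (hP.expMoment_scoreStat hE hθ hτ₀ hτ₁ j) ht
      (by linarith)).trans (le_of_eq ?_))
  simp

/-- Uniform linearization of the score near `β⋆`. -/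
theorem Regular.incr_deviation (hP : P.Regular τ f₁ f₂ l₀ c₁ α lamMin lamMax)
    (hE : P.EnvelopeBound θ C) (hθ : 0 ≤ θ) (hC : 0 < C)
    [IsProbabilityMeasure μ] (hξ : IsSample ξ μ P.jointLaw) {S : Finset (Fin (p + 1))}
    (hS : 1 ≤ S.card) {M : ℕ} (hM : 1 ≤ M) {ρ : ℝ} (hρ : 0 < ρ) (hρ1 : ρ ≤ 1)
    (hMρ : S.card / M ≤ ρ) {t : ℝ} (ht : 0 ≤ t) (htC : t ≤ 4 * (1 + l₀) * (ρ * C)) :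
    μ.real {ω | ¬ ∀ Δ : Vec p, SuppIn S Δ → l2norm Δ ≤ ρ → ∀ j,
        |emp ξ (incrStat Δ j) ω - (P.info *ᵥ Δ) j|
          ≤ 2 * t + 2 * l₀ * C * l2norm Δ ^ 2 + 5 * (1 + l₀) * C * (S.card / M)}
      ≤ (2 * M + 1) ^ S.card * (p + 1) *
        (4 * Real.exp (-(Fintype.card ι * t ^ 2 / (8 * (1 + l₀) * (ρ * C))))) := by
  classical
  have := hP.isProbabilityMeasure_jointLaw
  have hl := hP.l₀_nonneg
  have hM0 : (0 : ℝ) < M := by exact_mod_cast hM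
  have hs1 : (1 : ℝ) ≤ S.card := by exact_mod_cast hS
  set η : ℝ := 1 / M with hη
  have hη0 : 0 < η := by positivity
  have hη1 : η ≤ 1 := by rw [hη, div_le_one hM0]; exact_mod_cast hM
  have hsη : (S.card : ℝ) / M = S.card * η := by rw [hη]; ring
  have hsqrt : Real.sqrt S.card ≤ S.card := by
    rw [Real.sqrt_le_left (by positivity)]; nlinarith
  set V : ℝ := (1 + l₀) * (2 * ρ * C) with hV
  have hV0 : 0 < V := by positivity
  set A := (grid S M).filter (fun u => l2norm u ≤ 2 * ρ) ×ˢ (Finset.univ : Finset (Fin (p + 1)))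
  set q := 4 * Real.exp (-(Fintype.card ι * t ^ 2 / (8 * (1 + l₀) * (ρ * C)))) with hq
  set Ev : Vec p × Fin (p + 1) → Set Ω := fun a =>
    {ω | t ≤ |emp ξ (incrStat a.1 a.2) ω - ∫ z, incrStat a.1 a.2 z ∂P.jointLaw|} ∪
    {ω | t ≤ |emp ξ (nearStat S η a.1 a.2) ω - ∫ z, nearStat S η a.1 a.2 z ∂P.jointLaw|} with hEv
  have hnear := fun (u : Vec p) (j : Fin (p + 1)) =>
    hP.expMoment_nearStat hE hθ hC.le S hη0.le u j
  have hprob : ∀ a ∈ A, μ.real (Ev a) ≤ q := by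
    rintro ⟨u, j⟩ ha
    have hu : l2norm u ≤ 2 * ρ := (Finset.mem_filter.1 (Finset.mem_product.1 ha).1).2
    have h1 := hξ.bernstein (measurable_incrStat u j) hV0
      (hP.expMoment_incrStat hE hθ (by positivity) hu j) ht (by rw [hV]; linarith)
    have h2 := hξ.bernstein (measurable_nearStat η u j) hV0
      ((hnear u j).1.mono (by
        rw [hV]
        gcongr ?_ * ?_
        have := mul_le_mul_of_nonneg_right (hsη ▸ hMρ) hC.le
        linarith)) ht (by rw [hV]; linarith)
    refine (measureReal_union_le _ _).trans ((add_le_add h1 h2).trans (le_of_eq ?_))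
    have e : 4 * V = 8 * (1 + l₀) * (ρ * C) := by rw [hV]; ring
    rw [hq, e]; ring
  have hsub : {ω | ¬ ∀ Δ : Vec p, SuppIn S Δ → l2norm Δ ≤ ρ → ∀ j,
      |emp ξ (incrStat Δ j) ω - (P.info *ᵥ Δ) j|
        ≤ 2 * t + 2 * l₀ * C * l2norm Δ ^ 2 + 5 * (1 + l₀) * C * (S.card / M)}
      ⊆ ⋃ a ∈ A, Ev a := by
    intro ω hω
    by_contra hbad
    apply hω
    intro Δ hΔS hΔ j
    obtain ⟨u, hu, hΔu⟩ := exists_mem_grid hM hΔS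
      (fun j => (abs_apply_le_l2norm Δ j).trans (hΔ.trans hρ1))
    have huS := suppIn_of_mem_grid hu
    have hul := l2norm_le_add_of_sub_le hΔS huS hη0.le hΔu
    have hsη' : Real.sqrt S.card * η ≤ S.card * η := by gcongr
    have hu2 : l2norm u ≤ 2 * ρ := by linarith [hsη ▸ hMρ]
    have hmem : (u, j) ∈ A :=
      Finset.mem_product.2 ⟨Finset.mem_filter.2 ⟨hu, hu2⟩, Finset.mem_univ j⟩
    have hnot : ω ∉ Ev (u, j) := fun h => hbad (Set.mem_iUnion₂.2 ⟨(u, j), hmem, h⟩)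
    simp only [hEv, Set.mem_union, Set.mem_ofPred_eq, not_or, not_le] at hnot
    obtain ⟨n1, n2⟩ := hnot
    have a1 := abs_emp_sub_le (ξ := ξ) (fun z => abs_incrStat_sub_le hΔS huS hΔu j z) ω
    set r := l2norm Δ + Real.sqrt S.card * η with hr
    have hsq0 : 0 < Real.sqrt S.card := Real.sqrt_pos.2 (by linarith)
    have hr0 : 0 < r := by
      have := l2norm_nonneg Δ
      positivity
    have a2 := hP.abs_integral_incrStat_sub_le hE hθ hC.le hr0 hul j
    have a3 := hP.abs_info_mulVec_le hE hθ hC.le (hΔS.sub huS) hΔu j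
    have a4 := (hnear u j).2
    have hr2 : r ^ 2 ≤ 2 * l2norm Δ ^ 2 + 2 * (S.card * η) := by
      have h5 : (Real.sqrt S.card * η) ^ 2 ≤ S.card * η := by
        rw [mul_pow, Real.sq_sqrt (Nat.cast_nonneg _)]
        gcongr
        nlinarith
      rw [hr]
      nlinarith [sq_nonneg (l2norm Δ - Real.sqrt S.card * η)]
    have a5 : l₀ * C * r ^ 2 ≤ 2 * l₀ * C * l2norm Δ ^ 2 + 2 * (1 + l₀) * C * (S.card * η) := by
      have h6 : l₀ * C * r ^ 2 ≤ l₀ * C * (2 * l2norm Δ ^ 2 + 2 * (S.card * η)) := by gcongr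
      have h7 : 0 ≤ C * (S.card * η) := by positivity
      linarith
    rw [Matrix.mulVec_sub, Pi.sub_apply] at a3
    rw [hsη]
    rw [abs_lt] at n1 n2
    rw [abs_le] at a1 a2 a3 ⊢
    constructor <;> linarith
  refine (measureReal_mono hsub (measure_ne_top _ _)).trans ((measureReal_biUnion_le_card_mul A Ev hprob).trans ?_)
  have hcard : (A.card : ℝ) ≤ (2 * M + 1) ^ S.card * (p + 1) := by
    rw [Finset.card_product, Finset.card_univ, Fintype.card_fin]
    have h1 : ((grid S M).filter (fun u => l2norm u ≤ 2 * ρ)).card ≤ (2 * M + 1) ^ S.card :=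
      (Finset.card_filter_le _ _).trans card_grid_le
    exact_mod_cast Nat.mul_le_mul_right _ h1
  have hq0 : 0 ≤ q := by positivity
  gcongr

/-- Uniform consistency of the smoothed Hessian on sparse vectors near `β⋆`. -/
theorem Regular.hess_deviation (hP : P.Regular τ f₁ f₂ l₀ c₁ α lamMin lamMax)
    (hE : P.EnvelopeBound θ C) (hθ : 0 ≤ θ) (hC : 0 < C) {K : ℝ → ℝ} (hK : IsSmoothingKernel K)
    {B : ℝ} (hB : KernelBound K B)
    [IsProbabilityMeasure μ] (hξ : IsSample ξ μ P.jointLaw) {S : Finset (Fin (p + 1))}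
    (hS : 1 ≤ S.card) {M : ℕ} (hM : 1 ≤ M) {b : ℝ} (hb : 0 < b) (hb1 : b ≤ 1) {ρ : ℝ}
    (hρ : 0 < ρ) (hρ1 : ρ ≤ 1) (hMρ : S.card / M ≤ ρ) (hM2 : S.card / M ≤ (1 / 2 : ℝ))
    {t T : ℝ} (ht : 0 ≤ t) (htC : t ≤ 2 * θ * ((1 + l₀) * C)) (hT : 0 < T) :
    μ.real {ω | ¬ ∀ Δ : Vec p, SuppIn S Δ → l2norm Δ ≤ ρ → ∀ δ : Vec p, SuppIn S δ → ∀ j,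
        |emp ξ (hessStat K b Δ δ j) ω - (P.info *ᵥ δ) j|
          ≤ 2 * (t + l₀ * C * (b * kernelMoment K + 4 * ρ) + (1 + l₀) * C * (S.card / M)
            + B / (M * b ^ 2) * T) * l2norm δ}
      ≤ (2 * M + 1) ^ S.card * (2 * M + 1) ^ S.card * (p + 1) *
        (2 * Real.exp (-(Fintype.card ι * t ^ 2 * b / (4 * ((1 + l₀) * (B * C))))))
        + (1 + S.card) * ((p + 1) * (S.card * C)) / T := by
  classical
  have := hP.isProbabilityMeasure_jointLaw
  have hl := hP.l₀_nonneg
  have hB0 := hB.pos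
  have hM0 : (0 : ℝ) < M := by exact_mod_cast hM
  have hs1 : (1 : ℝ) ≤ S.card := by exact_mod_cast hS
  set η : ℝ := 1 / M with hη
  have hη0 : 0 < η := by positivity
  have hsη : (S.card : ℝ) / M = S.card * η := by rw [hη]; ring
  have hsqrt : Real.sqrt S.card ≤ S.card := by
    rw [Real.sqrt_le_left (by positivity)]; nlinarith
  have hsη' : Real.sqrt S.card * η ≤ S.card * η := by gcongr
  set V : ℝ := (1 + l₀) * (B * C) / b with hV
  have hV0 : 0 < V := by positivity
  set A := grid S M ×ˢ (grid S M).filter (fun u => l2norm u ≤ 1) ×ˢ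
    (Finset.univ : Finset (Fin (p + 1)))
  set q := 2 * Real.exp (-(Fintype.card ι * t ^ 2 * b / (4 * ((1 + l₀) * (B * C))))) with hq
  set Ev : Vec p × Vec p × Fin (p + 1) → Set Ω := fun a =>
    {ω | t ≤ |emp ξ (hessStat K b a.1 a.2.1 a.2.2) ω
      - ∫ z, hessStat K b a.1 a.2.1 a.2.2 z ∂P.jointLaw|} with hEv
  set EvT : Set Ω := {ω | T ≤ emp ξ (lipStat S θ) ω} with hEvT
  have hprob : ∀ a ∈ A, μ.real (Ev a) ≤ q := by
    rintro ⟨u, w, j⟩ ha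
    have hw : l2norm w ≤ 1 :=
      (Finset.mem_filter.1 (Finset.mem_product.1 (Finset.mem_product.1 ha).2).1).2
    have h1 := hξ.bernstein (hK.measurable_hessStat b u w j) hV0
      (hP.expMoment_hessStat hE hθ hK hB0 hB.le hb u hw j) ht (by
        rw [hV]
        refine htC.trans (le_of_eq ?_)
        field_simp)
    refine h1.trans (le_of_eq ?_)
    rw [hq, hV]
    congr 3
    field_simp
  have hprobT : μ.real EvT ≤ (1 + S.card) * ((p + 1) * (S.card * C)) / T := by
    obtain ⟨i1, i2⟩ := hP.integral_lipStat_le hE hC.le S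
    refine (hξ.markov (measurable_lipStat S θ) (lipStat_nonneg S θ) i1 hT).trans ?_
    gcongr
  have hsub : {ω | ¬ ∀ Δ : Vec p, SuppIn S Δ → l2norm Δ ≤ ρ → ∀ δ : Vec p, SuppIn S δ → ∀ j,
        |emp ξ (hessStat K b Δ δ j) ω - (P.info *ᵥ δ) j|
          ≤ 2 * (t + l₀ * C * (b * kernelMoment K + 4 * ρ) + (1 + l₀) * C * (S.card / M)
            + B / (M * b ^ 2) * T) * l2norm δ}
      ⊆ (⋃ a ∈ A, Ev a) ∪ EvT := by
    intro ω hω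
    by_contra hbad
    rw [Set.mem_union, not_or] at hbad
    obtain ⟨hbad, hbadT⟩ := hbad
    have hT' : emp ξ (lipStat S θ) ω ≤ T := (not_le.1 hbadT).le
    apply hω
    intro Δ hΔS hΔ
    obtain ⟨u, hu, hΔu⟩ := exists_mem_grid hM hΔS
      (fun j => (abs_apply_le_l2norm Δ j).trans (hΔ.trans hρ1))
    have huS := suppIn_of_mem_grid hu
    have hul := l2norm_le_add_of_sub_le hΔS huS hη0.le hΔu
    have hu2 : l2norm u ≤ 2 * ρ := by linarith [hsη ▸ hMρ]
    -- directions of length `1 / 2`, whose grid approximations stay in the unit ball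
    have half : ∀ δ : Vec p, SuppIn S δ → l2norm δ = 1 / 2 → ∀ j,
        |emp ξ (hessStat K b Δ δ j) ω - (P.info *ᵥ δ) j|
          ≤ t + l₀ * C * (b * kernelMoment K + 4 * ρ) + (1 + l₀) * C * (S.card / M)
            + B / (M * b ^ 2) * T := by
      intro δ hδS hδ j
      have hδ1 : ∀ j, |δ j| ≤ 1 := fun j => (abs_apply_le_l2norm δ j).trans (by rw [hδ]; norm_num)
      obtain ⟨w, hw, hδw⟩ := exists_mem_grid hM hδS hδ1
      have hwS := suppIn_of_mem_grid hw
      have hwl := l2norm_le_add_of_sub_le hδS hwS hη0.le hδw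
      have hw1 : l2norm w ≤ 1 := by rw [hsη] at hM2; linarith
      have hmem : (u, w, j) ∈ A := Finset.mem_product.2 ⟨hu, Finset.mem_product.2
        ⟨Finset.mem_filter.2 ⟨hw, hw1⟩, Finset.mem_univ j⟩⟩
      have n1 : ω ∉ Ev (u, w, j) := fun h => hbad (Set.mem_iUnion₂.2 ⟨(u, w, j), hmem, h⟩)
      simp only [hEv, Set.mem_ofPred_eq, not_le] at n1
      have a1 := abs_emp_sub_le (ξ := ξ) (fun z => abs_hessStat_sub_le hK hB hb hb1 hθ hΔS huS
        hδS hwS hΔu hδw hδ1 j z) ω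
      rw [emp_const_mul] at a1
      have a1' : η * B / b ^ 2 * emp ξ (lipStat S θ) ω ≤ B / (M * b ^ 2) * T := by
        have e : η * B / b ^ 2 = B / (M * b ^ 2) := by rw [hη]; field_simp
        rw [e]
        gcongr
      have a2 := hP.abs_integral_hessStat_sub_le hE hθ hC.le hK hb (ρ := 2 * ρ) (by positivity)
        hu2 hw1 j
      have a3 := hP.abs_info_mulVec_le hE hθ hC.le (hδS.sub hwS) hδw j
      rw [Matrix.mulVec_sub, Pi.sub_apply] at a3
      rw [hsη]
      rw [abs_lt] at n1
      rw [abs_le] at a1 a2 a3 ⊢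
      constructor <;> linarith
    intro δ hδS j
    rcases eq_or_ne δ 0 with rfl | hδ0
    · have e0 : hessStat K b Δ (0 : Vec p) j = fun _ => 0 := by
        funext z; simp [hessStat]
      simp [e0, emp, l2norm_zero]
    · have hpos := l2norm_pos hδ0
      have h1 := half ((2 * l2norm δ)⁻¹ • δ) (hδS.smul _) (by
        rw [l2norm_smul, abs_of_pos (by positivity)]; field_simp) j
      have e1 : hessStat K b Δ ((2 * l2norm δ)⁻¹ • δ) j
          = fun z => (2 * l2norm δ)⁻¹ * hessStat K b Δ δ j z := by
        funext z
        simp only [hessStat, dotProduct_smul, smul_eq_mul]; ring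
      rw [e1, emp_const_mul, Matrix.mulVec_smul, Pi.smul_apply, smul_eq_mul, ← mul_sub, abs_mul,
        abs_of_pos (by positivity), inv_mul_le_iff₀ (by positivity)] at h1
      linarith
  refine (measureReal_mono hsub (measure_ne_top _ _)).trans ((measureReal_union_le _ _).trans
    (add_le_add ((measureReal_biUnion_le_card_mul A Ev hprob).trans ?_) hprobT))
  have hcard : (A.card : ℝ) ≤ (2 * M + 1) ^ S.card * (2 * M + 1) ^ S.card * (p + 1) := by
    rw [Finset.card_product, Finset.card_product, Finset.card_univ, Fintype.card_fin, mul_assoc]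
    have h1 : ((grid S M).filter (fun u => l2norm u ≤ 1)).card ≤ (2 * M + 1) ^ S.card :=
      (Finset.card_filter_le _ _).trans card_grid_le
    exact_mod_cast Nat.mul_le_mul card_grid_le (Nat.mul_le_mul_right _ h1)
  have hq0 : 0 ≤ q := by positivity
  gcongr

end Population

/-! ### The asymptotic regime -/

namespace Experiment

/-- The radius `log N · √(s log N / n)` of a ball around `β⋆` that eventually contains all iterates
and on which score and Hessian are controlled. -/
noncomputable def radius (E : Experiment) : ℝ := Real.log E.N * E.initialRate

/-- The relations between the sizes of one experiment that hold for all large sample sizes. -/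
structure InRegime (E : Experiment) (c cb Cb : ℝ) (w : ℕ) : Prop where
  s_pos : 1 ≤ E.s
  s_le : E.s ≤ E.n
  n_le : E.n ≤ E.N
  two_le : 2 ≤ E.N
  one_le_log : 1 ≤ Real.log E.N
  log_ge : c * Real.log E.N ≤ Real.log E.n
  log_le : Real.log E.n ≤ Real.log E.N
  p_le : ((E.p : ℝ) + 1) ≤ (E.N : ℝ) ^ w
  b_ge : cb * (E.s * Real.log E.n / E.n) ^ (1 / 3 : ℝ) ≤ E.b
  b_le : E.b ≤ Cb * (E.s * Real.log E.n / E.n) ^ (1 / 3 : ℝ)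
  b_le_one : E.b ≤ 1
  radius_le : E.radius ≤ E.b
  first_small : (E.s : ℝ) ^ (5 / 2 : ℝ) * Real.log E.n / E.n ≤ 1
  second_small : (E.s : ℝ) ^ 2 * Real.log E.N / E.n ≤ 1

theorem n_le_N (E : Experiment) : E.n ≤ E.N := by
  have := NeZero.pos E.m
  exact Nat.le_mul_of_pos_left _ this

end Experiment

section Regime

variable {E : ℕ → Experiment} {ν c r : ℝ}

theorem tendsto_log_N (hN : Tendsto (fun k => (E k).N) atTop atTop) :
    Tendsto (fun k => Real.log (E k).N) atTop atTop :=
  Real.tendsto_log_atTop.comp (tendsto_natCast_atTop_atTop.comp hN)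

theorem tendsto_n (hc : 0 < c) (hN : Tendsto (fun k => (E k).N) atTop atTop)
    (hn : ∀ k, ((E k).N : ℝ) ^ c ≤ (E k).n) :
    Tendsto (fun k => ((E k).n : ℝ)) atTop atTop :=
  tendsto_atTop_mono hn
    ((tendsto_rpow_atTop hc).comp (tendsto_natCast_atTop_atTop.comp hN))

theorem log_n_ge (hN : Tendsto (fun k => (E k).N) atTop atTop)
    (hn : ∀ k, ((E k).N : ℝ) ^ c ≤ (E k).n) :
    ∀ᶠ k in atTop, c * Real.log (E k).N ≤ Real.log (E k).n := by
  filter_upwards [hN.eventually_ge_atTop 1] with k hk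
  have h0 : (0 : ℝ) < (E k).N := by exact_mod_cast hk
  rw [← Real.log_rpow h0]
  exact Real.log_le_log (Real.rpow_pos_of_pos h0 _) (hn k)

/-- Powers of `s` below the critical exponent and powers of `log N` are negligible against powers
of the local sample size. -/
theorem tendsto_rpow_div (hc : 0 < c) (hN : Tendsto (fun k => (E k).N) atTop atTop)
    (hn : ∀ k, ((E k).N : ℝ) ^ c ≤ (E k).n)
    (hs : (fun k => ((E k).s : ℝ)) =O[atTop] fun k => ((E k).n : ℝ) ^ r)
    {a b q : ℝ} (ha : 0 ≤ a) (hb : 0 ≤ b) (haq : a * r < q) :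
    Tendsto (fun k => ((E k).s : ℝ) ^ a * Real.log (E k).N ^ b / ((E k).n : ℝ) ^ q) atTop
      (𝓝 0) := by
  obtain ⟨D, hD, hDs⟩ := hs.exists_pos
  have hlim : Tendsto (fun k => D ^ a * (c⁻¹) ^ b *
      (Real.log (E k).n ^ b / ((E k).n : ℝ) ^ (q - a * r))) atTop (𝓝 0) := by
    have h1 := (isLittleO_log_rpow_rpow_atTop b (sub_pos.2 haq)).tendsto_div_nhds_zero
    have h2 := (h1.comp (tendsto_n hc hN hn)).const_mul (D ^ a * (c⁻¹) ^ b)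
    simpa using h2
  refine tendsto_of_tendsto_of_tendsto_of_le_of_le' tendsto_const_nhds hlim ?_ ?_
  · filter_upwards [(tendsto_log_N hN).eventually_ge_atTop 0] with k hk
    positivity
  · filter_upwards [hDs.bound, log_n_ge hN hn, (tendsto_log_N hN).eventually_ge_atTop 0,
      (tendsto_n hc hN hn).eventually_gt_atTop 0] with k h1 h2 h3 h4
    rw [Real.norm_eq_abs, Nat.abs_cast, Real.norm_eq_abs, abs_of_nonneg (by positivity)] at h1
    have h5 : Real.log (E k).N ≤ c⁻¹ * Real.log (E k).n := by
      rw [inv_mul_eq_div, le_div_iff₀ hc]; linarith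
    have h6 : 0 ≤ Real.log (E k).n := le_trans (by positivity) h2
    calc ((E k).s : ℝ) ^ a * Real.log (E k).N ^ b / ((E k).n : ℝ) ^ q
        ≤ (D * ((E k).n : ℝ) ^ r) ^ a * (c⁻¹ * Real.log (E k).n) ^ b / ((E k).n : ℝ) ^ q := by
          gcongr
      _ = D ^ a * (c⁻¹) ^ b * (Real.log (E k).n ^ b / ((E k).n : ℝ) ^ (q - a * r)) := by
          rw [Real.mul_rpow hD.le (by positivity), Real.mul_rpow (by positivity) h6,
            Real.rpow_sub h4, ← Real.rpow_mul h4.le, mul_comm r a]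
          field_simp

/-- The asymptotic hypotheses shared by all statements. -/
structure Asymptotics (E : ℕ → Experiment) (ν c r : ℝ) : Prop where
  c_pos : 0 < c
  r_nonneg : 0 ≤ r
  r_lt : r < 1 / 3
  N_top : Tendsto (fun k => (E k).N) atTop atTop
  p_bound : (fun k => ((E k).p : ℝ)) =O[atTop] fun k => ((E k).N : ℝ) ^ ν
  n_ge : ∀ k, ((E k).N : ℝ) ^ c ≤ (E k).n
  s_bound : (fun k => ((E k).s : ℝ)) =O[atTop] fun k => ((E k).n : ℝ) ^ r
  h_pos : ∀ k, 0 < (E k).h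
  b_pos : ∀ k, 0 < (E k).b
  h_rate : (fun k => (E k).h) =Θ[atTop]
    fun k => ((E k).s * Real.log (E k).N / (E k).N) ^ (1 / 3 : ℝ)
  b_rate : (fun k => (E k).b) =Θ[atTop]
    fun k => ((E k).s * Real.log (E k).n / (E k).n) ^ (1 / 3 : ℝ)

namespace Asymptotics

theorem tendsto_div (hA : Asymptotics E ν c r) {a b q : ℝ} (ha : 0 ≤ a) (hb : 0 ≤ b)
    (haq : a * r < q) :
    Tendsto (fun k => ((E k).s : ℝ) ^ a * Real.log (E k).N ^ b / ((E k).n : ℝ) ^ q) atTop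
      (𝓝 0) :=
  tendsto_rpow_div hA.c_pos hA.N_top hA.n_ge hA.s_bound ha hb haq

/-- A positive bandwidth of the order `(s log N / N)^{1/3}` rules out an empty support. -/
theorem eventually_s_pos (hA : Asymptotics E ν c r) : ∀ᶠ k in atTop, 1 ≤ (E k).s := by
  obtain ⟨D, hD⟩ := hA.h_rate.1.bound
  filter_upwards [hD] with k hk
  by_contra hs
  have hs0 : (E k).s = 0 := by omega
  rw [hs0, Nat.cast_zero, zero_mul, zero_div, Real.zero_rpow (by norm_num), norm_zero, mul_zero]
    at hk
  exact (hA.h_pos k).ne' (norm_le_zero_iff.1 hk)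

/-- The radius in terms of powers. -/
theorem radius_eq {E : Experiment} (hlog : 0 ≤ Real.log E.N) :
    E.radius = (E.s : ℝ) ^ (1 / 2 : ℝ) * Real.log E.N ^ (3 / 2 : ℝ) / (E.n : ℝ) ^ (1 / 2 : ℝ) := by
  rw [Experiment.radius, Experiment.initialRate, Real.sqrt_eq_rpow,
    Real.div_rpow (by positivity) (by positivity), Real.mul_rpow (by positivity) hlog]
  have : Real.log E.N ^ (3 / 2 : ℝ) = Real.log E.N * Real.log E.N ^ (1 / 2 : ℝ) := by
    rw [← Real.rpow_one_add' hlog (by norm_num)]; norm_num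
  rw [this]; ring

theorem tendsto_s_mul_radius (hA : Asymptotics E ν c r) :
    Tendsto (fun k => ((E k).s : ℝ) * (E k).radius) atTop (𝓝 0) := by
  have h := hA.tendsto_div (a := 3 / 2) (b := 3 / 2) (q := 1 / 2) (by norm_num) (by norm_num)
    (by linarith [hA.r_lt])
  refine h.congr' ?_
  filter_upwards [(tendsto_log_N hA.N_top).eventually_ge_atTop 0] with k hk
  have : ((E k).s : ℝ) ^ (3 / 2 : ℝ) = (E k).s * ((E k).s : ℝ) ^ (1 / 2 : ℝ) := by
    rw [← Real.rpow_one_add' (Nat.cast_nonneg _) (by norm_num)]; norm_num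
  rw [radius_eq hk, this]; ring

theorem exists_b_bounds (hA : Asymptotics E ν c r) : ∃ cb > 0, ∃ Cb > 0, ∀ᶠ k in atTop,
    cb * ((E k).s * Real.log (E k).n / (E k).n) ^ (1 / 3 : ℝ) ≤ (E k).b ∧
    (E k).b ≤ Cb * ((E k).s * Real.log (E k).n / (E k).n) ^ (1 / 3 : ℝ) := by
  obtain ⟨D, hD, h1⟩ := hA.b_rate.1.exists_pos
  obtain ⟨D', hD', h2⟩ := hA.b_rate.2.exists_pos
  refine ⟨D'⁻¹, inv_pos.2 hD', D, hD, ?_⟩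
  filter_upwards [h1.bound, h2.bound, (tendsto_n hA.c_pos hA.N_top hA.n_ge).eventually_ge_atTop 1]
    with k h1 h2 h3
  have h0 : 0 ≤ Real.log (E k).n := Real.log_nonneg h3
  rw [Real.norm_eq_abs, Real.norm_eq_abs, abs_of_pos (hA.b_pos k),
    abs_of_nonneg (by positivity)] at h1 h2
  refine ⟨?_, h1⟩
  rw [inv_mul_eq_div, div_le_iff₀ hD']
  linarith

theorem eventually_log_le (hA : Asymptotics E ν c r) :
    ∀ᶠ k in atTop, Real.log (E k).n ≤ Real.log (E k).N := by
  filter_upwards [(tendsto_n hA.c_pos hA.N_top hA.n_ge).eventually_gt_atTop 0] with k hk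
  exact Real.log_le_log hk (by exact_mod_cast (E k).n_le_N)

theorem tendsto_sqrt_s_mul_b (hA : Asymptotics E ν c r) :
    Tendsto (fun k => Real.sqrt (E k).s * (E k).b) atTop (𝓝 0) := by
  obtain ⟨cb, -, Cb, hCb, hb⟩ := hA.exists_b_bounds
  have h := (hA.tendsto_div (a := 5 / 6) (b := 1 / 3) (q := 1 / 3) (by norm_num) (by norm_num)
    (by linarith [hA.r_lt])).const_mul Cb
  rw [mul_zero] at h
  refine tendsto_of_tendsto_of_tendsto_of_le_of_le' tendsto_const_nhds h ?_ ?_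
  · exact Eventually.of_forall fun k => mul_nonneg (Real.sqrt_nonneg _) (hA.b_pos k).le
  · filter_upwards [hb, hA.eventually_log_le,
      (tendsto_n hA.c_pos hA.N_top hA.n_ge).eventually_ge_atTop 1] with k h1 h2 h3
    have h0 : 0 ≤ Real.log (E k).n := Real.log_nonneg h3
    have e : ((E k).s : ℝ) ^ (5 / 6 : ℝ)
        = ((E k).s : ℝ) ^ (1 / 2 : ℝ) * ((E k).s : ℝ) ^ (1 / 3 : ℝ) := by
      rw [← Real.rpow_add' (Nat.cast_nonneg _) (by norm_num)]; norm_num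
    calc Real.sqrt (E k).s * (E k).b
        ≤ Real.sqrt (E k).s *
          (Cb * ((E k).s * Real.log (E k).N / (E k).n) ^ (1 / 3 : ℝ)) := by
          gcongr
          exact h1.2.trans (by gcongr)
      _ = _ := by
          rw [Real.sqrt_eq_rpow, Real.div_rpow (mul_nonneg (by positivity) (h0.trans h2))
            (by positivity), Real.mul_rpow (by positivity) (h0.trans h2), e]
          ring

theorem exists_inRegime (hA : Asymptotics E ν c r) : ∃ cb > 0, ∃ Cb > 0, ∃ w : ℕ,
    ∀ᶠ k in atTop, (E k).InRegime c cb Cb w := by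
  have hc := hA.c_pos
  have hr := hA.r_lt
  have hr0 := hA.r_nonneg
  obtain ⟨cb, hcb, Cb, hCb, hb⟩ := hA.exists_b_bounds
  have hNtop : Tendsto (fun k => ((E k).N : ℝ)) atTop atTop :=
    tendsto_natCast_atTop_atTop.comp hA.N_top
  have hlogtop := tendsto_log_N hA.N_top
  have hntop := tendsto_n hA.c_pos hA.N_top hA.n_ge
  have t1 := hA.tendsto_div (a := 1) (b := 0) (q := 1) (by norm_num) le_rfl (by linarith)
  have t2 := hA.tendsto_div (a := 5 / 2) (b := 1) (q := 1) (by norm_num) (by norm_num)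
    (by linarith)
  have t3 := hA.tendsto_div (a := 2) (b := 1) (q := 1) (by norm_num) (by norm_num)
    (by linarith)
  have t4 := hA.tendsto_div (a := 1 / 6) (b := 7 / 6) (q := 1 / 6) (by norm_num) (by norm_num)
    (by linarith)
  have ht4 : 0 < cb * c ^ (1 / 3 : ℝ) := by positivity
  obtain ⟨D, hD⟩ := hA.p_bound.bound
  refine ⟨cb, hcb, Cb, hCb, ⌈|ν|⌉₊ + 1, ?_⟩
  filter_upwards [hb, hA.eventually_s_pos, hA.N_top.eventually_ge_atTop 2,
    hlogtop.eventually_ge_atTop 1, log_n_ge hA.N_top hA.n_ge, hA.eventually_log_le,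
    hD, hNtop.eventually_ge_atTop (D + 1), hntop.eventually_ge_atTop 1,
    hA.tendsto_sqrt_s_mul_b.eventually_le_const one_pos,
    t1.eventually_le_const one_pos, t2.eventually_le_const one_pos,
    t3.eventually_le_const one_pos, t4.eventually_le_const ht4]
    with k kb ks kN klog kge kle kp kD kn ksb k1 k2 k3 k4
  have hn0 : (0 : ℝ) < (E k).n := by linarith
  have hN2 : (2 : ℝ) ≤ (E k).N := by exact_mod_cast kN
  have hs1 : (1 : ℝ) ≤ (E k).s := by exact_mod_cast ks
  have hlog0 : 0 ≤ Real.log (E k).n := Real.log_nonneg kn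
  simp only [Real.rpow_one, Real.rpow_zero, mul_one] at k1 k2 k3
  have hx0 : 0 ≤ (E k).s * Real.log (E k).N / (E k).n := by positivity
  refine ⟨ks, ?_, (E k).n_le_N, kN, klog, kge, kle, ?_, kb.1, kb.2, ?_, ?_, ?_, ?_⟩
  · rw [div_le_one hn0] at k1
    exact_mod_cast k1
  · rw [Real.norm_eq_abs, Nat.abs_cast, Real.norm_eq_abs, abs_of_nonneg (by positivity)] at kp
    have e1 : ((E k).N : ℝ) ^ ν ≤ ((E k).N : ℝ) ^ ⌈|ν|⌉₊ := by
      rw [← Real.rpow_natCast]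
      exact Real.rpow_le_rpow_of_exponent_le (by linarith)
        ((le_abs_self ν).trans (Nat.le_ceil _))
    have e2 : 1 ≤ ((E k).N : ℝ) ^ ⌈|ν|⌉₊ := one_le_pow₀ (by linarith)
    have e3 : ((E k).p : ℝ) ≤ |D| * ((E k).N : ℝ) ^ ⌈|ν|⌉₊ := by
      refine kp.trans ((mul_le_mul_of_nonneg_right (le_abs_self D) (by positivity)).trans ?_)
      gcongr
    have e4 : |D| ≤ (E k).N - 1 := by
      rw [abs_le]
      constructor
      · by_contra hneg
        -- a negative constant bounds nothing nonnegative
        push Not at hneg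
        have h1 : D * ((E k).N : ℝ) ^ ν < 0 :=
          mul_neg_of_neg_of_pos (by linarith) (Real.rpow_pos_of_pos (by linarith) _)
        have h2 : (0 : ℝ) ≤ (E k).p := Nat.cast_nonneg _
        linarith
      · linarith
    rw [pow_succ]
    nlinarith
  · have : 1 ≤ Real.sqrt (E k).s := Real.one_le_sqrt.2 hs1
    nlinarith [hA.b_pos k]
  · have e0 : (E k).radius = ((E k).s * Real.log (E k).N / (E k).n) ^ (1 / 3 : ℝ) *
        (((E k).s : ℝ) ^ (1 / 6 : ℝ) * Real.log (E k).N ^ (7 / 6 : ℝ)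
          / ((E k).n : ℝ) ^ (1 / 6 : ℝ)) := by
      have hl : 0 ≤ Real.log (E k).N := by linarith
      have a1 : ((E k).s : ℝ) ^ (1 / 2 : ℝ)
          = ((E k).s : ℝ) ^ (1 / 3 : ℝ) * ((E k).s : ℝ) ^ (1 / 6 : ℝ) := by
        rw [← Real.rpow_add' (by positivity) (by norm_num)]; norm_num
      have a2 : Real.log (E k).N ^ (3 / 2 : ℝ)
          = Real.log (E k).N ^ (1 / 3 : ℝ) * Real.log (E k).N ^ (7 / 6 : ℝ) := by
        rw [← Real.rpow_add' hl (by norm_num)]; norm_num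
      have a3 : ((E k).n : ℝ) ^ (1 / 2 : ℝ)
          = ((E k).n : ℝ) ^ (1 / 3 : ℝ) * ((E k).n : ℝ) ^ (1 / 6 : ℝ) := by
        rw [← Real.rpow_add' (by positivity) (by norm_num)]; norm_num
      rw [radius_eq hl, Real.div_rpow (by positivity) (by positivity),
        Real.mul_rpow (by positivity) hl, a1, a2, a3]
      field_simp
    have e1 : ((E k).s * Real.log (E k).N / (E k).n) ^ (1 / 3 : ℝ) * c ^ (1 / 3 : ℝ)
        ≤ ((E k).s * Real.log (E k).n / (E k).n) ^ (1 / 3 : ℝ) := by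
      rw [← Real.mul_rpow hx0 hc.le]
      apply Real.rpow_le_rpow (by positivity) _ (by norm_num)
      rw [div_mul_eq_mul_div]
      apply div_le_div_of_nonneg_right _ hn0.le
      nlinarith
    rw [e0]
    calc _ ≤ ((E k).s * Real.log (E k).N / (E k).n) ^ (1 / 3 : ℝ) * (cb * c ^ (1 / 3 : ℝ)) := by
          gcongr
      _ = cb * (((E k).s * Real.log (E k).N / (E k).n) ^ (1 / 3 : ℝ) * c ^ (1 / 3 : ℝ)) := by ring
      _ ≤ cb * ((E k).s * Real.log (E k).n / (E k).n) ^ (1 / 3 : ℝ) := by gcongr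
      _ ≤ (E k).b := kb.1
  · refine le_trans ?_ k2
    gcongr
  · simpa using k3

end Asymptotics

end Regime

/-! ### Events of probability tending to one -/

namespace Experiment

/-- The observation `(X, ε)` in position `i` of machine `k`. -/
def obs (E : Experiment) (ki : Fin E.m × Fin E.n) (ω : E.Ω) : Vec E.p × ℝ :=
  (E.X ki.1 ki.2 ω, E.Y ki.1 ki.2 ω - E.X ki.1 ki.2 ω ⬝ᵥ E.pop.beta)

/-- The order `√(log N / N)` of the score at `β⋆` in the maximum norm. -/
noncomputable def noise (E : Experiment) : ℝ := Real.sqrt (Real.log E.N / E.N)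

theorem Valid.isSample {E : Experiment} (hE : E.Valid) : IsSample E.obs E.μ E.pop.jointLaw := by
  have hg : Measurable fun z : Vec E.p × ℝ => (z.1, z.2 - z.1 ⬝ᵥ E.pop.beta) := by
    have := Population.measurable_dot E.pop.beta
    fun_prop
  refine ⟨fun ki => ?_, ?_, fun ki => hE.law ki.1 ki.2⟩
  · exact hg.comp ((hE.measurable_X ki.1 ki.2).prodMk (hE.measurable_Y ki.1 ki.2))
  · exact hE.indep.comp (fun _ z => (z.1, z.2 - z.1 ⬝ᵥ E.pop.beta)) fun _ => hg

theorem Valid.isSample_central {E : Experiment} (hE : E.Valid) :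
    IsSample (fun i : Fin E.n => E.obs (0, i)) E.μ E.pop.jointLaw := by
  have h := hE.isSample
  exact ⟨fun i => h.measurable _, h.indep.precomp (g := fun i : Fin E.n => ((0 : Fin E.m), i))
    (fun i j hij => (Prod.mk.inj hij).2), fun i => h.law _⟩

/-- The score at `β⋆` is of order `√(log N / N)`. -/
def ScoreEvent (E : Experiment) (τ A : ℝ) (ω : E.Ω) : Prop :=
  ∀ j, |emp E.obs (scoreStat τ j) ω| ≤ A * E.noise

/-- The score is linear near `β⋆` up to `√(log N / N)` and a quadratic remainder. -/
def IncrEvent (E : Experiment) (A : ℝ) (ω : E.Ω) : Prop :=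
  ∀ Δ : Vec E.p, SuppIn E.pop.S Δ → l2norm Δ ≤ E.radius → ∀ j,
    |emp E.obs (incrStat Δ j) ω - (E.pop.info *ᵥ Δ) j| ≤ 3 * E.noise + A * l2norm Δ ^ 2

/-- The Hessian of the central machine is within order `b` of the information matrix on sparse
vectors. -/
def HessEvent (E : Experiment) (K : ℝ → ℝ) (A : ℝ) (ω : E.Ω) : Prop :=
  ∀ Δ : Vec E.p, SuppIn E.pop.S Δ → l2norm Δ ≤ E.radius → ∀ δ : Vec E.p, SuppIn E.pop.S δ → ∀ j,
    |emp (fun i : Fin E.n => E.obs (0, i)) (hessStat K E.b Δ δ j) ω - (E.pop.info *ᵥ δ) j|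
      ≤ A * E.b * l2norm δ

variable {E : Experiment} {c cb Cb : ℝ} {w : ℕ}

theorem noise_nonneg (E : Experiment) : 0 ≤ E.noise := Real.sqrt_nonneg _

namespace InRegime

variable (h : E.InRegime c cb Cb w)
include h

theorem one_le_s : (1 : ℝ) ≤ E.s := by exact_mod_cast h.s_pos

theorem one_le_n : (1 : ℝ) ≤ E.n := by exact_mod_cast h.s_pos.trans h.s_le

theorem two_le_N : (2 : ℝ) ≤ E.N := by exact_mod_cast h.two_le

theorem s_le_N : (E.s : ℝ) ≤ E.N := by exact_mod_cast h.s_le.trans h.n_le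

theorem noise_sq : E.noise ^ 2 = Real.log E.N / E.N :=
  Real.sq_sqrt (div_nonneg (zero_le_one.trans h.one_le_log) (Nat.cast_nonneg _))

theorem inv_N_le_noise : (E.N : ℝ)⁻¹ ≤ E.noise := by
  have h2 := h.two_le_N
  have h1 := h.one_le_log
  apply Real.le_sqrt_of_sq_le
  rw [sq, ← div_eq_mul_inv]
  apply div_le_div_of_nonneg_right _ (by positivity)
  exact (inv_le_one_of_one_le₀ (by linarith)).trans h1

theorem log_mul_noise_le_radius : Real.log E.N * E.noise ≤ E.radius := by
  have h1 := h.one_le_log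
  have hn := h.one_le_n
  have hs := h.one_le_s
  unfold radius initialRate noise
  gcongr
  · nlinarith
  · exact_mod_cast h.n_le

theorem noise_le_radius : E.noise ≤ E.radius :=
  (le_mul_of_one_le_left E.noise_nonneg h.one_le_log).trans h.log_mul_noise_le_radius

theorem radius_pos : 0 < E.radius := by
  have := h.two_le_N
  exact lt_of_lt_of_le (by positivity) (h.inv_N_le_noise.trans h.noise_le_radius)

theorem b_pos : 0 < E.b := h.radius_pos.trans_le h.radius_le

/-- The grid with mesh `N^{-(w + 5)}` is fine enough for all approximation errors. -/
theorem s_div_mesh_le : (E.s : ℝ) / ((E.N ^ (w + 5) : ℕ) : ℝ) ≤ (E.N : ℝ)⁻¹ * (E.N : ℝ)⁻¹ := by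
  have hN := h.two_le_N
  have h3 : (E.N : ℝ) ^ 3 ≤ (E.N : ℝ) ^ (w + 5) := pow_le_pow_right₀ (by linarith) (by omega)
  push_cast
  calc (E.s : ℝ) / (E.N : ℝ) ^ (w + 5) ≤ E.N / (E.N : ℝ) ^ 3 := by
        gcongr
        exact h.s_le.trans h.n_le
    _ = _ := by field_simp

theorem s_div_mesh_le_noise :
    (E.s : ℝ) / ((E.N ^ (w + 5) : ℕ) : ℝ) ≤ (E.N : ℝ)⁻¹ * E.noise := by
  have hN := h.two_le_N
  refine h.s_div_mesh_le.trans ?_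
  gcongr
  exact h.inv_N_le_noise

theorem s_div_mesh_le_radius : (E.s : ℝ) / ((E.N ^ (w + 5) : ℕ) : ℝ) ≤ E.radius := by
  have hN := h.two_le_N
  refine h.s_div_mesh_le_noise.trans (le_trans ?_ h.noise_le_radius)
  exact mul_le_of_le_one_left E.noise_nonneg (inv_le_one_of_one_le₀ (by linarith))

theorem s_div_mesh_le_half : (E.s : ℝ) / ((E.N ^ (w + 5) : ℕ) : ℝ) ≤ 1 / 2 := by
  have hN := h.two_le_N
  refine h.s_div_mesh_le.trans ?_
  have : (E.N : ℝ)⁻¹ ≤ 1 / 2 := by rw [inv_le_comm₀ (by positivity) (by norm_num)]; linarith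
  have h0 : 0 ≤ (E.N : ℝ)⁻¹ := by positivity
  nlinarith

theorem card_grid_le_pow :
    (2 * ((E.N ^ (w + 5) : ℕ) : ℝ) + 1) ^ E.pop.S.card ≤ (E.N : ℝ) ^ ((w + 7) * E.s) := by
  have hN := h.two_le_N
  rw [pow_mul]
  change _ ≤ ((E.N : ℝ) ^ (w + 7)) ^ E.pop.S.card
  refine pow_le_pow_left₀ (by positivity) ?_ _
  have h1 : 1 ≤ (E.N : ℝ) ^ (w + 5) := one_le_pow₀ (by linarith)
  push_cast
  have e : (E.N : ℝ) ^ (w + 7) = (E.N : ℝ) ^ (w + 5) * (E.N : ℝ) ^ 2 := by rw [← pow_add]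
  rw [e]
  nlinarith [mul_le_mul_of_nonneg_left (show (4 : ℝ) ≤ (E.N : ℝ) ^ 2 by nlinarith)
    (zero_le_one.trans h1)]

theorem pow_mul_exp_neg_le {j : ℕ} {y : ℝ} (hy : ((j : ℝ) + 1) * Real.log E.N ≤ y) :
    (E.N : ℝ) ^ j * Real.exp (-y) ≤ (E.N : ℝ)⁻¹ := by
  have hN : (0 : ℝ) < E.N := by linarith [h.two_le_N]
  have e1 : (E.N : ℝ) ^ j = Real.exp (j * Real.log E.N) := by
    rw [Real.exp_nat_mul, Real.exp_log hN]
  have e2 : (E.N : ℝ)⁻¹ = Real.exp (-Real.log E.N) := by rw [Real.exp_neg, Real.exp_log hN]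
  rw [e1, e2, ← Real.exp_add]
  exact Real.exp_le_exp.2 (by linarith)

theorem b_cube_ge (hc : 0 ≤ c) (hcb : 0 ≤ cb) :
    cb ^ 3 * c * (E.s * Real.log E.N) / E.n ≤ E.b ^ 3 := by
  have hn := h.one_le_n
  have hs := h.one_le_s
  have h1 := h.one_le_log
  have hln : 0 ≤ Real.log E.n := le_trans (by positivity) h.log_ge
  have h2 := pow_le_pow_left₀ (by positivity) h.b_ge 3
  rw [mul_pow, ← Real.rpow_natCast ((_ : ℝ) ^ (1 / 3 : ℝ)), ← Real.rpow_mul (by positivity)] at h2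
  norm_num at h2
  refine le_trans ?_ h2
  calc cb ^ 3 * c * (E.s * Real.log E.N) / E.n = cb ^ 3 * (E.s * (c * Real.log E.N) / E.n) := by
        ring
    _ ≤ _ := by
        gcongr
        exact h.log_ge

end InRegime

end Experiment

section Events

variable {E : ℕ → Experiment} {ν c r : ℝ} {τ f₁ f₂ l₀ c₁ α lamMin lamMax θ C : ℝ}

theorem tendsto_const_div_N (hA : Asymptotics E ν c r) (D : ℝ) :
    Tendsto (fun k => D * ((E k).N : ℝ)⁻¹) atTop (𝓝 0) := by
  have h : Tendsto (fun k => ((E k).N : ℝ)) atTop atTop :=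
    tendsto_natCast_atTop_atTop.comp hA.N_top
  simpa using (tendsto_inv_atTop_zero.comp h).const_mul D

theorem tendsto_noise (hA : Asymptotics E ν c r) :
    Tendsto (fun k => (E k).noise) atTop (𝓝 0) := by
  have h1 : Tendsto (fun x : ℝ => Real.log x / x) atTop (𝓝 0) :=
    Real.isLittleO_log_id_atTop.tendsto_div_nhds_zero
  have h2 := h1.comp (tendsto_natCast_atTop_atTop.comp hA.N_top)
  have h3 := (Real.continuous_sqrt.tendsto 0).comp h2
  rw [Real.sqrt_zero] at h3
  exact h3

theorem tendsto_prob_of_le (hA : Asymptotics E ν c r) {Ev : ∀ k, Set (E k).Ω} {D : ℝ}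
    (h : ∀ᶠ k in atTop, (E k).μ.real (Ev k) ≤ D * ((E k).N : ℝ)⁻¹) :
    Tendsto (fun k => (E k).μ.real (Ev k)) atTop (𝓝 0) :=
  tendsto_of_tendsto_of_tendsto_of_le_of_le' tendsto_const_nhds (tendsto_const_div_N hA D)
    (Eventually.of_forall fun _ => measureReal_nonneg) h

theorem exists_scoreEvent (hA : Asymptotics E ν c r) (hV : ∀ k, (E k).Valid)
    (hpop : ∀ k, (E k).pop.Regular τ f₁ f₂ l₀ c₁ α lamMin lamMax)
    (hE : ∀ k, (E k).pop.EnvelopeBound θ C) (hθ : 0 ≤ θ) (hC : 0 < C) (hτ₀ : 0 < τ)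
    (hτ₁ : τ < 1) :
    ∃ A > 0, Tendsto (fun k => (E k).μ.real {ω | ¬ (E k).ScoreEvent τ A ω}) atTop (𝓝 0) := by
  obtain ⟨cb, hcb, Cb, hCb, w, hreg⟩ := hA.exists_inRegime
  set A := Real.sqrt (4 * C * (w + 1)) with hAdef
  have hA2 : A ^ 2 = 4 * C * (w + 1) := Real.sq_sqrt (by positivity)
  have hA0 : 0 < A := Real.sqrt_pos.2 (by positivity)
  refine ⟨A, hA0, tendsto_prob_of_le hA (D := 2) ?_⟩
  have hsmall := (tendsto_noise hA).eventually_le_const (show 0 < 2 * C / A by positivity)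
  filter_upwards [hreg, hsmall] with k hk hs
  have := (hV k).prob
  have hN := hk.two_le_N
  have hcard : (Fintype.card (Fin (E k).m × Fin (E k).n) : ℝ) = (E k).N := by
    simp [Experiment.N]
  have : Nonempty (Fin (E k).m × Fin (E k).n) := by
    rw [← Fintype.card_pos_iff]
    have : (0 : ℝ) < Fintype.card (Fin (E k).m × Fin (E k).n) := by rw [hcard]; linarith
    exact_mod_cast this
  have h1 := (hpop k).score_deviation (hE k) hθ hC hτ₀ hτ₁ (hV k).isSample
    (t := A * (E k).noise) (mul_nonneg hA0.le (E k).noise_nonneg) (by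
      rw [le_div_iff₀ hA0] at hs; linarith)
  refine h1.trans ?_
  have hexp : (Fintype.card (Fin (E k).m × Fin (E k).n) : ℝ) * (A * (E k).noise) ^ 2 / (4 * C)
      = (w + 1) * Real.log (E k).N := by
    rw [hcard, mul_pow, hA2, hk.noise_sq]
    field_simp
  rw [hexp]
  calc (((E k).p : ℝ) + 1) * (2 * Real.exp (-((w + 1) * Real.log (E k).N)))
      ≤ ((E k).N : ℝ) ^ w * (2 * Real.exp (-((w + 1) * Real.log (E k).N))) := by
        gcongr
        exact hk.p_le
    _ = 2 * (((E k).N : ℝ) ^ w * Real.exp (-((w + 1) * Real.log (E k).N))) := by ring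
    _ ≤ 2 * ((E k).N : ℝ)⁻¹ := by
        gcongr
        exact hk.pow_mul_exp_neg_le le_rfl

theorem exists_incrEvent (hA : Asymptotics E ν c r) (hV : ∀ k, (E k).Valid)
    (hpop : ∀ k, (E k).pop.Regular τ f₁ f₂ l₀ c₁ α lamMin lamMax)
    (hE : ∀ k, (E k).pop.EnvelopeBound θ C) (hθ : 0 ≤ θ) (hC : 0 < C) :
    ∃ A > 0, Tendsto (fun k => (E k).μ.real {ω | ¬ (E k).IncrEvent A ω}) atTop (𝓝 0) := by
  obtain ⟨cb, hcb, Cb, hCb, w, hreg⟩ := hA.exists_inRegime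
  have hl : 0 ≤ l₀ := (hpop 0).l₀_nonneg
  refine ⟨2 * l₀ * C + 1, by positivity, tendsto_prob_of_le hA (D := 4) ?_⟩
  have hsmall := hA.tendsto_s_mul_radius.eventually_le_const
    (show 0 < 1 / (8 * (1 + l₀) * C * (w + 7 + w + 1)) by positivity)
  have hsmall2 := (tendsto_const_div_N hA (5 * (1 + l₀) * C)).eventually_le_const one_pos
  have hlog := (tendsto_log_N hA.N_top).eventually_ge_atTop (1 / (4 * (1 + l₀) * C))
  filter_upwards [hreg, hsmall, hsmall2, hlog] with k hk hs hs2 hl2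
  have := (hV k).prob
  have hN := hk.two_le_N
  have hN0 : (0 : ℝ) < (E k).N := by linarith
  have hR := hk.radius_pos
  have hs1 := hk.one_le_s
  have hcard : (Fintype.card (Fin (E k).m × Fin (E k).n) : ℝ) = (E k).N := by
    simp [Experiment.N]
  have : Nonempty (Fin (E k).m × Fin (E k).n) := by
    rw [← Fintype.card_pos_iff]
    have : (0 : ℝ) < Fintype.card (Fin (E k).m × Fin (E k).n) := by rw [hcard]; linarith
    exact_mod_cast this
  have hM1 : 1 ≤ (E k).N ^ (w + 5) := Nat.one_le_pow _ _ (by have := hk.two_le; omega)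
  have h1 := (hpop k).incr_deviation (hE k) hθ hC (hV k).isSample (S := (E k).pop.S)
    hk.s_pos hM1 hR (hk.radius_le.trans hk.b_le_one) hk.s_div_mesh_le_radius
    (t := (E k).noise) (E k).noise_nonneg (by
      have h2 := hk.log_mul_noise_le_radius
      have h3 : (E k).noise ≤ 4 * (1 + l₀) * C * (Real.log (E k).N * (E k).noise) := by
        rw [div_le_iff₀ (by positivity)] at hl2
        have := mul_le_mul_of_nonneg_right hl2 (E k).noise_nonneg
        linarith
      calc (E k).noise ≤ 4 * (1 + l₀) * C * (Real.log (E k).N * (E k).noise) := h3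
        _ ≤ 4 * (1 + l₀) * C * (E k).radius := by gcongr
        _ = _ := by ring)
  refine (measureReal_mono ?_ (measure_ne_top _ _)).trans (h1.trans ?_)
  · intro ω hω hgood
    apply hω
    intro Δ hΔS hΔ j
    refine (hgood Δ hΔS hΔ j).trans ?_
    have h2 : 5 * (1 + l₀) * C * ((E k).pop.S.card / (((E k).N ^ (w + 5) : ℕ) : ℝ))
        ≤ (E k).noise := by
      calc _ ≤ 5 * (1 + l₀) * C * (((E k).N : ℝ)⁻¹ * (E k).noise) := by
            gcongr
            exact hk.s_div_mesh_le_noise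
        _ = 5 * (1 + l₀) * C * ((E k).N : ℝ)⁻¹ * (E k).noise := by ring
        _ ≤ 1 * (E k).noise := by
            gcongr
            exact (E k).noise_nonneg
        _ = _ := one_mul _
    have h3 : 0 ≤ l2norm Δ ^ 2 := sq_nonneg _
    linarith
  · have hexp : ((((w + 7) * (E k).s + w : ℕ) : ℝ) + 1) * Real.log (E k).N
        ≤ (Fintype.card (Fin (E k).m × Fin (E k).n) : ℝ) * (E k).noise ^ 2
          / (8 * (1 + l₀) * ((E k).radius * C)) := by
      rw [hcard, hk.noise_sq, mul_div_cancel₀ _ hN0.ne', le_div_iff₀ (by positivity)]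
      have h5 : 0 < Real.log (E k).N := by linarith [hk.one_le_log]
      rw [le_div_iff₀ (by positivity)] at hs
      have h6 : ((((w + 7) * (E k).s + w : ℕ) : ℝ) + 1) ≤ (E k).s * (w + 7 + w + 1) := by
        push_cast
        have hw : (0 : ℝ) ≤ w := Nat.cast_nonneg _
        nlinarith
      calc _ ≤ (E k).s * (w + 7 + w + 1) * Real.log (E k).N
            * (8 * (1 + l₀) * ((E k).radius * C)) := by gcongr
        _ = (E k).s * (E k).radius * (8 * (1 + l₀) * C * (w + 7 + w + 1))
            * Real.log (E k).N := by ring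
        _ ≤ 1 * Real.log (E k).N := by gcongr
        _ = _ := one_mul _
    calc _ ≤ ((E k).N : ℝ) ^ ((w + 7) * (E k).s) * ((E k).N : ℝ) ^ w *
          (4 * Real.exp (-((Fintype.card (Fin (E k).m × Fin (E k).n) : ℝ) * (E k).noise ^ 2
          / (8 * (1 + l₀) * ((E k).radius * C))))) := by
          gcongr
          · exact hk.card_grid_le_pow
          · exact hk.p_le
      _ = 4 * (((E k).N : ℝ) ^ ((w + 7) * (E k).s + w) *
          Real.exp (-((Fintype.card (Fin (E k).m × Fin (E k).n) : ℝ) * (E k).noise ^ 2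
          / (8 * (1 + l₀) * ((E k).radius * C))))) := by rw [pow_add]; ring
      _ ≤ 4 * ((E k).N : ℝ)⁻¹ := by
          gcongr
          exact hk.pow_mul_exp_neg_le hexp

theorem exists_hessEvent (hA : Asymptotics E ν c r) (hV : ∀ k, (E k).Valid)
    (hpop : ∀ k, (E k).pop.Regular τ f₁ f₂ l₀ c₁ α lamMin lamMax)
    (hE : ∀ k, (E k).pop.EnvelopeBound θ C) (hθ : 0 < θ) (hC : 0 < C) {K : ℝ → ℝ}
    (hK : IsSmoothingKernel K) :
    ∃ A > 0, Tendsto (fun k => (E k).μ.real {ω | ¬ (E k).HessEvent K A ω}) atTop (𝓝 0) := by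
  obtain ⟨cb, hcb, Cb, hCb, w, hreg⟩ := hA.exists_inRegime
  obtain ⟨B, hB⟩ := hK.exists_kernelBound
  have hB0 := hB.pos
  have hc := hA.c_pos
  have hl : 0 ≤ l₀ := (hpop 0).l₀_nonneg
  have hκ := hK.kernelMoment_nonneg
  -- `A` makes the Bernstein exponent beat the entropy of the two grids
  set J : ℝ := 2 * (w + 7) + w + 1 with hJ
  have hJ0 : 0 < J := by positivity
  set A := Real.sqrt (J * (4 * ((1 + l₀) * (B * C))) / (cb ^ 3 * c)) with hAdef
  have hA2 : A ^ 2 = J * (4 * ((1 + l₀) * (B * C))) / (cb ^ 3 * c) := Real.sq_sqrt (by positivity)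
  have hA0 : 0 < A := Real.sqrt_pos.2 (by positivity)
  refine ⟨2 * (A + l₀ * C * (kernelMoment K + 4) + (1 + l₀) * C + 1), by positivity,
    tendsto_prob_of_le hA (D := 4) ?_⟩
  have hsmall := hA.tendsto_sqrt_s_mul_b.eventually_le_const
    (show 0 < 2 * θ * ((1 + l₀) * C) / A by positivity)
  have hsmall2 := (tendsto_const_div_N hA (B * C)).eventually_le_const
    (show 0 < cb ^ 3 * c by positivity)
  filter_upwards [hreg, hsmall, hsmall2] with k hk hs hs2
  have := (hV k).prob
  have hN := hk.two_le_N
  have hN0 : (0 : ℝ) < (E k).N := by linarith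
  have hR := hk.radius_pos
  have hs1 := hk.one_le_s
  have hn1 := hk.one_le_n
  have hb := hk.b_pos
  have hlog := hk.one_le_log
  have hnN : ((E k).n : ℝ) ≤ (E k).N := by exact_mod_cast hk.n_le
  have hb3 := hk.b_cube_ge hc.le hcb.le
  have : Nonempty (Fin (E k).n) := ⟨⟨0, hk.s_pos.trans hk.s_le⟩⟩
  have hM1 : 1 ≤ (E k).N ^ (w + 5) := Nat.one_le_pow _ _ (by have := hk.two_le; omega)
  set T : ℝ := C * ((E k).N : ℝ) ^ (w + 3) with hT
  have hT0 : 0 < T := by positivity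
  have h1 := (hpop k).hess_deviation (hE k) hθ.le hC hK hB (hV k).isSample_central
    (S := (E k).pop.S) hk.s_pos hM1 hb hk.b_le_one hR (hk.radius_le.trans hk.b_le_one)
    hk.s_div_mesh_le_radius hk.s_div_mesh_le_half (t := A * (E k).b) (by positivity) (by
      have h2 : (E k).b ≤ Real.sqrt (E k).s * (E k).b :=
        le_mul_of_one_le_left hb.le (Real.one_le_sqrt.2 hs1)
      have h3 := h2.trans hs
      rw [le_div_iff₀ hA0] at h3
      linarith) hT0
  refine (measureReal_mono ?_ (measure_ne_top _ _)).trans (h1.trans ?_)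
  · intro ω hω hgood
    apply hω
    intro Δ hΔS hΔ δ hδS j
    refine (hgood Δ hΔS hΔ δ hδS j).trans ?_
    refine mul_le_mul_of_nonneg_right ?_ (l2norm_nonneg δ)
    have h2 : (1 + l₀) * C * ((E k).pop.S.card / (((E k).N ^ (w + 5) : ℕ) : ℝ))
        ≤ (1 + l₀) * C * (E k).b := by
      gcongr
      exact hk.s_div_mesh_le_radius.trans hk.radius_le
    have h3 : B / ((((E k).N ^ (w + 5) : ℕ) : ℝ) * (E k).b ^ 2) * T ≤ (E k).b := by
      rw [div_mul_eq_mul_div, div_le_iff₀ (by positivity), hT]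
      push_cast
      have e1 : (E k).b * (((E k).N : ℝ) ^ (w + 5) * (E k).b ^ 2)
          = ((E k).N : ℝ) ^ (w + 5) * (E k).b ^ 3 := by ring
      have e2 : ((E k).N : ℝ) ^ (w + 5) = ((E k).N : ℝ) ^ (w + 3) * (E k).N * (E k).N := by ring
      have h4 : B * C ≤ (E k).N * ((E k).N * (E k).b ^ 3) := by
        rw [← div_eq_mul_inv, div_le_iff₀ hN0] at hs2
        have h5 : cb ^ 3 * c ≤ (E k).N * (E k).b ^ 3 := by
          rw [div_le_iff₀ (by linarith)] at hb3
          have h6 : cb ^ 3 * c * 1 ≤ cb ^ 3 * c * ((E k).s * Real.log (E k).N) := by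
            gcongr
            nlinarith
          have h7 : (E k).b ^ 3 * (E k).n ≤ (E k).b ^ 3 * (E k).N := by gcongr
          linarith
        have := mul_le_mul_of_nonneg_right h5 hN0.le
        linarith
      rw [e1, e2]
      calc B * (C * ((E k).N : ℝ) ^ (w + 3)) = ((E k).N : ℝ) ^ (w + 3) * (B * C) := by ring
        _ ≤ ((E k).N : ℝ) ^ (w + 3) * ((E k).N * ((E k).N * (E k).b ^ 3)) := by gcongr
        _ = _ := by ring
    have h8 : l₀ * C * ((E k).b * kernelMoment K + 4 * (E k).radius)
        ≤ l₀ * C * (kernelMoment K + 4) * (E k).b := by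
      have h9 : (E k).b * kernelMoment K + 4 * (E k).radius ≤ (kernelMoment K + 4) * (E k).b := by
        linarith [hk.radius_le]
      calc _ ≤ l₀ * C * ((kernelMoment K + 4) * (E k).b) := by gcongr
        _ = _ := by ring
    linarith
  · have hexp : ((((w + 7) * (E k).s + (w + 7) * (E k).s + w : ℕ) : ℝ) + 1) * Real.log (E k).N
        ≤ (Fintype.card (Fin (E k).n) : ℝ) * (A * (E k).b) ^ 2 * (E k).b
          / (4 * ((1 + l₀) * (B * C))) := by
      have h6 : ((((w + 7) * (E k).s + (w + 7) * (E k).s + w : ℕ) : ℝ) + 1) ≤ J * (E k).s := by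
        push_cast
        have hw : (0 : ℝ) ≤ w := Nat.cast_nonneg _
        rw [hJ]
        nlinarith
      rw [le_div_iff₀ (by positivity), Fintype.card_fin]
      have e1 : ((E k).n : ℝ) * (A * (E k).b) ^ 2 * (E k).b
          = A ^ 2 * ((E k).b ^ 3 * (E k).n) := by ring
      rw [e1]
      rw [div_le_iff₀ (by linarith)] at hb3
      calc _ ≤ J * (E k).s * Real.log (E k).N * (4 * ((1 + l₀) * (B * C))) := by gcongr
        _ = A ^ 2 * (cb ^ 3 * c * ((E k).s * Real.log (E k).N)) := by
            rw [hA2]; field_simp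
        _ ≤ _ := by gcongr
    set y := (Fintype.card (Fin (E k).n) : ℝ) * (A * (E k).b) ^ 2 * (E k).b
          / (4 * ((1 + l₀) * (B * C)))
    have p1 : (2 * (((E k).N ^ (w + 5) : ℕ) : ℝ) + 1) ^ (E k).pop.S.card *
        (2 * (((E k).N ^ (w + 5) : ℕ) : ℝ) + 1) ^ (E k).pop.S.card * ((E k).p + 1) *
        (2 * Real.exp (-y)) ≤ 2 * ((E k).N : ℝ)⁻¹ := by
      calc _ ≤ ((E k).N : ℝ) ^ ((w + 7) * (E k).s) * ((E k).N : ℝ) ^ ((w + 7) * (E k).s)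
            * ((E k).N : ℝ) ^ w * (2 * Real.exp (-y)) := by
            gcongr
            · exact hk.card_grid_le_pow
            · exact hk.card_grid_le_pow
            · exact hk.p_le
        _ = 2 * (((E k).N : ℝ) ^ ((w + 7) * (E k).s + (w + 7) * (E k).s + w)
            * Real.exp (-y)) := by rw [pow_add, pow_add]; ring
        _ ≤ 2 * ((E k).N : ℝ)⁻¹ := by
            gcongr
            exact hk.pow_mul_exp_neg_le hexp
    have p2 : (1 + ((E k).pop.S.card : ℝ)) * (((E k).p + 1) * ((E k).pop.S.card * C)) / T
        ≤ 2 * ((E k).N : ℝ)⁻¹ := by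
      rw [div_le_iff₀ hT0]
      have e1 : 2 * ((E k).N : ℝ)⁻¹ * T
          = (2 * (E k).N) * (((E k).N : ℝ) ^ w * ((E k).N * C)) := by
        rw [hT, pow_add]; field_simp
      rw [e1]
      have h7 : ((E k).pop.S.card : ℝ) ≤ (E k).N := hk.s_le_N
      gcongr
      · linarith
      · exact hk.p_le
    linarith

end Events

/-! ### The number of rounds -/

namespace Experiment

variable {E : Experiment} {c cb Cb : ℝ} {w : ℕ}

/-- The two logarithms in the denominators of `EnoughRounds` are at least of order `log n`. -/
structure LogGap (E : Experiment) : Prop where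
  first : Real.log E.n / 6
    ≤ Real.log ((E.n : ℝ) ^ 2 / ((E.s : ℝ) ^ 5 * Real.log E.n ^ 2))
  second : Real.log E.n / 12 ≤ Real.log ((E.n : ℝ) / ((E.s : ℝ) ^ 2 * Real.log E.N))

theorem InRegime.log_n_pos (h : E.InRegime c cb Cb w) (hc : 0 < c) : 0 < Real.log E.n :=
  lt_of_lt_of_le (mul_pos hc (zero_lt_one.trans_le h.one_le_log)) h.log_ge

theorem one_le_m (E : Experiment) : (1 : ℝ) ≤ E.m := by
  exact_mod_cast NeZero.one_le

theorem N_eq (E : Experiment) : (E.N : ℝ) = E.m * E.n := by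
  simp [N]

/-- `(s^{(5t+3)/6} (log n / n)^{(2t+3)/6})⁶` and `√(s log N / N)⁶` are compared as monomials. -/
theorem InRegime.excessRate_le (h : E.InRegime c cb Cb w) (hc : 0 < c) (hgap : E.LogGap) {t : ℕ}
    (ht : E.EnoughRounds t) : E.excessRate t ≤ E.oracleRate := by
  have hln := h.log_n_pos hc
  have hl : 0 < Real.log E.N := by linarith [h.one_le_log]
  have hs : (0 : ℝ) < E.s := by linarith [h.one_le_s]
  have hn : (0 : ℝ) < E.n := by linarith [h.one_le_n]
  have hm : (0 : ℝ) < E.m := by linarith [E.one_le_m]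
  obtain ⟨h1, h2⟩ := ht
  set a := (E.n : ℝ) ^ 2 / ((E.s : ℝ) ^ 5 * Real.log E.n ^ 2) with ha
  set d := (E.n : ℝ) / ((E.s : ℝ) ^ 2 * Real.log E.N) with hd
  have ha0 : 0 < a := by positivity
  have hd0 : 0 < d := by positivity
  have hla : 0 < Real.log a := by linarith [hgap.first]
  have hld : 0 < Real.log d := by linarith [hgap.second]
  rw [div_le_iff₀ hla] at h1
  rw [div_le_iff₀ hld] at h2
  have k1 : (E.m * Real.log E.n / Real.log E.N) ^ 3 ≤ a ^ t := by
    rw [← Real.log_le_log_iff (by positivity) (by positivity), Real.log_pow, Real.log_pow]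
    exact_mod_cast h1
  have k2 : (E.m : ℝ) ≤ d ^ t := by
    rw [← Real.log_le_log_iff hm (by positivity), Real.log_pow]
    exact h2
  have hN (y : ℝ) : y / (E.N : ℝ) = y / (E.m * E.n) := by rw [E.N_eq]
  have horacle : 0 ≤ E.oracleRate := Real.sqrt_nonneg _
  have ho2 : E.oracleRate ^ 2 = E.s * Real.log E.N / E.N := Real.sq_sqrt (by positivity)
  unfold excessRate kappa
  apply max_le
  · apply le_of_pow_le_pow_left₀ (n := 6) (by norm_num) horacle
    have e1 : ((E.s : ℝ) ^ ((5 * (t : ℝ) + 3) / 6)) ^ 6 = (E.s : ℝ) ^ (5 * t + 3) := by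
      rw [← Real.rpow_natCast, ← Real.rpow_mul hs.le, ← Real.rpow_natCast]
      congr 1; push_cast; ring
    have e2 : ((Real.log E.n / E.n) ^ ((2 * (t : ℝ) + 3) / 6)) ^ 6
        = (Real.log E.n / E.n) ^ (2 * t + 3) := by
      rw [← Real.rpow_natCast, ← Real.rpow_mul (by positivity), ← Real.rpow_natCast]
      congr 1; push_cast; ring
    have e3 : E.oracleRate ^ 6 = (E.s * Real.log E.N / E.N) ^ 3 := by rw [← ho2]; ring
    have e4 : (E.s : ℝ) ^ (5 * t + 3) * (Real.log E.n / E.n) ^ (2 * t + 3) * a ^ t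
        = (E.s * Real.log E.N / E.N) ^ 3 * (E.m * Real.log E.n / Real.log E.N) ^ 3 := by
      rw [ha, hN]
      simp only [div_pow, mul_pow, pow_add, pow_mul]
      field_simp
    rw [mul_pow, e1, e2, e3]
    have ha' : 0 < a ^ t := by positivity
    refine le_of_mul_le_mul_right ?_ ha'
    rw [e4]
    gcongr
  · apply le_of_pow_le_pow_left₀ (n := 2) (by norm_num) horacle
    have e1 : ((E.s : ℝ) ^ ((2 * (t : ℝ) + 1) / 2)) ^ 2 = (E.s : ℝ) ^ (2 * t + 1) := by
      rw [← Real.rpow_natCast, ← Real.rpow_mul hs.le, ← Real.rpow_natCast]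
      congr 1; push_cast; ring
    have e2 : ((Real.log E.N / E.n) ^ (((t : ℝ) + 1) / 2)) ^ 2
        = (Real.log E.N / E.n) ^ (t + 1) := by
      rw [← Real.rpow_natCast, ← Real.rpow_mul (by positivity), ← Real.rpow_natCast]
      congr 1; push_cast; ring
    have e4 : (E.s : ℝ) ^ (2 * t + 1) * (Real.log E.N / E.n) ^ (t + 1) * d ^ t
        = E.s * Real.log E.N / E.N * E.m := by
      rw [hd, hN]
      simp only [div_pow, mul_pow, pow_add, pow_mul]
      field_simp
    rw [mul_pow, e1, e2, ho2]
    have hd' : 0 < d ^ t := by positivity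
    refine le_of_mul_le_mul_right ?_ hd'
    rw [e4]
    gcongr

theorem InRegime.enoughRounds (h : E.InRegime c cb Cb w) (hc : 0 < c) (hgap : E.LogGap) {t : ℕ}
    (ht : 18 / c ≤ t) : E.EnoughRounds t := by
  have hln := h.log_n_pos hc
  have hl : 0 < Real.log E.N := by linarith [h.one_le_log]
  have hm : (1 : ℝ) ≤ E.m := E.one_le_m
  have hn : (1 : ℝ) ≤ E.n := h.one_le_n
  have hlm : Real.log E.m ≤ Real.log E.N := by
    apply Real.log_le_log (by linarith)
    rw [E.N_eq]; nlinarith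
  rw [div_le_iff₀ hc] at ht
  have ht0 : (0 : ℝ) ≤ t := Nat.cast_nonneg t
  -- `log N ≤ log n / c`
  have key : 18 * Real.log E.N ≤ t * Real.log E.n := by
    have h1 := mul_le_mul_of_nonneg_right ht hl.le
    have h2 := mul_le_mul_of_nonneg_left h.log_ge ht0
    linarith
  constructor
  · rw [div_le_iff₀ (by linarith [hgap.first])]
    have h1 : Real.log (E.m * Real.log E.n / Real.log E.N) ≤ Real.log E.m := by
      apply Real.log_le_log (by positivity)
      rw [div_le_iff₀ hl]
      have := h.log_le
      gcongr
    have h2 := mul_le_mul_of_nonneg_left hgap.first ht0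
    linarith
  · rw [div_le_iff₀ (by linarith [hgap.second])]
    have h2 := mul_le_mul_of_nonneg_left hgap.second ht0
    linarith

end Experiment

theorem Asymptotics.eventually_logGap {E : ℕ → Experiment} {ν c r : ℝ} (hA : Asymptotics E ν c r) :
    ∀ᶠ k in atTop, (E k).LogGap := by
  have hr := hA.r_lt
  have hc := hA.c_pos
  obtain ⟨cb, -, Cb, -, w, hreg⟩ := hA.exists_inRegime
  have t2 := hA.tendsto_div (a := 5 / 2) (b := 1) (q := 11 / 12) (by norm_num) (by norm_num)
    (by linarith)
  have t3 := hA.tendsto_div (a := 2) (b := 1) (q := 11 / 12) (by norm_num) (by norm_num)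
    (by linarith)
  filter_upwards [hreg, t2.eventually_le_const one_pos, t3.eventually_le_const one_pos]
    with k h k2 k3
  have hln := h.log_n_pos hc
  have hl : 0 < Real.log (E k).N := by linarith [h.one_le_log]
  have hs : (0 : ℝ) < (E k).s := by linarith [h.one_le_s]
  have hn : (0 : ℝ) < (E k).n := by linarith [h.one_le_n]
  have hq : (0 : ℝ) < ((E k).n : ℝ) ^ (11 / 12 : ℝ) := by positivity
  simp only [Real.rpow_one] at k2 k3
  rw [div_le_one hq] at k2 k3
  constructor
  · have h5 : (E k).s ^ (5 / 2 : ℝ) * Real.log (E k).n ≤ ((E k).n : ℝ) ^ (11 / 12 : ℝ) :=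
      le_trans (mul_le_mul_of_nonneg_left h.log_le (by positivity)) k2
    have h6 := pow_le_pow_left₀ (by positivity) h5 2
    have e1 : (((E k).s : ℝ) ^ (5 / 2 : ℝ) * Real.log (E k).n) ^ 2
        = ((E k).s : ℝ) ^ 5 * Real.log (E k).n ^ 2 := by
      rw [mul_pow, ← Real.rpow_natCast ((_ : ℝ) ^ (5 / 2 : ℝ)), ← Real.rpow_mul hs.le]
      norm_num
    have e2 : (((E k).n : ℝ) ^ (11 / 12 : ℝ)) ^ 2 = ((E k).n : ℝ) ^ (11 / 6 : ℝ) := by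
      rw [← Real.rpow_natCast, ← Real.rpow_mul hn.le]
      norm_num
    rw [e1, e2] at h6
    have h7 : ((E k).n : ℝ) ^ (1 / 6 : ℝ)
        ≤ ((E k).n : ℝ) ^ 2 / (((E k).s : ℝ) ^ 5 * Real.log (E k).n ^ 2) := by
      rw [le_div_iff₀ (by positivity)]
      calc _ ≤ ((E k).n : ℝ) ^ (1 / 6 : ℝ) * ((E k).n : ℝ) ^ (11 / 6 : ℝ) := by gcongr
        _ = ((E k).n : ℝ) ^ 2 := by
          rw [← Real.rpow_add hn, ← Real.rpow_natCast]; norm_num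
    have h8 := Real.log_le_log (by positivity) h7
    rw [Real.log_rpow hn] at h8
    linarith
  · have h7 : ((E k).n : ℝ) ^ (1 / 12 : ℝ)
        ≤ ((E k).n : ℝ) / (((E k).s : ℝ) ^ 2 * Real.log (E k).N) := by
      rw [le_div_iff₀ (by positivity)]
      have k3' : ((E k).s : ℝ) ^ 2 * Real.log (E k).N ≤ ((E k).n : ℝ) ^ (11 / 12 : ℝ) := by
        simpa using k3
      calc _ ≤ ((E k).n : ℝ) ^ (1 / 12 : ℝ) * ((E k).n : ℝ) ^ (11 / 12 : ℝ) := by gcongr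
        _ = (E k).n := by
          rw [← Real.rpow_add hn]; norm_num
    have h8 := Real.log_le_log (by positivity) h7
    rw [Real.log_rpow hn] at h8
    linarith

/-! ### One round, and the recursion of the rates -/

namespace Experiment

variable {E : Experiment} {K : ℝ → ℝ} {τ f₁ f₂ l₀ c₁ α lamMin lamMax c cb Cb : ℝ} {w : ℕ}

/-- The residual of the iterate `β` is `ε - Xᵀ(β - β⋆)`. -/
theorem residual_eq (E : Experiment) (ki : Fin E.m × Fin E.n) (β : Vec E.p) (ω : E.Ω) :
    E.Y ki.1 ki.2 ω - E.X ki.1 ki.2 ω ⬝ᵥ β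
      = (E.obs ki ω).2 - (E.obs ki ω).1 ⬝ᵥ (β - E.pop.beta) := by
  simp only [obs, dotProduct_sub]; ring

theorem score_eq_emp (E : Experiment) (τ : ℝ) (β : Vec E.p) (ω : E.Ω) (j : Fin (E.p + 1)) :
    score τ (fun k i => E.X k i ω) (fun k i => E.Y k i ω) β j
      = emp E.obs (scoreStat τ j) ω + emp E.obs (incrStat (β - E.pop.beta) j) ω := by
  rw [score_apply, emp, emp, ← add_div, ← Finset.sum_add_distrib]
  congr 1
  · refine Finset.sum_congr rfl fun ki _ => ?_
    rw [E.residual_eq, scoreStat, incrStat]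
    simp only [obs]; ring
  · simp

theorem centralHessian_eq_emp (hK : IsSmoothingKernel K) (hb : 0 < E.b) (β v : Vec E.p) (ω : E.Ω)
    (j : Fin (E.p + 1)) :
    (centralHessian K E.b (fun k i => E.X k i ω) (fun k i => E.Y k i ω) β *ᵥ v) j
      = emp (fun i : Fin E.n => E.obs (0, i)) (hessStat K E.b (β - E.pop.beta) v j) ω := by
  rw [centralHessian_mulVec_apply hK.nonneg hb, emp]
  congr 1
  · refine Finset.sum_congr rfl fun i _ => ?_
    rw [hessStat, ← E.residual_eq (0, i)]
    simp only [obs]; ring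
  · simp

/-- One round of the algorithm: an error `a` of the current iterate enters the gradient at `β⋆`
only through `b * a`. -/
theorem InRegime.one_round (h : E.InRegime c cb Cb w)
    (hP : E.pop.Regular τ f₁ f₂ l₀ c₁ α lamMin lamMax) (hK : IsSmoothingKernel K)
    (hα₀ : 0 < α) (hα₁ : α < 1) (hlamMin : 0 < lamMin) {A₁ A₂ A₃ : ℝ} (hA₂ : 0 ≤ A₂)
    (hA₃ : 0 ≤ A₃) {ω : E.Ω} (hscore : E.ScoreEvent τ A₁ ω) (hincr : E.IncrEvent A₂ ω)
    (hhess : E.HessEvent K A₃ ω) (hb : Real.sqrt E.s * (A₃ * E.b) ≤ lamMin * α / 24)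
    {β : Vec E.p} (hβ : SuppIn E.pop.S β) {a : ℝ} (ha : l2norm (β - E.pop.beta) ≤ a)
    (haR : a ≤ E.radius) {lam : ℝ} (hlam : 0 < lam)
    (hgrad : (A₁ + 3) * E.noise + (A₂ + A₃) * (E.b * a) ≤ α / 8 * lam) :
    (∃ γ, IsMinOn (objective τ K E.h E.b lam (fun k i => E.X k i ω) (fun k i => E.Y k i ω) β)
      Set.univ γ) ∧
    ∀ γ, IsMinOn (objective τ K E.h E.b lam (fun k i => E.X k i ω) (fun k i => E.Y k i ω) β)
      Set.univ γ →
        SuppIn E.pop.S γ ∧ l2norm (γ - E.pop.beta) ≤ 3 / lamMin * (Real.sqrt E.s * lam) := by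
  have hb0 := h.b_pos
  have hΔ : SuppIn E.pop.S (β - E.pop.beta) := hβ.sub Population.suppIn_beta
  have hΔR := ha.trans haR
  have hD (v : Vec E.p) (hv : SuppIn E.pop.S v) (j : Fin (E.p + 1)) :
      |(centralHessian K E.b (fun k i => E.X k i ω) (fun k i => E.Y k i ω) β *ᵥ v) j
        - (E.pop.info *ᵥ v) j| ≤ A₃ * E.b * l2norm v := by
    rw [centralHessian_eq_emp hK hb0]
    exact hhess _ hΔ hΔR v hv j
  rw [objective_eq]
  refine primal_dual_witness (centralHessian_isSymm _ _ _ _ _) (centralHessian_nonneg _ _ _ _ _)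
    hlamMin hα₀ hα₁ (mul_nonneg hA₃ hb0.le) hlam (fun v => (hP.eigen v).1)
    (fun i hi => hP.irrepresentable_row hlamMin i hi)
    (fun v hv j => ?_) hb Population.suppIn_beta (fun j => ?_)
  · rw [Matrix.sub_mulVec]
    exact hD v hv j
  · have h1 := hD _ hΔ j
    have h2 := hincr _ hΔ hΔR j
    have h3 := hscore j
    have h0 := l2norm_nonneg (β - E.pop.beta)
    -- the quadratic remainder is dominated, as the radius is at most the bandwidth
    have h4 : A₂ * l2norm (β - E.pop.beta) ^ 2 ≤ A₂ * (E.b * a) := by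
      rw [sq]
      have := hΔR.trans h.radius_le
      gcongr
    have h5 : A₃ * E.b * l2norm (β - E.pop.beta) ≤ A₃ * (E.b * a) := by
      rw [mul_assoc]; gcongr
    have e : E.pop.beta - β = -(β - E.pop.beta) := by abel
    rw [Pi.add_apply, e, Matrix.mulVec_neg, Pi.neg_apply, score_eq_emp]
    rw [abs_le] at h1 h2 h3 ⊢
    constructor <;> linarith [h1.1, h1.2, h2.1, h2.2, h3.1, h3.2]

/-- The part `κ(5g/6, g, g)` of the penalty of round `g`. -/
noncomputable def iterKappa (E : Experiment) (g : ℕ) : ℝ := E.kappa (5 * (g : ℝ) / 6) g g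

theorem iterKappa_nonneg (h : E.InRegime c cb Cb w) (g : ℕ) : 0 ≤ E.iterKappa g := by
  refine le_max_of_le_right ?_
  have := h.one_le_log
  positivity

theorem sqrt_s_mul_noise (E : Experiment) : Real.sqrt E.s * E.noise = E.oracleRate := by
  rw [noise, oracleRate, ← Real.sqrt_mul (Nat.cast_nonneg _), mul_div_assoc]

theorem sqrt_s_mul_sqrt (E : Experiment) :
    Real.sqrt E.s * Real.sqrt (Real.log E.N / E.n) = E.initialRate := by
  rw [initialRate, ← Real.sqrt_mul (Nat.cast_nonneg _), mul_div_assoc]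

namespace InRegime

theorem sqrt_s_mul_iterKappa (h : E.InRegime c cb Cb w) (g : ℕ) :
    Real.sqrt E.s * E.iterKappa g = E.excessRate g := by
  have hs : (0 : ℝ) < E.s := by linarith [h.one_le_s]
  rw [iterKappa, excessRate, kappa, kappa, mul_max_of_nonneg _ _ (Real.sqrt_nonneg _),
    Real.sqrt_eq_rpow, ← mul_assoc, ← mul_assoc, ← Real.rpow_add hs, ← Real.rpow_add hs]
  congr 3 <;> ring

theorem le_iterKappa_zero (E : Experiment) :
    Real.sqrt (Real.log E.N / E.n) ≤ E.iterKappa 0 := by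
  refine le_trans (le_of_eq ?_) (le_max_right _ _)
  rw [Real.sqrt_eq_rpow]; norm_num

theorem noise_le_sqrt (h : E.InRegime c cb Cb w) : E.noise ≤ Real.sqrt (Real.log E.N / E.n) := by
  have h1 := h.one_le_log
  have hn := h.one_le_n
  unfold noise
  gcongr
  exact_mod_cast h.n_le

theorem iterKappa_le_sqrt (h : E.InRegime c cb Cb w) (hc : 0 < c) (g : ℕ) :
    E.iterKappa g ≤ Real.sqrt (Real.log E.N / E.n) := by
  have hs : (0 : ℝ) < E.s := by linarith [h.one_le_s]
  have hn : (0 : ℝ) < E.n := by linarith [h.one_le_n]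
  have hln := h.log_n_pos hc
  have hl : 0 < Real.log E.N := by linarith [h.one_le_log]
  have hxn : 0 < Real.log E.n / E.n := by positivity
  have hxN : 0 < Real.log E.N / E.n := by positivity
  rw [Real.sqrt_eq_rpow]
  refine max_le ?_ ?_
  · have e : (E.s : ℝ) ^ (5 * (g : ℝ) / 6) * (Real.log E.n / E.n) ^ ((2 * (g : ℝ) + 3) / 6)
        = ((E.s : ℝ) ^ (5 / 2 : ℝ) * Real.log E.n / E.n) ^ ((g : ℝ) / 3)
          * (Real.log E.n / E.n) ^ (1 / 2 : ℝ) := by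
      rw [mul_div_assoc (_ ^ (5 / 2 : ℝ)), Real.mul_rpow (by positivity) hxn.le, ← Real.rpow_mul hs.le, mul_assoc,
        ← Real.rpow_add hxn]
      congr 2 <;> ring
    rw [e]
    calc _ ≤ 1 * (Real.log E.N / E.n) ^ (1 / 2 : ℝ) := by
          gcongr
          · exact Real.rpow_le_one (by positivity) h.first_small (by positivity)
          · exact h.n_le
      _ = _ := one_mul _
  · have e : (E.s : ℝ) ^ (g : ℝ) * (Real.log E.N / E.n) ^ (((g : ℝ) + 1) / 2)
        = ((E.s : ℝ) ^ 2 * Real.log E.N / E.n) ^ ((g : ℝ) / 2)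
          * (Real.log E.N / E.n) ^ (1 / 2 : ℝ) := by
      rw [mul_div_assoc, Real.mul_rpow (by positivity) hxN.le, ← Real.rpow_natCast (E.s : ℝ) 2,
        ← Real.rpow_mul hs.le, mul_assoc, ← Real.rpow_add hxN]
      congr 2 <;> push_cast <;> ring
    rw [e]
    exact mul_le_of_le_one_left (by positivity)
      (Real.rpow_le_one (by positivity) h.second_small (by positivity))

theorem one_le_inv (h : E.InRegime c cb Cb w) (hc : 0 < c) : 1 ≤ c⁻¹ := by
  rw [one_le_inv₀ hc]
  have h1 := h.log_ge.trans h.log_le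
  have h2 := h.one_le_log
  by_contra hcon
  push Not at hcon
  nlinarith

/-- The rate improves by the factor `√s b` in each round. -/
theorem sqrt_s_mul_b_mul_iterKappa_le (h : E.InRegime c cb Cb w) (hc : 0 < c) (hCb : 0 ≤ Cb)
    (g : ℕ) : Real.sqrt E.s * E.b * E.iterKappa g
      ≤ Cb * (c⁻¹) ^ (((g : ℝ) + 1) / 2) * E.iterKappa (g + 1) := by
  have hs : (0 : ℝ) < E.s := by linarith [h.one_le_s]
  have hn : (0 : ℝ) < E.n := by linarith [h.one_le_n]
  have hln := h.log_n_pos hc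
  have hl : 0 < Real.log E.N := by linarith [h.one_le_log]
  have hc1 := h.one_le_inv hc
  set x := Real.log E.n / E.n with hx
  have hx0 : 0 < x := by positivity
  have hsx : E.s * x ≤ 1 := by
    refine le_trans ?_ h.second_small
    rw [hx, ← mul_div_assoc]
    gcongr
    · nlinarith [h.one_le_s]
    · exact h.n_le
  set a := (E.s : ℝ) ^ (5 * (g : ℝ) / 6) * x ^ ((2 * (g : ℝ) + 3) / 6) with ha
  have hq : 1 ≤ (c⁻¹) ^ (((g : ℝ) + 1) / 2) := Real.one_le_rpow hc1 (by positivity)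
  have ha0 : 0 < a := by positivity
  -- the second part of `κ` is at most a constant times the first
  have hκ : E.iterKappa g ≤ (c⁻¹) ^ (((g : ℝ) + 1) / 2) * a := by
    refine max_le (le_mul_of_one_le_left ha0.le hq) ?_
    have h1 : Real.log E.N / E.n ≤ c⁻¹ * x := by
      rw [hx, ← mul_div_assoc]
      gcongr
      rw [inv_mul_eq_div, le_div_iff₀ hc]
      linarith [h.log_ge]
    calc (E.s : ℝ) ^ (g : ℝ) * (Real.log E.N / E.n) ^ (((g : ℝ) + 1) / 2)
        ≤ (E.s : ℝ) ^ (g : ℝ) * (c⁻¹ * x) ^ (((g : ℝ) + 1) / 2) := by gcongr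
      _ = (c⁻¹) ^ (((g : ℝ) + 1) / 2) * ((E.s * x) ^ ((g : ℝ) / 6) * a) := by
          rw [Real.mul_rpow (by positivity) hx0.le, Real.mul_rpow hs.le hx0.le, ha]
          have e1 : (E.s : ℝ) ^ (g : ℝ)
              = (E.s : ℝ) ^ ((g : ℝ) / 6) * (E.s : ℝ) ^ (5 * (g : ℝ) / 6) := by
            rw [← Real.rpow_add hs]; congr 1; ring
          have e2 : x ^ (((g : ℝ) + 1) / 2)
              = x ^ ((g : ℝ) / 6) * x ^ ((2 * (g : ℝ) + 3) / 6) := by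
            rw [← Real.rpow_add hx0]; congr 1; ring
          rw [e1, e2]; ring
      _ ≤ (c⁻¹) ^ (((g : ℝ) + 1) / 2) * (1 * a) := by
          gcongr
          exact Real.rpow_le_one (by positivity) hsx (by positivity)
      _ = _ := by rw [one_mul]
  have hstep : Real.sqrt E.s * (E.s * x) ^ (1 / 3 : ℝ) * a ≤ E.iterKappa (g + 1) := by
    refine le_trans (le_of_eq ?_) (le_max_left _ _)
    rw [ha, Real.mul_rpow hs.le hx0.le, Real.sqrt_eq_rpow, ← hx]
    have e1 : (E.s : ℝ) ^ (5 * ((g + 1 : ℕ) : ℝ) / 6)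
        = (E.s : ℝ) ^ (1 / 2 : ℝ) * (E.s : ℝ) ^ (1 / 3 : ℝ) * (E.s : ℝ) ^ (5 * (g : ℝ) / 6) := by
      rw [← Real.rpow_add hs, ← Real.rpow_add hs]; congr 1; push_cast; ring
    have e2 : x ^ ((2 * ((g + 1 : ℕ) : ℝ) + 3) / 6)
        = x ^ (1 / 3 : ℝ) * x ^ ((2 * (g : ℝ) + 3) / 6) := by
      rw [← Real.rpow_add hx0]; congr 1; push_cast; ring
    rw [e1, e2]; ring
  have hb : E.b ≤ Cb * (E.s * x) ^ (1 / 3 : ℝ) := by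
    rw [hx, ← mul_div_assoc]; exact h.b_le
  have hb0 := h.b_pos
  have hκ0 := iterKappa_nonneg h g
  calc Real.sqrt E.s * E.b * E.iterKappa g
      ≤ Real.sqrt E.s * (Cb * (E.s * x) ^ (1 / 3 : ℝ))
        * ((c⁻¹) ^ (((g : ℝ) + 1) / 2) * a) := by gcongr
    _ = Cb * (c⁻¹) ^ (((g : ℝ) + 1) / 2)
        * (Real.sqrt E.s * (E.s * x) ^ (1 / 3 : ℝ) * a) := by ring
    _ ≤ _ := by gcongr

/-- All iterates stay sparse, and their errors follow the recursion of the rates. The constant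
`D g` multiplies the rate of round `g`. -/
theorem iterates (h : E.InRegime c cb Cb w) (hc : 0 < c) (hCb : 0 ≤ Cb)
    (hP : E.pop.Regular τ f₁ f₂ l₀ c₁ α lamMin lamMax) (hK : IsSmoothingKernel K)
    (hα₀ : 0 < α) (hα₁ : α < 1) (hlamMin : 0 < lamMin) {A₁ A₂ A₃ : ℝ} (hA₁ : 0 ≤ A₁)
    (hA₂ : 0 ≤ A₂) (hA₃ : 0 ≤ A₃) {ω : E.Ω} (hscore : E.ScoreEvent τ A₁ ω)
    (hincr : E.IncrEvent A₂ ω) (hhess : E.HessEvent K A₃ ω)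
    (hb : Real.sqrt E.s * (A₃ * E.b) ≤ lamMin * α / 24) {t : ℕ} {C D : ℕ → ℝ}
    (hD : ∀ g ≤ t, 0 ≤ D g) (hDC : ∀ g < t, D (g + 1) = 3 / lamMin * C (g + 1))
    (hDb : ∀ g < t, (A₂ + A₃) * D g * (Real.sqrt E.s * E.b) ≤ 1)
    (hDlog : ∀ g < t, 2 * D g ≤ Real.log E.N)
    (hC₁ : ∀ g < t, 8 / α * (A₁ + 4) ≤ C (g + 1))
    (hC₂ : ∀ g < t, 8 / α * ((A₂ + A₃) * (Cb * (c⁻¹) ^ (((t : ℝ) + 1) / 2)) * D g) ≤ C (g + 1))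
    {B : ℕ → E.Ω → Vec E.p} (hB : E.IsRun τ K C t B) (hsupp : SuppIn E.pop.S (E.beta0 ω))
    (hinit : E.err E.beta0 ω ≤ D 0 * E.initialRate) :
    ∀ g ≤ t, SuppIn E.pop.S (B g ω) ∧
      E.err (B g) ω ≤ D g * (Real.sqrt E.s * (E.noise + E.iterKappa g)) := by
  have hnoise := E.noise_nonneg
  have hb0 := h.b_pos
  intro g
  induction g with
  | zero =>
    intro ht
    rw [hB.1]
    refine ⟨hsupp, ?_⟩
    refine hinit.trans (mul_le_mul_of_nonneg_left ?_ (hD 0 ht))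
    rw [← E.sqrt_s_mul_sqrt]
    gcongr
    linarith [le_iterKappa_zero E]
  | succ g ih =>
    intro hg
    obtain ⟨ih₁, ih₂⟩ := ih (by omega)
    have hDg := hD g (by omega)
    have hκ := iterKappa_nonneg h g
    have hκ' := iterKappa_nonneg h (g + 1)
    have hl : 0 < Real.log E.N := by linarith [h.one_le_log]
    have hn : (0 : ℝ) < E.n := by linarith [h.one_le_n]
    have hN : (0 : ℝ) < E.N := by linarith [h.two_le_N]
    have hnoise₀ : 0 < E.noise := Real.sqrt_pos.2 (by positivity)
    have hc1 := h.one_le_inv hc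
    have hC : 0 < C (g + 1) := lt_of_lt_of_le (by positivity) (hC₁ g hg)
    have hlam : 0 < C (g + 1) * (E.noise + E.iterKappa (g + 1)) := by positivity
    have haR : D g * (Real.sqrt E.s * (E.noise + E.iterKappa g)) ≤ E.radius := by
      calc D g * (Real.sqrt E.s * (E.noise + E.iterKappa g))
          ≤ D g * (Real.sqrt E.s * (Real.sqrt (Real.log E.N / E.n)
            + Real.sqrt (Real.log E.N / E.n))) := by
            gcongr
            · exact h.noise_le_sqrt
            · exact h.iterKappa_le_sqrt hc g
        _ = 2 * D g * E.initialRate := by rw [← E.sqrt_s_mul_sqrt]; ring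
        _ ≤ E.radius := mul_le_mul_of_nonneg_right (hDlog g hg) (Real.sqrt_nonneg _)
    have hgrad : (A₁ + 3) * E.noise
        + (A₂ + A₃) * (E.b * (D g * (Real.sqrt E.s * (E.noise + E.iterKappa g))))
        ≤ α / 8 * (C (g + 1) * (E.noise + E.iterKappa (g + 1))) := by
      have h1 : (A₂ + A₃) * D g * (Real.sqrt E.s * E.b) * E.noise ≤ 1 * E.noise :=
        mul_le_mul_of_nonneg_right (hDb g hg) hnoise
      have h2 : (A₂ + A₃) * D g * (Real.sqrt E.s * E.b * E.iterKappa g)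
          ≤ (A₂ + A₃) * D g
            * (Cb * (c⁻¹) ^ (((t : ℝ) + 1) / 2) * E.iterKappa (g + 1)) := by
        refine mul_le_mul_of_nonneg_left
          ((h.sqrt_s_mul_b_mul_iterKappa_le hc hCb g).trans ?_) (by positivity)
        have hgt : (g : ℝ) ≤ t := by exact_mod_cast (by omega : g ≤ t)
        gcongr
      have h3 := mul_le_mul_of_nonneg_right (hC₁ g hg) hnoise
      have h4 := mul_le_mul_of_nonneg_right (hC₂ g hg) hκ'
      have h5 := mul_le_mul_of_nonneg_left (add_le_add h3 h4) (show 0 ≤ α / 8 by positivity)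
      have e5 : α / 8 * (8 / α * (A₁ + 4) * E.noise
          + 8 / α * ((A₂ + A₃) * (Cb * (c⁻¹) ^ (((t : ℝ) + 1) / 2)) * D g)
            * E.iterKappa (g + 1))
          = (A₁ + 4) * E.noise + (A₂ + A₃) * D g
            * (Cb * (c⁻¹) ^ (((t : ℝ) + 1) / 2) * E.iterKappa (g + 1)) := by
        field_simp
      rw [e5] at h5
      linarith
    obtain ⟨hex, hmin⟩ := h.one_round hP hK hα₀ hα₁ hlamMin hA₂ hA₃ hscore hincr hhess hb ih₁
      ih₂ haR hlam hgrad
    obtain ⟨k1, k2⟩ := hmin _ (hB.2 g (by omega) ω hex)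
    refine ⟨k1, k2.trans (le_of_eq ?_)⟩
    rw [hDC g hg]; ring

end InRegime

end Experiment

/-! ### Rates in probability -/

section Rates

variable {E : ℕ → Experiment} {ν c r : ℝ} {K : ℝ → ℝ} {τ f₁ f₂ l₀ c₁ α lamMin lamMax : ℝ}

/-- Outside an event of vanishing probability, which does not depend on the penalty constants or
the initial estimator, a sparse initial estimator with error at most `M₀ √(s log N / n)` leads to
the rate of the `t`-th iterate. -/
theorem exists_bad_event (hA : Asymptotics E ν c r) (hV : ∀ k, (E k).Valid)
    (hpop : ∀ k, (E k).pop.Regular τ f₁ f₂ l₀ c₁ α lamMin lamMax) (hK : IsSmoothingKernel K)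
    (hf₁ : 0 < f₁) (hc₁ : 0 < c₁) (hα₀ : 0 < α) (hα₁ : α < 1) (hlamMin : 0 < lamMin)
    (hlamMax : 0 < lamMax) (hτ₀ : 0 < τ) (hτ₁ : τ < 1) :
    ∃ bad : ∀ k, Set (E k).Ω, Tendsto (fun k => (E k).μ.real (bad k)) atTop (𝓝 0) ∧
      ∀ M₀, 0 ≤ M₀ → ∀ t, 1 ≤ t → ∃ Γ > 0, ∀ C, LargeConstants Γ t C → ∃ M > 0,
        ∀ᶠ k in atTop, ∀ B, (E k).IsRun τ K C t B → ∀ ω, ω ∉ bad k →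
          SuppIn (E k).pop.S ((E k).beta0 ω) →
          (E k).err (E k).beta0 ω ≤ M₀ * (E k).initialRate →
          (E k).err (B t) ω ≤ M * (E k).iterateRate t := by
  have hc := hA.c_pos
  obtain ⟨θ, hθ, G, hG, henv⟩ := Population.Regular.exists_envelopeBound (τ := τ) (f₂ := f₂)
    (l₀ := l₀) (α := α) (lamMin := lamMin) hf₁ hc₁ hlamMax
  have hE k : (E k).pop.EnvelopeBound θ G := henv (hpop k)
  obtain ⟨A₁, hA₁, T₁⟩ := exists_scoreEvent hA hV hpop hE hθ.le hG hτ₀ hτ₁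
  obtain ⟨A₂, hA₂, T₂⟩ := exists_incrEvent hA hV hpop hE hθ.le hG
  obtain ⟨A₃, hA₃, T₃⟩ := exists_hessEvent hA hV hpop hE hθ hG hK
  obtain ⟨cb, -, Cb, hCb, w, hreg⟩ := hA.exists_inRegime
  refine ⟨fun k => {ω | ¬ (E k).ScoreEvent τ A₁ ω} ∪ {ω | ¬ (E k).IncrEvent A₂ ω} ∪
    {ω | ¬ (E k).HessEvent K A₃ ω}, ?_, ?_⟩
  · have h := (T₁.add T₂).add T₃
    rw [add_zero, add_zero] at h
    refine squeeze_zero (fun k => measureReal_nonneg) (fun k => ?_) h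
    exact (measureReal_union_le _ _).trans (by gcongr; exact measureReal_union_le _ _)
  intro M₀ hM₀ t ht
  set Q := Cb * (c⁻¹) ^ (((t : ℝ) + 1) / 2) with hQ
  have hQ0 : 0 < Q := by positivity
  -- `M₀` is the constant of the initial rate, `3 / lamMin * C g` that of the rate of round `g`
  set Γ := 1 + 8 / α * (A₁ + 4) + 8 / α * ((A₂ + A₃) * Q * (M₀ + 3 / lamMin)) with hΓ
  have hp1 : 0 ≤ 8 / α * (A₁ + 4) := by positivity
  have hp2 : 0 ≤ 8 / α * ((A₂ + A₃) * Q * M₀) := by positivity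
  have hp3 : 0 ≤ 8 / α * ((A₂ + A₃) * Q * (3 / lamMin)) := by positivity
  have hΓe : Γ = 1 + 8 / α * (A₁ + 4) + 8 / α * ((A₂ + A₃) * Q * M₀)
      + 8 / α * ((A₂ + A₃) * Q * (3 / lamMin)) := by rw [hΓ]; ring
  have hΓ1 : 1 ≤ Γ := by linarith
  refine ⟨Γ, by linarith, fun C hC => ?_⟩
  have hCΓ : ∀ g < t, Γ ≤ C (g + 1) := by
    intro g hg
    induction g with
    | zero => exact hC.1
    | succ g ih =>
      have h1 := ih (by omega)
      have h2 := hC.2 (g + 1) (by omega) hg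
      nlinarith
  let D : ℕ → ℝ := fun g => if g = 0 then M₀ else 3 / lamMin * C g
  have hD0 : D 0 = M₀ := rfl
  have hDs g : D (g + 1) = 3 / lamMin * C (g + 1) := rfl
  have hD : ∀ g ≤ t, 0 ≤ D g := by
    intro g hg
    cases g with
    | zero => exact hM₀
    | succ g =>
      have := hCΓ g (by omega)
      rw [hDs]
      exact mul_nonneg (by positivity) (by linarith)
  have hC₂ : ∀ g < t, 8 / α * ((A₂ + A₃) * Q * D g) ≤ C (g + 1) := by
    intro g hg
    cases g with
    | zero =>
      rw [hD0]
      linarith [hCΓ 0 hg]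
    | succ g =>
      have h1 := hCΓ g (by omega)
      have h2 := hC.2 (g + 1) (by omega) hg
      have h3 : 8 / α * ((A₂ + A₃) * Q * (3 / lamMin)) ≤ Γ := by linarith
      rw [hDs]
      calc _ = 8 / α * ((A₂ + A₃) * Q * (3 / lamMin)) * C (g + 1) := by ring
        _ ≤ Γ * C (g + 1) := by gcongr; linarith
        _ ≤ _ := h2
  obtain ⟨t, rfl⟩ : ∃ u, t = u + 1 := ⟨t - 1, by omega⟩
  refine ⟨D (t + 1), ?_, ?_⟩
  · have := hCΓ t (by omega)
    rw [hDs]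
    exact mul_pos (by positivity) (by linarith)
  have hsb := hA.tendsto_sqrt_s_mul_b
  have hev₁ : ∀ᶠ k in atTop, Real.sqrt (E k).s * (A₃ * (E k).b) ≤ lamMin * α / 24 := by
    have h := hsb.const_mul A₃
    rw [mul_zero] at h
    filter_upwards [h.eventually_le_const (show 0 < lamMin * α / 24 by positivity)] with k hk
    linarith
  have hev₂ : ∀ᶠ k in atTop, ∀ g ∈ Finset.range (t + 1),
      (A₂ + A₃) * D g * (Real.sqrt (E k).s * (E k).b) ≤ 1 := by
    rw [Filter.eventually_all_finset]
    intro g _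
    have h := hsb.const_mul ((A₂ + A₃) * D g)
    rw [mul_zero] at h
    exact h.eventually_le_const one_pos
  have hev₃ : ∀ᶠ k in atTop, ∀ g ∈ Finset.range (t + 1), 2 * D g ≤ Real.log (E k).N := by
    rw [Filter.eventually_all_finset]
    exact fun g _ => (tendsto_log_N hA.N_top).eventually_ge_atTop _
  filter_upwards [hreg, hev₁, hev₂, hev₃] with k hk h₁ h₂ h₃ B hB ω hω hsupp hinit
  simp only [Set.mem_union, Set.mem_ofPred_eq, not_or, not_not] at hω
  obtain ⟨⟨hω₁, hω₂⟩, hω₃⟩ := hω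
  have h := (hk.iterates hc hCb.le (hpop k) hK hα₀ hα₁ hlamMin hA₁.le hA₂.le hA₃.le hω₁ hω₂ hω₃
    h₁ hD (fun g _ => hDs g) (fun g hg => h₂ g (Finset.mem_range.2 hg))
    (fun g hg => h₃ g (Finset.mem_range.2 hg)) (fun g hg => by linarith [hCΓ g hg]) hC₂ hB hsupp
    hinit (t + 1) le_rfl).2
  rwa [mul_add, (E k).sqrt_s_mul_noise, hk.sqrt_s_mul_iterKappa] at h

theorem tendsto_prob_not {s : ∀ k, Set (E k).Ω} (hV : ∀ k, (E k).Valid)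
    (hs : ∀ k, MeasurableSet (s k)) (h : Tendsto (fun k => (E k).μ.real (s k)) atTop (𝓝 1)) :
    Tendsto (fun k => (E k).μ.real (s k)ᶜ) atTop (𝓝 0) := by
  have e k : (E k).μ.real (s k)ᶜ = 1 - (E k).μ.real (s k) := by
    have := (hV k).prob
    exact probReal_compl_eq_one_sub (hs k)
  simp only [e]
  simpa using h.const_sub 1

theorem attainsRate_iterateRate (hA : Asymptotics E ν c r) (hV : ∀ k, (E k).Valid)
    (hpop : ∀ k, (E k).pop.Regular τ f₁ f₂ l₀ c₁ α lamMin lamMax) (hK : IsSmoothingKernel K)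
    (hf₁ : 0 < f₁) (hc₁ : 0 < c₁) (hα₀ : 0 < α) (hα₁ : α < 1) (hlamMin : 0 < lamMin)
    (hlamMax : 0 < lamMax) (hτ₀ : 0 < τ) (hτ₁ : τ < 1)
    (hinit : IsBigOP E (fun k => (E k).err (E k).beta0) (fun k => (E k).initialRate))
    (hsupp : Tendsto (fun k => (E k).μ.real
      {ω | supp ((E k).beta0 ω) ⊆ (E k).pop.S}) atTop (𝓝 1)) {t : ℕ} (ht : 1 ≤ t) :
    AttainsRate E τ K t (fun k => (E k).iterateRate t) := by
  obtain ⟨bad, hbad, hmain⟩ := exists_bad_event hA hV hpop hK hf₁ hc₁ hα₀ hα₁ hlamMin hlamMax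
    hτ₀ hτ₁
  have hns := tendsto_prob_not hV (fun k => by
    have e : {ω | supp ((E k).beta0 ω) ⊆ (E k).pop.S}
        = ⋂ j ∈ {j | j ∉ (E k).pop.S}, {ω | (E k).beta0 ω j = 0} := by
      ext ω
      simp only [Set.mem_ofPred_eq, ← suppIn_iff, SuppIn, Set.mem_iInter]
    rw [e]
    refine MeasurableSet.biInter (Set.to_countable _) fun j _ => ?_
    exact measurableSet_eq_fun ((measurable_pi_apply j).comp (hV k).measurable_beta0)
      measurable_const) hsupp
  have hrest := hbad.add hns
  rw [add_zero] at hrest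
  -- the exceptional set of the `t`-th iterate, in terms of that of the initial estimator
  have hincl (M₀ M : ℝ) (k : ℕ) (B : ℕ → (E k).Ω → Vec (E k).p)
      (h : ∀ ω, ω ∉ bad k → SuppIn (E k).pop.S ((E k).beta0 ω) →
        (E k).err (E k).beta0 ω ≤ M₀ * (E k).initialRate →
        (E k).err (B t) ω ≤ M * (E k).iterateRate t) :
      (E k).μ.real {ω | M * (E k).iterateRate t < (E k).err (B t) ω}
        ≤ (E k).μ.real (bad k)
          + (E k).μ.real {ω | supp ((E k).beta0 ω) ⊆ (E k).pop.S}ᶜ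
          + (E k).μ.real {ω | M₀ * (E k).initialRate < (E k).err (E k).beta0 ω} := by
    have := (hV k).prob
    refine (measureReal_mono ?_ (measure_ne_top _ _)).trans ((measureReal_union_le (_ ∪ _) _).trans
      (by gcongr; exact measureReal_union_le (bad k) _))
    intro ω hω
    by_contra hcon
    simp only [Set.mem_union, Set.mem_compl_iff, Set.mem_ofPred_eq, not_or, not_not, not_lt]
      at hcon hω
    exact absurd (h ω hcon.1.1 (suppIn_iff.2 hcon.1.2) hcon.2) (not_le.2 hω)
  constructor
  · intro ε hε
    obtain ⟨M₀, hM₀, hev⟩ := hinit (ε / 2) (by positivity)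
    obtain ⟨Γ, hΓ, hΓC⟩ := hmain M₀ hM₀.le t ht
    refine ⟨Γ, hΓ, fun C hC B hB => ?_⟩
    obtain ⟨M, hM, hrun⟩ := hΓC C hC
    refine ⟨M, hM, ?_⟩
    filter_upwards [hev, hrun, hrest.eventually_le_const (half_pos hε)] with k h1 h2 h3
    have h4 := hincl M₀ M k (B k) (h2 (B k) (hB k))
    have h5 (ω : (E k).Ω) : |(E k).err (E k).beta0 ω| = (E k).err (E k).beta0 ω :=
      abs_of_nonneg (l2norm_nonneg _)
    simp only [h5] at h1
    linarith
  · rintro ⟨M₀, hM₀⟩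
    obtain ⟨Γ, hΓ, hΓC⟩ := hmain (max M₀ 0) (le_max_right _ _) t ht
    have hni := tendsto_prob_not hV
      (s := fun k => {ω | (E k).err (E k).beta0 ω ≤ M₀ * (E k).initialRate})
      (fun k => measurableSet_le
      (continuous_l2norm.measurable.comp ((hV k).measurable_beta0.sub_const _))
      measurable_const) hM₀
    refine ⟨Γ, hΓ, fun C hC B hB ε hε => ?_⟩
    obtain ⟨M, hM, hrun⟩ := hΓC C hC
    refine ⟨M, hM, ?_⟩
    filter_upwards [hrun, hrest.eventually_le_const (half_pos hε),
      hni.eventually_le_const (half_pos hε)] with k h2 h3 h6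
    have h4 := hincl (max M₀ 0) M k (B k) (h2 (B k) (hB k))
    have h5 (ω : (E k).Ω) : |(E k).err (B k t) ω| = (E k).err (B k t) ω :=
      abs_of_nonneg (l2norm_nonneg _)
    simp only [h5]
    have h7 : (E k).μ.real {ω | max M₀ 0 * (E k).initialRate < (E k).err (E k).beta0 ω}
        ≤ (E k).μ.real {ω | (E k).err (E k).beta0 ω ≤ M₀ * (E k).initialRate}ᶜ := by
      have := (hV k).prob
      refine measureReal_mono (fun ω hω => ?_) (measure_ne_top _ _)
      simp only [Set.mem_compl_iff, Set.mem_ofPred_eq, not_le] at hω ⊢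
      refine lt_of_le_of_lt ?_ hω
      exact mul_le_mul_of_nonneg_right (le_max_left _ _) (Real.sqrt_nonneg _)
    linarith

/-- A rate may be replaced by one of at least the same order. -/
theorem AttainsRate.mono (hV : ∀ k, (E k).Valid) {t : ℕ} {ρ ρ' : ℕ → ℝ}
    (h : AttainsRate E τ K t ρ) {a : ℝ} (ha : 0 < a) (hρ : ∀ᶠ k in atTop, ρ k ≤ a * ρ' k) :
    AttainsRate E τ K t ρ' := by
  have key {M : ℝ} (hM : 0 < M) {k : ℕ} (hk : ρ k ≤ a * ρ' k) (Z : (E k).Ω → ℝ) :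
      (E k).μ.real {ω | M * a * ρ' k < Z ω} ≤ (E k).μ.real {ω | M * ρ k < Z ω} := by
    have := (hV k).prob
    refine measureReal_mono (fun ω hω => ?_) (measure_ne_top _ _)
    simp only [Set.mem_ofPred_eq] at hω ⊢
    refine lt_of_le_of_lt ?_ hω
    rw [mul_assoc]
    gcongr
  constructor
  · intro ε hε
    obtain ⟨Γ, hΓ, hC⟩ := h.1 ε hε
    refine ⟨Γ, hΓ, fun C hlarge B hB => ?_⟩
    obtain ⟨M, hM, hev⟩ := hC C hlarge B hB
    refine ⟨M * a, by positivity, ?_⟩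
    filter_upwards [hev, hρ] with k h1 h2
    exact (key hM h2 _).trans h1
  · intro hinit
    obtain ⟨Γ, hΓ, hC⟩ := h.2 hinit
    refine ⟨Γ, hΓ, fun C hlarge B hB ε hε => ?_⟩
    obtain ⟨M, hM, hev⟩ := hC C hlarge B hB ε hε
    refine ⟨M * a, by positivity, ?_⟩
    filter_upwards [hev, hρ] with k h1 h2
    exact (key hM h2 _).trans h1

end Rates

end DHSQR

theorem theorem2
    -- quantile level and kernel
    (τ : ℝ) (hτ₀ : 0 < τ) (hτ₁ : τ < 1) (K : ℝ → ℝ) (hK : DHSQR.IsSmoothingKernel K)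
    -- constants that do not change with the sample size
    (f₁ f₂ l₀ c₁ α lamMin lamMax ν c r : ℝ) (hf₁ : 0 < f₁) (hf₁₂ : f₁ ≤ f₂) (hc₁ : 0 < c₁)
    (hα₀ : 0 < α) (hα₁ : α < 1) (hlamMin : 0 < lamMin) (hlamMax : 0 < lamMax)
    (hν : 0 < ν) (hc_pos : 0 < c) (hc_lt : c < 1) (hr₀ : 0 ≤ r) (hr₁ : r < 1 / 3)
    -- a sequence of experiments whose total sample size tends to infinity
    (E : ℕ → DHSQR.Experiment) (hE : ∀ k, (E k).Valid)
    (hpop : ∀ k, (E k).pop.Regular τ f₁ f₂ l₀ c₁ α lamMin lamMax)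
    (hN : Tendsto (fun k => (E k).N) atTop atTop)
    -- dimension, local sample size, sparsity
    (hp : (fun k => ((E k).p : ℝ)) =O[atTop] fun k => ((E k).N : ℝ) ^ ν)
    (hn : ∀ k, ((E k).N : ℝ) ^ c ≤ (E k).n)
    (hs : (fun k => ((E k).s : ℝ)) =O[atTop] fun k => ((E k).n : ℝ) ^ r)
    -- bandwidths
    (hh : (fun k => (E k).h) =Θ[atTop]
      fun k => ((E k).s * Real.log (E k).N / (E k).N) ^ (1 / 3 : ℝ))
    (hb : (fun k => (E k).b) =Θ[atTop]
      fun k => ((E k).s * Real.log (E k).n / (E k).n) ^ (1 / 3 : ℝ))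
    -- initial estimator
    (hinit : DHSQR.IsBigOP E (fun k => (E k).err (E k).beta0) (fun k => (E k).initialRate))
    (hsupp : Tendsto (fun k => (E k).μ.real
      {ω | DHSQR.supp ((E k).beta0 ω) ⊆ (E k).pop.S}) atTop (𝓝 1)) :
    -- the rate of the iterates
    (∀ t, 1 ≤ t → DHSQR.AttainsRate E τ K t (fun k => (E k).iterateRate t)) ∧
    -- after enough rounds the first part of the rate dominates
    (∀ᶠ k in atTop, ∀ t, 1 ≤ t → (E k).EnoughRounds t →
      (E k).excessRate t ≤ (E k).oracleRate) ∧
    (∀ t, 1 ≤ t → (∀ᶠ k in atTop, (E k).EnoughRounds t) →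
      DHSQR.AttainsRate E τ K t (fun k => (E k).oracleRate)) ∧
    -- a constant number of rounds is enough
    (∃ T : ℕ, ∀ t, T ≤ t → ∀ᶠ k in atTop, (E k).EnoughRounds t) := by
  have hA : DHSQR.Asymptotics E ν c r :=
    ⟨hc_pos, hr₀, hr₁, hN, hp, hn, hs, fun k => (hE k).h_pos, fun k => (hE k).b_pos, hh, hb⟩
  have hrate {t : ℕ} (ht : 1 ≤ t) :=
    DHSQR.attainsRate_iterateRate hA hE hpop hK hf₁ hc₁ hα₀ hα₁ hlamMin hlamMax hτ₀ hτ₁ hinit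
      hsupp ht
  obtain ⟨cb, -, Cb, -, w, hreg⟩ := hA.exists_inRegime
  have hexcess : ∀ᶠ k in atTop, ∀ t, 1 ≤ t → (E k).EnoughRounds t →
      (E k).excessRate t ≤ (E k).oracleRate := by
    filter_upwards [hreg, hA.eventually_logGap] with k hk hgap t _ ht
    exact hk.excessRate_le hc_pos hgap ht
  refine ⟨fun t ht => hrate ht, hexcess, fun t ht hrounds => ?_, ⌈18 / c⌉₊, fun t ht => ?_⟩
  · refine (hrate ht).mono hE two_pos ?_
    filter_upwards [hexcess, hrounds] with k h1 h2
    have := h1 t ht h2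
    rw [DHSQR.Experiment.iterateRate]
    linarith
  · filter_upwards [hreg, hA.eventually_logGap] with k hk hgap
    exact hk.enoughRounds hc_pos hgap (Nat.ceil_le.1 ht)
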